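/- Let $d \ge 2$, let $\mathcal M$ be a $d$-dimensional $C^2$ submanifold (without boundary) of $\mathbb R^m$, with the Riemannian metric inherited from $\mathbb R^m$. Let $v$ be the Riemannian volume measure on $\mathcal M$ and let $\mathrm{dist}$ be the geodesic distance (the infimum of the lengths of curves in $\mathcal M$, equal to $\infty$ if there are none); write $B(x,r)=\{y\in\mathcal M:\mathrm{dist}(x,y)\le r\}$. For $D\subset\mathcal M$ let $D^o$ denote the interior of $D$ relative to $\mathcal M$ and $\partial D=\overline D\setminus D^o$. Let $A\subset\mathcal M$ be a compact $d$-dimensional $C^2$ submanifold-with-boundary of $\mathcal M$: for each $y\in\partial A$ there is a chart $g:U\to\mathcal M$ (with $U\subset\mathbb R^d$ open and $g$ a $C^2$ injective immersion that is open onto its image in $\mathcal M$) with $0\in U$, $g(0)=y$ and $g(U\cap\mathbb H)=g(U)\cap A$, where $\mathbb H=\mathbb R^{d-1}\times[0,\infty)$; the case $\partial A=\emptyset$ is allowed. Let $B\subset A$ be closed. Let $f$ be a probability density on $\mathcal M$ with respect to $v$ that vanishes outside $A$ and whose restriction to $A$ is continuous. Let $X_1,X_2,\dots$ be independent random points with common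 density $f$, and $\mathcal X_n=\{X_1,\dots,X_n\}$. For $n,k\in\mathbb N=\{1,2,\dots\}$ define the $k$-coverage threshold $$R_{n,k}=\inf\{r>0:\ \#(\mathcal X_n\cap B(x,r))\ge k\ \text{ for all } x\in B\},\qquad \inf\emptyset=+\infty .$$ Let $\theta_d=\pi^{d/2}/\Gamma(1+d/2)$, $f_0=\inf_{B}f$ and $f_1=\inf_{B\cap\partial A}f$, where $f_1=+\infty$ and $1/f_1=0$ if $B\cap\partial A=\emptyset$. Let $H(t)=1-t+t\log t$ for $t>0$ and $H(0)=1$. For $a,x\in[0,\infty)$ let $\hat H_a(x)$ be the unique $y\ge a$ with $yH(a/y)=x$ (with $\hat H_0(0)=0$). Assume that $f_0>0$, that $B=\overline{B^o}$, that $B\cap\partial A=\overline{B_A^o\cap\partial A}$, where $B_A^o=B\setminus\overline{A\setminus B}$ is the interior of $B$ relative to $A$, and that $\int_B f\,dv>0$. Let $\beta\in[0,\infty]$ and let $k:\mathbb N\to\mathbb N$ satisfy $k(n)/\log n\to\beta$ and $k(n)/n\to0$ as $n\to\infty$. Then, almost surely, as $n\to\infty$, $$\frac{n\theta_d R_{n,k(n)}^d}{k(n)}\to\max\Big(\frac1{f_0},\frac2{f_1}\Big)\quad\text{if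 }\beta=\infty,$$ $$\frac{n\theta_d R_{n,k(n)}^d}{\log n}\to\max\Big(\frac{\hat H_\beta(1)}{f_0},\frac{2\hat H_\beta(1-1/d)}{f_1}\Big)\quad\text{if }\beta<\infty.$$ In particular, for each constant $k\in\mathbb N$, almost surely, as $n\to\infty$, $$\frac{n\theta_d R_{n,k}^d}{\log n}\to\max\Big(\frac1{f_0},\frac{2-2/d}{f_1}\Big).$$ -/

import Mathlib

open MeasureTheory ProbabilityTheory Filter Topology
open scoped ENNReal NNReal

noncomputable section

namespace Coverage

/-- `(U, g)` is a chart of `M ⊆ ℝᵐ`: `U ⊆ ℝᵈ` is open, `g : U → M` is a `C²` injection which is an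
open map into `M` (with the subset topology), and `g'(u)` has full rank for all `u ∈ U`. Only the
values of `g` on `U` matter. -/
structure IsChart {d m : ℕ} (M : Set (EuclideanSpace ℝ (Fin m)))
    (U : Set (EuclideanSpace ℝ (Fin d)))
    (g : EuclideanSpace ℝ (Fin d) → EuclideanSpace ℝ (Fin m)) : Prop where
  isOpen : IsOpen U
  contDiffOn : ContDiffOn ℝ 2 g U
  injOn : Set.InjOn g U
  image_subset : g '' U ⊆ M
  isOpen_image : ∀ W ⊆ U, IsOpen W →
    ∃ V : Set (EuclideanSpace ℝ (Fin m)), IsOpen V ∧ g '' W = V ∩ M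
  fullRank : ∀ u ∈ U, Function.Injective (fderiv ℝ g u)

/-- `M` is a `d`-dimensional `C²` submanifold (without boundary) of `ℝᵐ`. -/
def IsC2Submanifold (d : ℕ) {m : ℕ} (M : Set (EuclideanSpace ℝ (Fin m))) : Prop :=
  M.Nonempty ∧ ∀ y ∈ M, ∃ (U : Set (EuclideanSpace ℝ (Fin d)))
    (g : EuclideanSpace ℝ (Fin d) → EuclideanSpace ℝ (Fin m)), IsChart M U g ∧ y ∈ g '' U

/-- The interior of `D` relative to `M`. -/
def relInterior {m : ℕ} (M D : Set (EuclideanSpace ℝ (Fin m))) :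
    Set (EuclideanSpace ℝ (Fin m)) :=
  M \ closure (M \ D)

/-- The boundary `∂D` of `D ⊆ M` relative to `M`. -/
def relBoundary {m : ℕ} (M D : Set (EuclideanSpace ℝ (Fin m))) :
    Set (EuclideanSpace ℝ (Fin m)) :=
  closure D \ relInterior M D

/-- The half-space `ℍ = ℝᵈ⁻¹ × [0, ∞)`: the last coordinate is nonnegative. -/
def halfSpace (d : ℕ) : Set (EuclideanSpace ℝ (Fin d)) :=
  {x | ∀ i : Fin d, (i : ℕ) + 1 = d → 0 ≤ x i}

/-- `A ⊆ M` is a `d`-dimensional `C²` submanifold-with-boundary of `M` (possibly `∂A = ∅`). -/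
def IsSubmanifoldWithBoundary (d : ℕ) {m : ℕ} (M A : Set (EuclideanSpace ℝ (Fin m))) : Prop :=
  A ⊆ M ∧ ∀ y ∈ relBoundary M A, ∃ (U : Set (EuclideanSpace ℝ (Fin d)))
    (g : EuclideanSpace ℝ (Fin d) → EuclideanSpace ℝ (Fin m)),
    IsChart M U g ∧ 0 ∈ U ∧ g 0 = y ∧ g '' (U ∩ halfSpace d) = g '' U ∩ A

/-- The Jacobian matrix of `g` at `u`. -/
def jacobian {d m : ℕ} (g : EuclideanSpace ℝ (Fin d) → EuclideanSpace ℝ (Fin m))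
    (u : EuclideanSpace ℝ (Fin d)) : Matrix (Fin m) (Fin d) ℝ :=
  Matrix.of fun i j => (fderiv ℝ g u (EuclideanSpace.single j 1)) i

/-- The volume density `D_g(u) = √(det (Jᵀ J))` of `g` at `u`. -/
def volumeDensity {d m : ℕ} (g : EuclideanSpace ℝ (Fin d) → EuclideanSpace ℝ (Fin m))
    (u : EuclideanSpace ℝ (Fin d)) : ℝ :=
  Real.sqrt ((jacobian g u).transpose * jacobian g u).det

/-- The volume measure in a chart: `D ↦ ∫_U 1_D(g(x)) D_g(x) dx`. -/
def chartVolume {d m : ℕ} (U : Set (EuclideanSpace ℝ (Fin d)))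
    (g : EuclideanSpace ℝ (Fin d) → EuclideanSpace ℝ (Fin m)) :
    Measure (EuclideanSpace ℝ (Fin m)) :=
  ((volume.restrict U).withDensity fun u => ENNReal.ofReal (volumeDensity g u)).map g

/-- The Riemannian volume measure of the `d`-dimensional submanifold `M`, as a measure on `ℝᵐ`
carried by `M`. By the change of variables formula the chart volumes of any two charts agree on the
intersection of their ranges, and countably many charts cover `M`; the least measure dominating all
chart volumes is therefore the measure obtained by gluing them, that is,
`D ↦ ∑ᵢ ∫_{Uᵢ} 1_D(gᵢ(x)) ψᵢ(gᵢ(x)) D_{gᵢ}(x) dx` for every countable atlas `(Uᵢ, gᵢ)` and every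
measurable partition of unity `ψᵢ` subordinate to it. -/
def riemannianVolume (d : ℕ) {m : ℕ} (M : Set (EuclideanSpace ℝ (Fin m))) :
    Measure (EuclideanSpace ℝ (Fin m)) :=
  ⨆ (U : Set (EuclideanSpace ℝ (Fin d)))
    (g : EuclideanSpace ℝ (Fin d) → EuclideanSpace ℝ (Fin m)) (_ : IsChart M U g),
    chartVolume U g

/-- The geodesic distance in `M`: the infimum of the lengths of the `C¹` curves in `M` from `x` to
`y`, which is `∞` if there are none. -/
def geodesicEDist {m : ℕ} (M : Set (EuclideanSpace ℝ (Fin m)))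
    (x y : EuclideanSpace ℝ (Fin m)) : ℝ≥0∞ :=
  ⨅ (γ : ℝ → EuclideanSpace ℝ (Fin m))
    (_ : ContDiffOn ℝ 1 γ (Set.Icc 0 1) ∧ Set.MapsTo γ (Set.Icc 0 1) M ∧ γ 0 = x ∧ γ 1 = y),
    ∫⁻ t in Set.Icc (0 : ℝ) 1, ‖derivWithin γ (Set.Icc 0 1) t‖ₑ

/-- The closed geodesic ball `B(x, r)` in `M`. -/
def geodesicBall {m : ℕ} (M : Set (EuclideanSpace ℝ (Fin m)))
    (x : EuclideanSpace ℝ (Fin m)) (r : ℝ≥0) : Set (EuclideanSpace ℝ (Fin m)) :=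
  {y ∈ M | geodesicEDist M x y ≤ r}

/-- The `k`-coverage threshold of `B` by the point set `S`: the infimum of the `r > 0` such that
every geodesic ball of radius `r` centred in `B` contains at least `k` points of `S`
(with `inf ∅ = ∞`). -/
def coverageThreshold {m : ℕ} (M B S : Set (EuclideanSpace ℝ (Fin m))) (k : ℕ) : ℝ≥0∞ :=
  ⨅ (r : ℝ≥0) (_ : 0 < r ∧ ∀ x ∈ B, (k : ℕ∞) ≤ (S ∩ geodesicBall M x r).encard), (r : ℝ≥0∞)

/-- The set of the first `n` sample points. -/
def sample {Ω : Type*} {m : ℕ} (X : ℕ → Ω → EuclideanSpace ℝ (Fin m)) (n : ℕ) (ω : Ω) :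
    Set (EuclideanSpace ℝ (Fin m)) :=
  (fun i => X i ω) '' Set.Iio n

/-- `f` is a probability density function on `M` with respect to the Riemannian volume, and is
supported by `A`. Only the values of `f` on `M` matter. -/
structure IsDensityOn (d : ℕ) {m : ℕ} (M A : Set (EuclideanSpace ℝ (Fin m)))
    (f : EuclideanSpace ℝ (Fin m) → ℝ) : Prop where
  nonneg : ∀ x ∈ M, 0 ≤ f x
  eq_zero : ∀ x ∈ M \ A, f x = 0
  lintegral_eq_one : ∫⁻ x, ENNReal.ofReal (f x) ∂(riemannianVolume d M) = 1

/-- The measure with density `f` with respect to the Riemannian volume of `M`. -/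
def densityMeasure (d : ℕ) {m : ℕ} (M : Set (EuclideanSpace ℝ (Fin m)))
    (f : EuclideanSpace ℝ (Fin m) → ℝ) : Measure (EuclideanSpace ℝ (Fin m)) :=
  (riemannianVolume d M).withDensity fun x => ENNReal.ofReal (f x)

/-- The infimum of the nonnegative function `f` over `S`, in `[0, ∞]`; it is `∞` if `S = ∅`. -/
def infOn {m : ℕ} (f : EuclideanSpace ℝ (Fin m) → ℝ) (S : Set (EuclideanSpace ℝ (Fin m))) :
    ℝ≥0∞ :=
  ⨅ x ∈ S, ENNReal.ofReal (f x)

/-- The volume `θ_d` of the unit ball in `ℝᵈ`. -/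
def unitBallVolume (d : ℕ) : ℝ :=
  Real.pi ^ ((d : ℝ) / 2) / Real.Gamma (1 + (d : ℝ) / 2)

/-- `H(t) = 1 - t + t log t` for `t > 0`, and `H(0) = 1`. -/
def rateH (t : ℝ) : ℝ :=
  if 0 < t then 1 - t + t * Real.log t else 1

/-- For `a, x ≥ 0`, `hatH a x` is the unique `y ≥ a` with `y H(a / y) = x` (and `hatH 0 0 = 0`):
the inverse of the increasing bijection `y ↦ y H(a / y)` from `[a, ∞)` to `[0, ∞)`. -/
def hatH (a x : ℝ) : ℝ :=
  Function.invFunOn (fun y : ℝ => y * rateH (a / y)) (Set.Ici a) x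

end Coverage

end

open Coverage

noncomputable section

namespace Coverage

/-! ### Binomial tails -/

/-! The threshold is at least r as soon as some ball of radius r centred in `B` holds fewer than `k`
sample points. The count in a ball is binomial with mean n μ(B(x,r)), where for small r the measure
is about f(x) θ_d r^d, and about half of that when x lies on ∂A. Take r^d = u t / n with t = log n
or t = k(n).

For t = log n, a ball with mean count c log n holds fewer than β log n points with probability
n^(-`rate c β`), up to powers of log n. There is room for about r^(-d), that is n / log n, disjoint
balls in the interior, but only for about r^(-(d-1)), that is (n / log n)^(1-1/d), along the
boundary. So deficient balls appear or not according as the rate is below or above 1 in the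
interior, where the worst c is u θ_d f_0, and below or above 1 - 1/d on the boundary, where the
worst c is u θ_d f_1 / 2. Inverting the rate by `hatH` gives the two terms, and their maximum
appears because both regions have to be covered. If k(n) / log n → ∞, the tails decay faster than
every power of n, the number of balls no longer matters, and the critical mean is k(n) itself.

Upper bounds (`ae_eventually_covered_log`, `ae_eventually_covered`): Chernoff's inequality and a
union bound over a net of mesh δr. At the logarithmic scale this yields only a small negative power
of n, so Borel–Cantelli is applied along n = j^K and the gaps are filled by monotonicity of counts
in n and in the ball. Lower bounds (`ae_eventually_not_covered_log`, `ae_eventually_not_covered`):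
counts in disjoint balls are negatively dependent (`measureReal_forall_le_hits_le`), so the
probability that none is deficient is at most a product; `eventually_le_one_sub_binomialTail` makes
it summable over all n.

Geometry enters only through `HasCovers` and `HasPackings`, proved in almost isometric charts that
carry `A` to everything or to a half-space (`exists_flat_local`): see `hasCovers`,
`hasPackings_interior`, `hasPackings_boundary`. All counting uses Euclidean balls; the geodesic
distance is at least the Euclidean one and, uniformly near the compact set `B`, at most 1 + η times
the scale (`exists_geodesicEDist_le`). `ae_tendsto_threshold` joins both sides. -/

/-- The probability that a binomial variable with parameters `n` and `p` is at least `k`. -/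
def binomialTail (p : ℝ) : ℕ → ℕ → ℝ
  | _, 0 => 1
  | 0, _ + 1 => 0
  | n + 1, k + 1 => (1 - p) * binomialTail p n (k + 1) + p * binomialTail p n k

@[simp] lemma binomialTail_zero_right (p : ℝ) (n : ℕ) : binomialTail p n 0 = 1 := by
  cases n <;> simp [binomialTail]

@[simp] lemma binomialTail_zero_succ (p : ℝ) (k : ℕ) : binomialTail p 0 (k + 1) = 0 := by
  simp [binomialTail]

lemma binomialTail_succ (p : ℝ) (n k : ℕ) :
    binomialTail p (n + 1) k =
      (1 - p) * binomialTail p n k + p * binomialTail p n (k - 1) := by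
  cases k <;> simp [binomialTail]

lemma binomialTail_nonneg {p : ℝ} (h0 : 0 ≤ p) (h1 : p ≤ 1) (n k : ℕ) :
    0 ≤ binomialTail p n k := by
  induction n generalizing k with
  | zero => cases k <;> simp
  | succ n ih =>
    rw [binomialTail_succ]
    have := ih k
    have := ih (k - 1)
    have : 0 ≤ 1 - p := by linarith
    positivity

lemma binomialTail_le_pred {p : ℝ} (h0 : 0 ≤ p) (h1 : p ≤ 1) (n k : ℕ) :
    binomialTail p n k ≤ binomialTail p n (k - 1) := by
  induction n generalizing k with
  | zero => rcases k with _ | _ | k <;> simp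
  | succ n ih =>
    rw [binomialTail_succ, binomialTail_succ]
    exact add_le_add (mul_le_mul_of_nonneg_left (ih k) (by linarith))
      (mul_le_mul_of_nonneg_left (ih (k - 1)) h0)

lemma binomialTail_mono {p q : ℝ} (h0 : 0 ≤ p) (hpq : p ≤ q) (h1 : q ≤ 1) (n k : ℕ) :
    binomialTail p n k ≤ binomialTail q n k := by
  induction n generalizing k with
  | zero => cases k <;> simp
  | succ n ih =>
    rw [binomialTail_succ, binomialTail_succ]
    have a := ih k
    have b := ih (k - 1)
    have c := binomialTail_le_pred (h0.trans hpq) h1 n k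
    nlinarith [mul_le_mul_of_nonneg_left a (show 0 ≤ 1 - p by linarith),
      mul_le_mul_of_nonneg_left b h0, mul_nonneg (sub_nonneg.2 hpq) (sub_nonneg.2 c)]

/-- Chernoff's bound for the upper tail, with 1 + p(s - 1) the generating function of one trial at
s. The right side satisfies the recursion of `binomialTail` with equality, so induction needs no
moments. -/
lemma binomialTail_le_pow {p s : ℝ} (h0 : 0 ≤ p) (h1 : p ≤ 1) (hs : 1 ≤ s) (n k : ℕ) :
    binomialTail p n k ≤ (s⁻¹) ^ k * (1 + p * (s - 1)) ^ n := by
  have hQ : 1 ≤ 1 + p * (s - 1) := by nlinarith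
  have hs0 : 0 < s := by linarith
  induction n generalizing k with
  | zero =>
    cases k with
    | zero => simp
    | succ k => simp; positivity
  | succ n ih =>
    cases k with
    | zero => simpa using one_le_pow₀ hQ
    | succ k =>
      have a := mul_le_mul_of_nonneg_left (ih (k + 1)) (show 0 ≤ 1 - p by linarith)
      have b := mul_le_mul_of_nonneg_left (ih k) h0
      simp only [binomialTail]
      refine (add_le_add a b).trans (le_of_eq ?_)
      rw [pow_succ, pow_succ]
      field_simp
      ring

/-- The same argument for the lower tail, with s ≤ 1. -/
lemma one_sub_binomialTail_le_pow {p s : ℝ} (h0 : 0 ≤ p) (h1 : p ≤ 1) (hs : 0 < s) (hs1 : s ≤ 1)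
    (n k : ℕ) : 1 - binomialTail p n k ≤ (s⁻¹) ^ k * (1 - p * (1 - s)) ^ n := by
  have hQ : 0 ≤ 1 - p * (1 - s) := by nlinarith
  induction n generalizing k with
  | zero =>
    cases k with
    | zero => simp
    | succ k =>
      simp only [binomialTail_zero_succ, sub_zero, pow_zero, mul_one]
      exact one_le_pow₀ ((one_le_inv₀ hs).2 hs1)
  | succ n ih =>
    cases k with
    | zero => simp; positivity
    | succ k =>
      have a := mul_le_mul_of_nonneg_left (ih (k + 1)) (show 0 ≤ 1 - p by linarith)
      have b := mul_le_mul_of_nonneg_left (ih k) h0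
      simp only [binomialTail]
      have e : 1 - ((1 - p) * binomialTail p n (k + 1) + p * binomialTail p n k) =
        (1 - p) * (1 - binomialTail p n (k + 1)) + p * (1 - binomialTail p n k) := by ring
      rw [e]
      refine (add_le_add a b).trans (le_of_eq ?_)
      rw [pow_succ, pow_succ]
      field_simp
      ring

/-- A single atom, the probability of exactly `j` successes, bounds the lower tail from below.
Pascal's rule matches the recursion. -/
lemma choose_mul_pow_le_one_sub_binomialTail {p : ℝ} (h0 : 0 ≤ p) (h1 : p ≤ 1) {n k j : ℕ}
    (hjk : j < k) (hjn : j ≤ n) :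
    (n.choose j : ℝ) * p ^ j * (1 - p) ^ (n - j) ≤ 1 - binomialTail p n k := by
  induction n generalizing k j with
  | zero =>
    obtain rfl : j = 0 := by omega
    obtain ⟨k, rfl⟩ : ∃ l, k = l + 1 := ⟨k - 1, by omega⟩
    simp
  | succ n ih =>
    obtain ⟨k, rfl⟩ : ∃ l, k = l + 1 := ⟨k - 1, by omega⟩
    have hp : 0 ≤ 1 - p := by linarith
    have e : 1 - binomialTail p (n + 1) (k + 1) =
        (1 - p) * (1 - binomialTail p n (k + 1)) + p * (1 - binomialTail p n k) := by
      simp only [binomialTail]; ring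
    rw [e]
    have nonneg : ∀ l, 0 ≤ 1 - binomialTail p n l := by
      intro l
      cases l with
      | zero => simp
      | succ l =>
        refine le_trans ?_ (ih (k := l + 1) (j := 0) (by omega) (by omega))
        positivity
    rcases Nat.eq_zero_or_pos j with rfl | hj
    · have a := mul_le_mul_of_nonneg_left (ih (k := k + 1) (j := 0) (by omega) (by omega)) hp
      have b := mul_nonneg h0 (nonneg k)
      simp only [Nat.choose_zero_right, Nat.cast_one, pow_zero, mul_one, one_mul, Nat.sub_zero,
        pow_succ] at a ⊢
      linarith
    · obtain ⟨i, rfl⟩ : ∃ l, j = l + 1 := ⟨j - 1, by omega⟩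
      have b := mul_le_mul_of_nonneg_left (ih (k := k) (j := i) (by omega) (by omega)) h0
      rcases Nat.lt_or_ge n (i + 1) with hn | hn
      · obtain rfl : n = i := by omega
        have a := mul_nonneg hp (nonneg (k + 1))
        simp only [Nat.choose_self, Nat.sub_self, pow_zero, Nat.cast_one, one_mul, mul_one,
          pow_succ] at b ⊢
        linarith
      · have a := mul_le_mul_of_nonneg_left (ih (k := k + 1) (j := i + 1) (by omega) hn) hp
        refine le_trans (le_of_eq ?_) (add_le_add a b)
        obtain ⟨l, rfl⟩ : ∃ l, n = i + 1 + l := ⟨n - (i + 1), by omega⟩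
        have e1 : i + 1 + l + 1 - (i + 1) = l + 1 := by omega
        have e2 : i + 1 + l - (i + 1) = l := by omega
        have e3 : i + 1 + l - i = l + 1 := by omega
        rw [e1, e2, e3, Nat.choose_succ_succ' (i + 1 + l) i]
        push_cast
        ring

/-- These are the terms of order zero and one in `b` of the expanded product; the others are
nonnegative. In the next section `a` is a binomial tail after n trials and `b` its increment at
trial n + 1. -/
lemma prod_add_sum_le_prod_add {ι : Type*} [DecidableEq ι] (T : Finset ι) {a b : ι → ℝ}
    (ha : ∀ i, 0 ≤ a i) (hb : ∀ i, 0 ≤ b i) :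
    ∏ i ∈ T, a i + ∑ i ∈ T, b i * ∏ j ∈ T.erase i, a j ≤ ∏ i ∈ T, (a i + b i) := by
  induction T using Finset.induction_on with
  | empty => simp
  | insert c T hc ih =>
    rw [Finset.prod_insert hc, Finset.prod_insert hc, Finset.sum_insert hc,
      Finset.erase_insert hc]
    have e : ∑ i ∈ T, b i * ∏ j ∈ (insert c T).erase i, a j =
        a c * ∑ i ∈ T, b i * ∏ j ∈ T.erase i, a j := by
      rw [Finset.mul_sum]
      refine Finset.sum_congr rfl fun i hi => ?_
      have hic : i ≠ c := fun h => hc (h ▸ hi)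
      rw [Finset.erase_insert_of_ne hic.symm, Finset.prod_insert (by simp [hc])]
      ring
    rw [e]
    have h1 : ∏ i ∈ T, a i ≤ ∏ i ∈ T, (a i + b i) :=
      Finset.prod_le_prod (fun i _ => ha i) fun i _ => by linarith [hb i]
    nlinarith [mul_le_mul_of_nonneg_left ih (ha c), mul_le_mul_of_nonneg_left h1 (hb c)]

/-! ### Numbers of sample points in given sets -/

section Hits

variable {Ω E : Type*}

open Classical in
/-- The number of indices `i < n` for which `X i ω` lies in `S`. -/
def hits (X : ℕ → Ω → E) (n : ℕ) (S : Set E) (ω : Ω) : ℕ :=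
  ∑ i ∈ Finset.range n, if X i ω ∈ S then 1 else 0

@[simp] lemma hits_zero (X : ℕ → Ω → E) (S : Set E) (ω : Ω) : hits X 0 S ω = 0 := by
  simp [hits]

open Classical in
lemma hits_succ (X : ℕ → Ω → E) (n : ℕ) (S : Set E) (ω : Ω) :
    hits X (n + 1) S ω = hits X n S ω + if X n ω ∈ S then 1 else 0 := by
  rw [hits, hits, Finset.sum_range_succ]

lemma hits_mono (X : ℕ → Ω → E) {n n' : ℕ} (hn : n ≤ n') {S S' : Set E} (hS : S ⊆ S') (ω : Ω) :
    hits X n S ω ≤ hits X n' S' ω := by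
  classical
  unfold hits
  refine (Finset.sum_le_sum fun i _ => ?_).trans
    (Finset.sum_le_sum_of_subset (Finset.range_subset_range.2 hn))
  split_ifs with h1 h2 <;> simp_all
  exact h2 (hS h1)

variable [MeasurableSpace Ω] [MeasurableSpace E] {P : Measure Ω}
  {μ : Measure E} {X : ℕ → Ω → E}

lemma measurable_card_hits {n : ℕ} {S : Set E} (hS : MeasurableSet S) [DecidablePred (· ∈ S)] :
    Measurable fun z : Finset.range n → E => ∑ i, if z i ∈ S then 1 else 0 := by
  refine Finset.measurable_fun_sum _ fun i _ => ?_
  exact Measurable.ite (measurable_pi_apply i hS) measurable_const measurable_const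

/-- The counts involve only the points with index below n, which are independent of `X n`. This is
the conditioning step of both inductions on n that follow. -/
lemma measureReal_hits_inter (hX : ∀ i, Measurable (X i)) (hind : iIndepFun X P)
    (hlaw : ∀ i, P.map (X i) = μ) {ι : Type*} (T : Finset ι) {S : ι → Set E}
    (hS : ∀ i, MeasurableSet (S i)) (n : ℕ) (Q : ι → Set ℕ) {S' : Set E} (hS' : MeasurableSet S') :
    P.real ({ω | ∀ i ∈ T, hits X n (S i) ω ∈ Q i} ∩ X n ⁻¹' S') =
      P.real {ω | ∀ i ∈ T, hits X n (S i) ω ∈ Q i} * μ.real S' := by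
  classical
  have h := hind.indepFun_finset (Finset.range n) {n} (by simp) hX
  have hQ : MeasurableSet {z : Finset.range n → E |
      ∀ i ∈ T, (∑ j, if z j ∈ S i then 1 else 0) ∈ Q i} := by
    have : {z : Finset.range n → E | ∀ i ∈ T, (∑ j, if z j ∈ S i then 1 else 0) ∈ Q i} =
        ⋂ i ∈ T, (fun z : Finset.range n → E => ∑ j, if z j ∈ S i then 1 else 0) ⁻¹' (Q i) := by
      ext z; simp
    rw [this]
    exact Finset.measurableSet_biInter _ fun i _ =>
      measurable_card_hits (hS i) (MeasurableSet.of_discrete)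
  have hR : MeasurableSet {z : ({n} : Finset ℕ) → E | z ⟨n, by simp⟩ ∈ S'} :=
    measurable_pi_apply _ hS'
  have key := h.measure_inter_preimage_eq_mul _ _ hQ hR
  have e1 : (fun ω (i : Finset.range n) => X i ω) ⁻¹' {z : Finset.range n → E |
      ∀ i ∈ T, (∑ j, if z j ∈ S i then 1 else 0) ∈ Q i} =
      {ω | ∀ i ∈ T, hits X n (S i) ω ∈ Q i} := by
    ext ω
    simp only [Set.mem_preimage, Set.mem_ofPred_eq, hits]
    refine forall₂_congr fun i _ => ?_
    rw [Finset.sum_coe_sort (Finset.range n) fun j => if X j ω ∈ S i then 1 else 0]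
  have e2 : (fun ω (i : ({n} : Finset ℕ)) => X i ω) ⁻¹'
      {z : ({n} : Finset ℕ) → E | z ⟨n, by simp⟩ ∈ S'} = X n ⁻¹' S' := rfl
  rw [e1, e2] at key
  rw [Measure.real, key, ENNReal.toReal_mul, ← hlaw n, Measure.real, Measure.real,
    Measure.map_apply (hX n) hS']

variable [IsProbabilityMeasure P]

/-- Negative orthant dependence of the numbers of sample points in disjoint sets. -/
lemma measureReal_forall_le_hits_le (hX : ∀ i, Measurable (X i)) (hind : iIndepFun X P)
    (hlaw : ∀ i, P.map (X i) = μ) {ι : Type*} (T : Finset ι) {S : ι → Set E}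
    (hS : ∀ i, MeasurableSet (S i)) (hdisj : (T : Set ι).PairwiseDisjoint S) (n : ℕ) (k : ι → ℕ) :
    P.real {ω | ∀ i ∈ T, k i ≤ hits X n (S i) ω} ≤
      ∏ i ∈ T, binomialTail (μ.real (S i)) n (k i) := by
  classical
  have : IsProbabilityMeasure μ := hlaw 0 ▸ Measure.isProbabilityMeasure_map (hX 0).aemeasurable
  induction n generalizing k with
  | zero =>
    by_cases h : ∀ i ∈ T, k i = 0
    · rw [Finset.prod_eq_one fun i hi => by rw [h i hi, binomialTail_zero_right]]
      exact measureReal_le_one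
    · push Not at h
      obtain ⟨i, hi, hk⟩ := h
      have : {ω | ∀ i ∈ T, k i ≤ hits X 0 (S i) ω} = ∅ := by
        ext ω
        simp only [hits_zero, Set.mem_ofPred_eq, Set.mem_empty_iff_false, iff_false]
        exact fun h => hk (Nat.le_zero.1 (h i hi))
      rw [this, measureReal_empty]
      exact Finset.prod_nonneg fun i _ =>
        binomialTail_nonneg measureReal_nonneg measureReal_le_one _ _
  | succ n ih =>
    set p : ι → ℝ := fun i => μ.real (S i) with hp
    -- By disjointness the new point falls in none of the sets or in exactly one `S c`, and in the
    -- latter case only the requirement `k c` drops by one.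
    set S₀ : Set E := (⋃ i ∈ T, S i)ᶜ with hS₀
    have hS₀m : MeasurableSet S₀ := (Finset.measurableSet_biUnion _ fun i _ => hS i).compl
    have hp₀ : μ.real S₀ = 1 - ∑ i ∈ T, p i := by
      rw [hS₀, probReal_compl_eq_one_sub (Finset.measurableSet_biUnion _ fun i _ => hS i),
        measureReal_biUnion_finset hdisj fun i _ => hS i]
    have hsub : {ω | ∀ i ∈ T, k i ≤ hits X (n + 1) (S i) ω} ⊆
        ({ω | ∀ i ∈ T, hits X n (S i) ω ∈ Set.Ici (k i)} ∩ X n ⁻¹' S₀) ∪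
        ⋃ c ∈ T, ({ω | ∀ i ∈ T, hits X n (S i) ω ∈
          Set.Ici (Function.update k c (k c - 1) i)} ∩ X n ⁻¹' (S c)) := by
      intro ω hω
      by_cases h : X n ω ∈ S₀
      · refine Or.inl ⟨fun i hi => ?_, h⟩
        have hi' : X n ω ∉ S i := fun h' => h (Set.mem_biUnion hi h')
        simpa [hits_succ, hi'] using hω i hi
      · simp only [hS₀, Set.mem_compl_iff, not_not, Set.mem_iUnion, exists_prop] at h
        obtain ⟨c, hc, hcX⟩ := h
        refine Or.inr (Set.mem_biUnion hc ⟨fun i hi => ?_, hcX⟩)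
        have := hω i hi
        rw [hits_succ] at this
        by_cases hic : i = c
        · subst hic
          simp only [hcX, if_true] at this
          simp only [Function.update_self, Set.mem_Ici]
          omega
        · have hi' : X n ω ∉ S i := fun h' =>
            Set.disjoint_left.1 (hdisj hi hc hic) h' hcX
          simpa [hi', hic] using this
    have hu : ∀ i, 0 ≤ binomialTail (p i) n (k i) := fun i =>
      binomialTail_nonneg measureReal_nonneg measureReal_le_one _ _
    have hw : ∀ i, 0 ≤ p i * (binomialTail (p i) n (k i - 1) - binomialTail (p i) n (k i)) :=
      fun i => mul_nonneg measureReal_nonneg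
        (sub_nonneg.2 (binomialTail_le_pred measureReal_nonneg measureReal_le_one _ _))
    calc P.real {ω | ∀ i ∈ T, k i ≤ hits X (n + 1) (S i) ω}
      ≤ P.real ({ω | ∀ i ∈ T, hits X n (S i) ω ∈ Set.Ici (k i)} ∩ X n ⁻¹' S₀) +
        ∑ c ∈ T, P.real ({ω | ∀ i ∈ T, hits X n (S i) ω ∈
          Set.Ici (Function.update k c (k c - 1) i)} ∩ X n ⁻¹' (S c)) :=
        (measureReal_mono hsub).trans ((measureReal_union_le _ _).trans
          (add_le_add le_rfl (measureReal_biUnion_finset_le _ _)))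
      _ = P.real {ω | ∀ i ∈ T, hits X n (S i) ω ∈ Set.Ici (k i)} * (1 - ∑ i ∈ T, p i) +
        ∑ c ∈ T, P.real {ω | ∀ i ∈ T, hits X n (S i) ω ∈
          Set.Ici (Function.update k c (k c - 1) i)} * p c := by
        rw [measureReal_hits_inter hX hind hlaw T hS n _ hS₀m, hp₀]
        congr 1
        exact Finset.sum_congr rfl fun c _ =>
          measureReal_hits_inter hX hind hlaw T hS n _ (hS c)
      _ ≤ (∏ i ∈ T, binomialTail (p i) n (k i)) * (1 - ∑ i ∈ T, p i) +
        ∑ c ∈ T, (binomialTail (p c) n (k c - 1) *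
          ∏ i ∈ T.erase c, binomialTail (p i) n (k i)) * p c := by
        refine add_le_add (mul_le_mul_of_nonneg_right (ih k) ?_) (Finset.sum_le_sum fun c hc => ?_)
        · rw [← hp₀]; exact measureReal_nonneg
        · refine mul_le_mul_of_nonneg_right ((ih (Function.update k c (k c - 1))).trans
            (le_of_eq ?_)) measureReal_nonneg
          rw [← Finset.mul_prod_erase T _ hc]
          simp only [Function.update_self]
          congr 1
          refine Finset.prod_congr rfl fun i hi => ?_
          rw [Function.update_of_ne (Finset.ne_of_mem_erase hi)]
      _ = ∏ i ∈ T, binomialTail (p i) n (k i) +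
        ∑ c ∈ T, (p c * (binomialTail (p c) n (k c - 1) - binomialTail (p c) n (k c))) *
          ∏ i ∈ T.erase c, binomialTail (p i) n (k i) := by
        rw [mul_sub, mul_one, Finset.mul_sum, sub_add, ← Finset.sum_sub_distrib, sub_eq_add_neg,
          ← Finset.sum_neg_distrib]
        congr 1
        refine Finset.sum_congr rfl fun c hc => ?_
        rw [← Finset.mul_prod_erase T _ hc]
        ring
      _ ≤ _ := by
        refine (prod_add_sum_le_prod_add T hu hw).trans (le_of_eq ?_)
        refine Finset.prod_congr rfl fun i _ => ?_
        rw [binomialTail_succ]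
        ring

lemma measureReal_hits_lt_le (hX : ∀ i, Measurable (X i)) (hind : iIndepFun X P)
    (hlaw : ∀ i, P.map (X i) = μ) {S : Set E} (hS : MeasurableSet S) (n k : ℕ) :
    P.real {ω | hits X n S ω < k} ≤ 1 - binomialTail (μ.real S) n k := by
  have : IsProbabilityMeasure μ := hlaw 0 ▸ Measure.isProbabilityMeasure_map (hX 0).aemeasurable
  induction n generalizing k with
  | zero =>
    cases k with
    | zero => simp
    | succ k => simp
  | succ n ih =>
    rcases Nat.eq_zero_or_pos k with rfl | hk
    · simp
    have hsub : {ω | hits X (n + 1) S ω < k} ⊆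
        ({ω | ∀ i ∈ ({()} : Finset Unit), hits X n S ω ∈ Set.Iio k} ∩ X n ⁻¹' Sᶜ) ∪
        ({ω | ∀ i ∈ ({()} : Finset Unit), hits X n S ω ∈ Set.Iio (k - 1)} ∩ X n ⁻¹' S) := by
      intro ω hω
      simp only [Set.mem_ofPred_eq, hits_succ] at hω
      by_cases h : X n ω ∈ S
      · refine Or.inr ⟨?_, h⟩
        simp only [h, if_true] at hω
        simp only [Set.mem_ofPred_eq, Set.mem_Iio]
        intros; omega
      · exact Or.inl ⟨by simpa [h] using hω, h⟩
    refine (measureReal_mono hsub).trans ((measureReal_union_le _ _).trans ?_)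
    rw [measureReal_hits_inter hX hind hlaw {()} (S := fun _ => S) (fun _ => hS) n
        (fun _ => Set.Iio k) hS.compl,
      measureReal_hits_inter hX hind hlaw {()} (S := fun _ => S) (fun _ => hS) n
        (fun _ => Set.Iio (k - 1)) hS, probReal_compl_eq_one_sub hS, binomialTail_succ]
    have a := mul_le_mul_of_nonneg_right (ih k) (show 0 ≤ 1 - μ.real S by
      linarith [measureReal_le_one (μ := μ) (s := S)])
    have b := mul_le_mul_of_nonneg_right (ih (k - 1)) (measureReal_nonneg (μ := μ) (s := S))
    simp only [Finset.mem_singleton, forall_const, Set.mem_Iio]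
    linarith

end Hits

/-! ### Large deviations and almost sure statements -/

/-- Stirling's sequence decreases, hence is at most its first term e/√2. The loss is polynomial in
`j`, which is harmless at exponential scale. -/
lemma factorial_le_pow_mul_exp (j : ℕ) :
    (j.factorial : ℝ) ≤ Real.exp 1 * (j + 1) * ((j : ℝ) ^ j * Real.exp (-j)) := by
  rcases Nat.eq_zero_or_pos j with rfl | hj
  · simp
  obtain ⟨i, rfl⟩ : ∃ i, j = i + 1 := ⟨j - 1, by omega⟩
  have h := Stirling.stirlingSeq'_antitone (Nat.zero_le i)
  simp only [Function.comp, Nat.succ_eq_add_one, zero_add, Stirling.stirlingSeq_one] at h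
  rw [Stirling.stirlingSeq, div_le_iff₀ (by positivity)] at h
  refine h.trans ?_
  have e1 : ((((i + 1 : ℕ) : ℝ)) / Real.exp 1) ^ (i + 1) =
      ((i + 1 : ℕ) : ℝ) ^ (i + 1) * Real.exp (-((i + 1 : ℕ) : ℝ)) := by
    rw [div_pow, ← Real.exp_nat_mul, mul_one, Real.exp_neg, div_eq_mul_inv]
  have e2 : √(2 * ((i + 1 : ℕ) : ℝ)) ≤ √2 * (((i + 1 : ℕ) : ℝ) + 1) := by
    rw [Real.sqrt_mul (by norm_num)]
    gcongr
    rw [Real.sqrt_le_left (by positivity)]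
    nlinarith [(Nat.cast_nonneg (i + 1) : (0 : ℝ) ≤ ((i + 1 : ℕ) : ℝ))]
  rw [e1, ← mul_assoc]
  refine mul_le_mul_of_nonneg_right ?_ (by positivity)
  calc Real.exp 1 / √2 * √(2 * ((i + 1 : ℕ) : ℝ))
      ≤ Real.exp 1 / √2 * (√2 * (((i + 1 : ℕ) : ℝ) + 1)) := by gcongr
    _ = _ := by field_simp

lemma tendsto_log_nat : Tendsto (fun n : ℕ => Real.log n) atTop atTop :=
  Real.tendsto_log_atTop.comp tendsto_natCast_atTop_atTop

lemma tendsto_log_sq_div_nat :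
    Tendsto (fun n : ℕ => Real.log n ^ 2 / n) atTop (𝓝 0) := by
  have h := (Real.isLittleO_pow_log_id_atTop (n := 2)).tendsto_div_nhds_zero
  exact h.comp tendsto_natCast_atTop_atTop

lemma exp_neg_le_one_sub_pow {p : ℝ} (h0 : 0 ≤ p) (h1 : p ≤ 1 / 2) (n : ℕ) :
    Real.exp (-(n * p + 2 * (n * p ^ 2))) ≤ (1 - p) ^ n := by
  have hp : 0 < 1 - p := by linarith
  rw [← Real.rpow_natCast (1 - p) n, Real.rpow_def_of_pos hp]
  refine Real.exp_le_exp.2 ?_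
  have a := Real.one_sub_inv_le_log_of_pos hp
  have b : -(p + 2 * p ^ 2) ≤ 1 - (1 - p)⁻¹ := by
    rw [le_sub_iff_add_le, ← le_sub_iff_add_le', inv_le_iff_one_le_mul₀ hp]
    nlinarith [mul_nonneg (mul_nonneg h0 h0) (show 0 ≤ 1 - 2 * p by linarith)]
  have c := mul_le_mul_of_nonneg_left (b.trans a) (Nat.cast_nonneg (α := ℝ) n)
  linarith

set_option maxHeartbeats 1000000 in
/-- Lower bound, with the right exponential rate, for the probability that a binomial variable
with mean `c log n` is at most `b log n`. -/
lemma eventually_le_one_sub_binomialTail {b c : ℝ} (hb : 0 ≤ b) (hbc : b < c) :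
    ∃ κ > 0, ∀ᶠ n : ℕ in atTop, ∀ k : ℕ, b * Real.log n < k →
      κ * Real.exp (-((c - b + b * Real.log (b / c)) * Real.log n)) / (Real.log n + 1) ≤
        1 - binomialTail (c * Real.log n / n) n k := by
  have hc : 0 < c := hb.trans_lt hbc
  set M : ℝ := 1 + |Real.log (c / b)| with hM
  -- The factor 1/2 pays for replacing n(n-1)⋯(n-j+1) by n^j, e and b + 1 come from the factorial
  -- bound, exp(-1) from (1-p)^n against exp(-np), and exp(-M) from rounding b log n down.
  refine ⟨1 / 2 / Real.exp 1 / (b + 1) * Real.exp (-1) * Real.exp (-M), by positivity, ?_⟩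
  have ev1 : ∀ᶠ n : ℕ in atTop, 1 ≤ Real.log n := tendsto_log_nat.eventually_ge_atTop 1
  have ev2 : ∀ᶠ n : ℕ in atTop, Real.log n ^ 2 / n < (2 * (c + 1) ^ 2)⁻¹ :=
    tendsto_log_sq_div_nat.eventually_lt_const (by positivity)
  filter_upwards [ev1, ev2, eventually_gt_atTop 0] with n h1 h2 hn k hk
  have hn' : (0 : ℝ) < n := by exact_mod_cast hn
  set l := Real.log n with hl
  have h2' : l ^ 2 * (2 * (c + 1) ^ 2) ≤ n := by
    rw [div_lt_iff₀ hn', inv_mul_eq_div, lt_div_iff₀ (by positivity)] at h2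
    exact h2.le
  have hcl : l * (2 * (c + 1)) ≤ n := by
    nlinarith [mul_nonneg (show 0 ≤ l by linarith) (show 0 ≤ l * (c+1) - 1 by nlinarith)]
  set p := c * l / n with hp
  have hp0 : 0 ≤ p := by positivity
  have hnp : n * p = c * l := by rw [hp]; field_simp
  have hp1 : p ≤ 1 / 2 := by
    rw [hp, div_le_iff₀ hn']
    nlinarith
  have hnp2 : 2 * (n * p ^ 2) ≤ 1 := by
    have : n * p ^ 2 = (c * l) ^ 2 / n := by rw [hp]; field_simp
    rw [this, mul_div_assoc', div_le_iff₀ hn']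
    nlinarith [sq_nonneg l]
  -- The atom at the largest integer not above b log n already has the right exponential order.
  set j := ⌊b * l⌋₊ with hj
  have hjb : (j : ℝ) ≤ b * l := Nat.floor_le (by positivity)
  have hjk : j < k := by exact_mod_cast hjb.trans_lt hk
  have hjn2 : (j : ℝ) ^ 2 / n ≤ 1 / 2 := by
    rw [div_le_iff₀ hn']
    have : (j : ℝ) ^ 2 ≤ (c * l) ^ 2 := by
      gcongr
      exact hjb.trans (by gcongr)
    nlinarith [sq_nonneg l]
  have hjn : j ≤ n := by
    have : (j : ℝ) ≤ n := by nlinarith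
    exact_mod_cast this
  have hmain := choose_mul_pow_le_one_sub_binomialTail hp0 (by linarith : p ≤ 1) hjk hjn
  refine le_trans ?_ hmain
  have i1 : Real.exp (-(c * l)) * Real.exp (-1) ≤ (1 - p) ^ (n - j) := by
    refine le_trans ?_ (pow_le_pow_of_le_one (by linarith) (by linarith) (Nat.sub_le n j))
    refine le_trans ?_ (exp_neg_le_one_sub_pow hp0 hp1 n)
    rw [← Real.exp_add]
    exact Real.exp_le_exp.2 (by linarith)
  -- Since j²/n ≤ 1/2, Bernoulli's inequality bounds (1 - j/n)^j below by 1/2, so the binomial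
  -- weight is comparable to the Poisson weight.
  have i2 : 1 / 2 * (c * l) ^ j / j.factorial ≤ (n.choose j : ℝ) * p ^ j := by
    rw [div_le_iff₀ (by positivity)]
    have a : ((n : ℝ) - j) ^ j ≤ j.factorial * n.choose j := by
      have := Nat.pow_sub_le_descFactorial n j
      rw [Nat.descFactorial_eq_factorial_mul_choose] at this
      have h' : ((n + 1 - j : ℕ) : ℝ) ^ j ≤ j.factorial * n.choose j := by exact_mod_cast this
      refine le_trans ?_ h'
      rw [Nat.cast_sub (by omega)]
      push_cast
      have : (j : ℝ) ≤ n := by exact_mod_cast hjn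
      gcongr
      linarith
    have b1 : 1 / 2 ≤ (1 - (j : ℝ) / n) ^ j := by
      have := one_add_mul_le_pow (a := -((j : ℝ) / n)) (by
        have : (j : ℝ) / n ≤ 1 := (div_le_one hn').2 (by exact_mod_cast hjn)
        linarith) j
      rw [← sub_eq_add_neg] at this
      refine le_trans ?_ this
      have e : (j : ℝ) * -((j : ℝ) / n) = -((j : ℝ) ^ 2 / n) := by ring
      linarith
    have e : ((n : ℝ) - j) ^ j * p ^ j = (1 - (j : ℝ) / n) ^ j * (c * l) ^ j := by
      rw [← mul_pow, ← mul_pow, ← hnp]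
      congr 1
      field_simp
    calc 1 / 2 * (c * l) ^ j ≤ (1 - (j : ℝ) / n) ^ j * (c * l) ^ j := by gcongr
      _ = ((n : ℝ) - j) ^ j * p ^ j := e.symm
      _ ≤ (j.factorial * n.choose j) * p ^ j := by gcongr
      _ = _ := by ring
  have i3 : Real.exp (b * l * (1 - Real.log (b / c))) * Real.exp (-M) * (j : ℝ) ^ j *
      Real.exp (-j) ≤ (c * l) ^ j := by
    rcases hb.eq_or_lt with h0 | h0
    · have : j = 0 := by rw [hj, ← h0]; simp
      rw [this, ← h0]
      simp only [zero_mul, Real.exp_zero, one_mul, pow_zero, CharP.cast_eq_zero, neg_zero, mul_one]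
      exact Real.exp_le_one_iff.2 (by rw [hM]; linarith [abs_nonneg (Real.log (c / b))])
    · have hlog : 0 ≤ Real.log (c / b) := Real.log_nonneg ((one_le_div h0).2 hbc.le)
      have e : -Real.log (b / c) = Real.log (c / b) := by rw [← Real.log_inv, inv_div]
      have hjl : b * l - 1 ≤ j := by
        have := Nat.lt_floor_add_one (b * l)
        linarith
      have c1 : Real.exp (b * l * (1 - Real.log (b / c))) * Real.exp (-M) * Real.exp (-j) ≤
          (c / b) ^ j := by
        rw [← Real.rpow_natCast, Real.rpow_def_of_pos (by positivity), ← Real.exp_add,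
          ← Real.exp_add]
        refine Real.exp_le_exp.2 ?_
        rw [sub_eq_add_neg, e, hM, abs_of_nonneg hlog]
        nlinarith
      have c2 : (c / b) ^ j * (j : ℝ) ^ j ≤ (c * l) ^ j := by
        rw [← mul_pow]
        refine pow_le_pow_left₀ (by positivity) ?_ j
        rw [div_mul_eq_mul_div, div_le_iff₀ h0]
        nlinarith
      refine le_trans (le_of_eq ?_) ((mul_le_mul_of_nonneg_right c1 (by positivity)).trans c2)
      ring
  have i4 : 1 / 2 / Real.exp 1 / (b + 1) * Real.exp (-M) *
      Real.exp (b * l * (1 - Real.log (b / c))) / (l + 1) ≤ 1 / 2 * (c * l) ^ j / j.factorial := by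
    rw [div_le_div_iff₀ (by positivity) (by positivity)]
    have hf := factorial_le_pow_mul_exp j
    have hj1 : (j : ℝ) + 1 ≤ (b + 1) * (l + 1) := by nlinarith
    calc 1 / 2 / Real.exp 1 / (b + 1) * Real.exp (-M) *
          Real.exp (b * l * (1 - Real.log (b / c))) * j.factorial
        ≤ 1 / 2 / Real.exp 1 / (b + 1) * Real.exp (-M) *
          Real.exp (b * l * (1 - Real.log (b / c))) * (Real.exp 1 * ((b + 1) * (l + 1)) *
            ((j : ℝ) ^ j * Real.exp (-j))) := by
          gcongr
          exact hf.trans (by gcongr)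
      _ = 1 / 2 * (Real.exp (b * l * (1 - Real.log (b / c))) * Real.exp (-M) * (j : ℝ) ^ j *
          Real.exp (-j)) * (l + 1) := by field_simp
      _ ≤ 1 / 2 * (c * l) ^ j * (l + 1) := by gcongr
  calc 1 / 2 / Real.exp 1 / (b + 1) * Real.exp (-1) * Real.exp (-M) *
        Real.exp (-((c - b + b * Real.log (b / c)) * l)) / (l + 1)
      = (1 / 2 / Real.exp 1 / (b + 1) * Real.exp (-M) *
      Real.exp (b * l * (1 - Real.log (b / c))) / (l + 1)) *
        (Real.exp (-(c * l)) * Real.exp (-1)) := by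
        have : -((c - b + b * Real.log (b / c)) * l) =
          b * l * (1 - Real.log (b / c)) + -(c * l) := by ring
        rw [this, Real.exp_add]; ring
    _ ≤ ((n.choose j : ℝ) * p ^ j) * (1 - p) ^ (n - j) :=
        mul_le_mul (i4.trans i2) i1 (by positivity) (by positivity)

lemma ae_eventually_notMem_of_summable {Ω : Type*} [MeasurableSpace Ω] {P : Measure Ω}
    [IsProbabilityMeasure P] {F : ℕ → Set Ω} {a : ℕ → ℝ} (ha : Summable a)
    (hF : ∀ᶠ n in atTop, P.real (F n) ≤ a n) : ∀ᵐ ω ∂P, ∀ᶠ n in atTop, ω ∉ F n := by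
  refine ae_eventually_notMem ?_
  have h : Summable fun n => P.real (F n) := by
    refine Summable.of_norm_bounded_eventually_nat ha ?_
    filter_upwards [hF] with n hn
    rwa [Real.norm_of_nonneg measureReal_nonneg]
  have := h.tsum_ofReal_ne_top
  simpa [ofReal_measureReal] using this

section AlmostSure

variable {Ω E : Type*} [MeasurableSpace Ω] [MeasurableSpace E] {P : Measure Ω}
  [IsProbabilityMeasure P] {μ : Measure E} {X : ℕ → Ω → E}

lemma measureReal_hits_lt_le_exp (hX : ∀ i, Measurable (X i)) (hind : iIndepFun X P)
    (hlaw : ∀ i, P.map (X i) = μ) {S : Set E} (hS : MeasurableSet S) (n k : ℕ) {p s : ℝ}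
    (hp : p ≤ μ.real S) (hs : 0 < s) (hs1 : s ≤ 1) :
    P.real {ω | hits X n S ω < k} ≤ (s⁻¹) ^ k * Real.exp (-(n * p * (1 - s))) := by
  have : IsProbabilityMeasure μ := hlaw 0 ▸ Measure.isProbabilityMeasure_map (hX 0).aemeasurable
  refine (measureReal_hits_lt_le hX hind hlaw hS n k).trans
    ((one_sub_binomialTail_le_pow measureReal_nonneg measureReal_le_one hs hs1 n k).trans ?_)
  gcongr
  have h1 : 1 - μ.real S * (1 - s) ≤ Real.exp (-(p * (1 - s))) := by
    refine le_trans ?_ (Real.add_one_le_exp _)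
    nlinarith
  refine (pow_le_pow_left₀ ?_ h1 n).trans (le_of_eq ?_)
  · nlinarith [measureReal_le_one (μ := μ) (s := S), measureReal_nonneg (μ := μ) (s := S)]
  · rw [← Real.exp_nat_mul]; congr 1; ring

lemma measureReal_le_hits_le_exp (hX : ∀ i, Measurable (X i)) (hind : iIndepFun X P)
    (hlaw : ∀ i, P.map (X i) = μ) {S : Set E} (hS : MeasurableSet S) (n k : ℕ) {p s : ℝ}
    (hp : μ.real S ≤ p) (hs1 : 1 ≤ s) :
    P.real {ω | k ≤ hits X n S ω} ≤ (s⁻¹) ^ k * Real.exp (n * p * (s - 1)) := by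
  have : IsProbabilityMeasure μ := hlaw 0 ▸ Measure.isProbabilityMeasure_map (hX 0).aemeasurable
  have h := measureReal_forall_le_hits_le hX hind hlaw ({()} : Finset Unit) (S := fun _ => S)
    (fun _ => hS) (by simp) n (fun _ => k)
  simp only [Finset.mem_singleton, forall_const, Finset.prod_singleton] at h
  refine h.trans ((binomialTail_le_pow measureReal_nonneg measureReal_le_one hs1 n k).trans ?_)
  have : 0 ≤ s⁻¹ := by positivity
  gcongr
  have h1 : 1 + μ.real S * (s - 1) ≤ Real.exp (p * (s - 1)) := by
    refine le_trans ?_ (Real.add_one_le_exp _)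
    nlinarith
  refine (pow_le_pow_left₀ ?_ h1 n).trans (le_of_eq ?_)
  · nlinarith [measureReal_nonneg (μ := μ) (s := S)]
  · rw [← Real.exp_nat_mul]; congr 1; ring

/-- If sets of probability at least `c log n / n` are not too numerous, then along a polynomially
growing subsequence almost surely all of them eventually contain `b log n` sample points. -/
lemma ae_eventually_forall_log_le_hits (hX : ∀ i, Measurable (X i)) (hind : iIndepFun X P)
    (hlaw : ∀ i, P.map (X i) = μ) {ι : Type*} {T : ℕ → Finset ι} {S : ℕ → ι → Set E}
    (hS : ∀ n x, MeasurableSet (S n x)) {b c τ C : ℝ} (hb : 0 < b) (hbc : b < c)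
    (hτ : τ < c - b + b * Real.log (b / c))
    (hT : ∀ᶠ n : ℕ in atTop, ((T n).card : ℝ) ≤ C * (n : ℝ) ^ τ)
    (hμ : ∀ᶠ n : ℕ in atTop, ∀ x ∈ T n, c * Real.log n / n ≤ μ.real (S n x)) :
    ∃ K₀ : ℕ, ∀ K ≥ K₀, ∀ᵐ ω ∂P, ∀ᶠ j : ℕ in atTop, ∀ x ∈ T (j ^ K),
      b * Real.log ((j ^ K : ℕ) : ℝ) ≤ hits X (j ^ K) (S (j ^ K) x) ω := by
  set δ := c - b + b * Real.log (b / c) - τ with hδ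
  have hδ0 : 0 < δ := by linarith
  have hc : 0 < c := hb.trans hbc
  have hlog : 0 ≤ Real.log (c / b) := Real.log_nonneg ((one_le_div hb).2 hbc.le)
  have hlog' : Real.log (b / c) = -Real.log (c / b) := by rw [← Real.log_inv, inv_div]
  have hF : ∀ᶠ n : ℕ in atTop, P.real {ω | ∃ x ∈ T n, hits X n (S n x) ω < ⌈b * Real.log n⌉₊} ≤
      C * (c / b) * (n : ℝ) ^ (-δ) := by
    filter_upwards [hT, hμ, eventually_gt_atTop 0] with n h1 h2 hn
    have hn' : (0 : ℝ) < n := by exact_mod_cast hn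
    have hl0 : 0 ≤ Real.log n := Real.log_natCast_nonneg n
    have e : {ω | ∃ x ∈ T n, hits X n (S n x) ω < ⌈b * Real.log n⌉₊} =
        ⋃ x ∈ T n, {ω | hits X n (S n x) ω < ⌈b * Real.log n⌉₊} := by
      ext ω; simp
    have hone : ∀ x ∈ T n, P.real {ω | hits X n (S n x) ω < ⌈b * Real.log n⌉₊} ≤
        c / b * (n : ℝ) ^ (-δ - τ) := by
      intro x hx
      -- The parameter s = b/c is optimal in Chernoff's bound. Rounding b log n up costs at most one
      -- factor c/b.
      refine (measureReal_hits_lt_le_exp hX hind hlaw (hS n x) n _ (h2 x hx)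
        (s := b / c) (by positivity) ((div_le_one hc).2 hbc.le)).trans ?_
      rw [inv_div, ← Real.rpow_natCast, Real.rpow_def_of_pos (by positivity), ← Real.exp_add,
        Real.rpow_def_of_pos hn', ← Real.exp_log (show 0 < c / b by positivity), ← Real.exp_add,
        Real.exp_log (show 0 < c / b by positivity)]
      refine Real.exp_le_exp.2 ?_
      have hk := (Nat.ceil_lt_add_one (show 0 ≤ b * Real.log n by positivity)).le
      have e1 : n * (c * Real.log n / n) * (1 - b / c) = (c - b) * Real.log n := by
        field_simp
      rw [e1]
      have := mul_le_mul_of_nonneg_left hk hlog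
      have e2 : -δ - τ = -(c - b) + b * Real.log (c / b) := by rw [hδ, hlog']; ring
      rw [e2]
      nlinarith
    rw [e]
    calc P.real (⋃ x ∈ T n, {ω | hits X n (S n x) ω < ⌈b * Real.log n⌉₊})
        ≤ ∑ x ∈ T n, P.real {ω | hits X n (S n x) ω < ⌈b * Real.log n⌉₊} :=
          measureReal_biUnion_finset_le _ _
      _ ≤ ∑ x ∈ T n, c / b * (n : ℝ) ^ (-δ - τ) := Finset.sum_le_sum hone
      _ = (T n).card * (c / b * (n : ℝ) ^ (-δ - τ)) := by simp
      _ ≤ (C * (n : ℝ) ^ τ) * (c / b * (n : ℝ) ^ (-δ - τ)) := by gcongr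
      _ = C * (c / b) * ((n : ℝ) ^ τ * (n : ℝ) ^ (-δ - τ)) := by ring
      _ = _ := by rw [← Real.rpow_add hn']; congr 2; ring
  -- The union bound is only of order n^(-δ), possibly not summable; along n = j^K it becomes
  -- j^(-Kδ), summable once Kδ > 1.
  obtain ⟨K₀, hK₀⟩ := exists_nat_gt (1 / δ)
  refine ⟨K₀, fun K hK => ?_⟩
  have hKδ : 1 < K * δ := by
    have : (K₀ : ℝ) ≤ K := by exact_mod_cast hK
    rw [div_lt_iff₀ hδ0] at hK₀
    nlinarith
  have hKpos : K ≠ 0 := by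
    rintro rfl
    norm_num at hKδ
  have hsum : Summable fun j : ℕ => C * (c / b) * (j : ℝ) ^ (-(K * δ)) :=
    (Real.summable_nat_rpow.2 (by linarith)).mul_left _
  have hlim : Tendsto (fun j : ℕ => j ^ K) atTop atTop := tendsto_pow_atTop hKpos
  have := ae_eventually_notMem_of_summable (P := P) hsum
    (F := fun j => {ω | ∃ x ∈ T (j ^ K), hits X (j ^ K) (S (j ^ K) x) ω <
      ⌈b * Real.log ((j ^ K : ℕ) : ℝ)⌉₊}) (by
      filter_upwards [hlim.eventually hF] with j hj
      refine hj.trans (le_of_eq ?_)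
      push_cast
      rw [← Real.rpow_natCast, ← Real.rpow_mul (by positivity)]
      congr 2; ring)
  filter_upwards [this] with ω hω
  filter_upwards [hω] with j hj x hx
  simp only [not_exists, not_and, not_lt] at hj
  exact Nat.ceil_le.1 (hj x hx)

lemma eventually_exp_neg_mul_le {k : ℕ → ℕ} {δ : ℝ} (hδ : 0 < δ)
    (hk : Tendsto (fun n : ℕ => (k n : ℝ) / Real.log n) atTop atTop) (a : ℝ) :
    ∀ᶠ n : ℕ in atTop, Real.exp (-(k n * δ)) ≤ (n : ℝ) ^ (-a) := by
  filter_upwards [hk.eventually_ge_atTop (a / δ), tendsto_log_nat.eventually_gt_atTop 0,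
    eventually_gt_atTop 0] with n h1 h2 hn
  have hn' : (0 : ℝ) < n := by exact_mod_cast hn
  rw [Real.rpow_def_of_pos hn']
  refine Real.exp_le_exp.2 ?_
  rw [div_le_div_iff₀ hδ h2] at h1
  linarith

lemma sub_one_sub_log_pos {c : ℝ} (hc : 0 < c) (h1 : c ≠ 1) : 0 < c - 1 - Real.log c := by
  linarith [Real.log_lt_sub_one_of_pos hc h1]

/-- When k(n) / log n → ∞, Chernoff's bound with s = 1/c gives exp(-k(n)(c - 1 - log c)), which
beats every power of n. A union bound over O(n) sets is then summable without passing to a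
subsequence. -/
lemma ae_eventually_forall_le_hits (hX : ∀ i, Measurable (X i)) (hind : iIndepFun X P)
    (hlaw : ∀ i, P.map (X i) = μ) {ι : Type*} {T : ℕ → Finset ι} {S : ℕ → ι → Set E}
    (hS : ∀ n x, MeasurableSet (S n x)) {k : ℕ → ℕ} {c C : ℝ} (hc : 1 < c)
    (hk : Tendsto (fun n : ℕ => (k n : ℝ) / Real.log n) atTop atTop)
    (hT : ∀ᶠ n : ℕ in atTop, ((T n).card : ℝ) ≤ C * n)
    (hμ : ∀ᶠ n : ℕ in atTop, ∀ x ∈ T n, c * k n / n ≤ μ.real (S n x)) :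
    ∀ᵐ ω ∂P, ∀ᶠ n : ℕ in atTop, ∀ x ∈ T n, k n ≤ hits X n (S n x) ω := by
  have hc0 : 0 < c := by linarith
  have hsum : Summable fun n : ℕ => C * (n : ℝ) ^ (-(2 : ℝ)) :=
    (Real.summable_nat_rpow.2 (by norm_num)).mul_left _
  have hF : ∀ᶠ n : ℕ in atTop, P.real {ω | ∃ x ∈ T n, hits X n (S n x) ω < k n} ≤
      C * (n : ℝ) ^ (-(2 : ℝ)) := by
    filter_upwards [hT, hμ, eventually_gt_atTop 0,
      eventually_exp_neg_mul_le (sub_one_sub_log_pos hc0 hc.ne') hk 3] with n h1 h2 hn h3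
    have hn' : (0 : ℝ) < n := by exact_mod_cast hn
    have e : {ω | ∃ x ∈ T n, hits X n (S n x) ω < k n} =
        ⋃ x ∈ T n, {ω | hits X n (S n x) ω < k n} := by
      ext ω; simp
    have hone : ∀ x ∈ T n, P.real {ω | hits X n (S n x) ω < k n} ≤ (n : ℝ) ^ (-(3 : ℝ)) := by
      intro x hx
      refine (measureReal_hits_lt_le_exp hX hind hlaw (hS n x) n _ (h2 x hx)
        (s := c⁻¹) (by positivity) (inv_le_one_of_one_le₀ hc.le)).trans (le_trans ?_ h3)
      rw [inv_inv, ← Real.rpow_natCast, Real.rpow_def_of_pos (by positivity), ← Real.exp_add]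
      refine Real.exp_le_exp.2 (le_of_eq ?_)
      field_simp
      ring
    rw [e]
    calc P.real (⋃ x ∈ T n, {ω | hits X n (S n x) ω < k n})
        ≤ ∑ x ∈ T n, P.real {ω | hits X n (S n x) ω < k n} := measureReal_biUnion_finset_le _ _
      _ ≤ ∑ x ∈ T n, (n : ℝ) ^ (-(3 : ℝ)) := Finset.sum_le_sum hone
      _ = (T n).card * (n : ℝ) ^ (-(3 : ℝ)) := by simp
      _ ≤ (C * n) * (n : ℝ) ^ (-(3 : ℝ)) := by gcongr
      _ = C * ((n : ℝ) ^ (1 : ℝ) * (n : ℝ) ^ (-(3 : ℝ))) := by rw [Real.rpow_one]; ring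
      _ = _ := by rw [← Real.rpow_add hn']; norm_num
  filter_upwards [ae_eventually_notMem_of_summable hsum hF] with ω hω
  filter_upwards [hω] with n hn x hx
  simp only [not_exists, not_and, not_lt] at hn
  exact hn x hx

/-- One set of too small a mean suffices in this regime: its upper tail already decays faster than
every power of n. -/
lemma ae_eventually_hits_lt (hX : ∀ i, Measurable (X i)) (hind : iIndepFun X P)
    (hlaw : ∀ i, P.map (X i) = μ) {S : ℕ → Set E}
    (hS : ∀ n, MeasurableSet (S n)) {k : ℕ → ℕ} {c : ℝ} (hc0 : 0 < c) (hc : c < 1)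
    (hk : Tendsto (fun n : ℕ => (k n : ℝ) / Real.log n) atTop atTop)
    (hμ : ∀ᶠ n : ℕ in atTop, μ.real (S n) ≤ c * k n / n) :
    ∀ᵐ ω ∂P, ∀ᶠ n : ℕ in atTop, hits X n (S n) ω < k n := by
  have hsum : Summable fun n : ℕ => (n : ℝ) ^ (-(2 : ℝ)) :=
    Real.summable_nat_rpow.2 (by norm_num)
  have hF : ∀ᶠ n : ℕ in atTop, P.real {ω | k n ≤ hits X n (S n) ω} ≤ (n : ℝ) ^ (-(2 : ℝ)) := by
    filter_upwards [hμ, eventually_gt_atTop 0,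
      eventually_exp_neg_mul_le (sub_one_sub_log_pos hc0 hc.ne) hk 2] with n h2 hn h3
    have hn' : (0 : ℝ) < n := by exact_mod_cast hn
    refine (measureReal_le_hits_le_exp hX hind hlaw (hS n) n _ h2
        (s := c⁻¹) ((one_le_inv₀ hc0).2 hc.le)).trans (le_trans ?_ h3)
    rw [inv_inv, ← Real.rpow_natCast, Real.rpow_def_of_pos (by positivity), ← Real.exp_add]
    refine Real.exp_le_exp.2 (le_of_eq ?_)
    field_simp
    ring
  filter_upwards [ae_eventually_notMem_of_summable hsum hF] with ω hω
  filter_upwards [hω] with n hn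
  simpa using hn

lemma tendsto_exp_mul_div_log_pow {η : ℝ} (hη : 0 < η) (s : ℝ) :
    Tendsto (fun n : ℕ => Real.exp (η * Real.log n) / Real.log n ^ s) atTop atTop :=
  (tendsto_exp_mul_div_rpow_atTop s η hη).comp tendsto_log_nat

/-- If disjoint sets of probability at most `c log n / n` are sufficiently numerous, then almost
surely one of them eventually contains fewer than `k n` sample points. -/
lemma ae_eventually_exists_hits_lt (hX : ∀ i, Measurable (X i)) (hind : iIndepFun X P)
    (hlaw : ∀ i, P.map (X i) = μ) {ι : Type*} {T : ℕ → Finset ι} {S : ℕ → ι → Set E}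
    (hS : ∀ n x, MeasurableSet (S n x))
    (hdisj : ∀ᶠ n : ℕ in atTop, (T n : Set ι).PairwiseDisjoint (S n))
    {k : ℕ → ℕ} {b c τ C : ℝ} (hb : 0 ≤ b) (hbc : b < c) (hC : 0 < C)
    (hτ : c - b + b * Real.log (b / c) < τ)
    (hT : ∀ᶠ n : ℕ in atTop, C * (n / Real.log n : ℝ) ^ τ ≤ (T n).card)
    (hk : ∀ᶠ n : ℕ in atTop, b * Real.log n < k n)
    (hμ : ∀ᶠ n : ℕ in atTop, ∀ x ∈ T n, μ.real (S n x) ≤ c * Real.log n / n) :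
    ∀ᵐ ω ∂P, ∀ᶠ n : ℕ in atTop, ∃ x ∈ T n, hits X n (S n x) ω < k n := by
  have : IsProbabilityMeasure μ := hlaw 0 ▸ Measure.isProbabilityMeasure_map (hX 0).aemeasurable
  have hc : 0 < c := hb.trans_lt hbc
  obtain ⟨κ, hκ, hev⟩ := eventually_le_one_sub_binomialTail hb hbc
  set ρ := c - b + b * Real.log (b / c) with hρ
  have hsum : Summable fun n : ℕ => (n : ℝ) ^ (-(2 : ℝ)) :=
    Real.summable_nat_rpow.2 (by norm_num)
  have hF : ∀ᶠ n : ℕ in atTop, P.real {ω | ∀ x ∈ T n, k n ≤ hits X n (S n x) ω} ≤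
      (n : ℝ) ^ (-(2 : ℝ)) := by
    -- The expected number of deficient sets is about n^(τ-ρ) over powers of log n, and it has to
    -- exceed 2 log n. The power τ comes from (n / log n)^τ, one more from the denominator log n +
    -- 1, and the last from the target 2 log n.
    have hlarge := (tendsto_exp_mul_div_log_pow (sub_pos.2 hτ) (τ + 2)).eventually_ge_atTop
      (4 / (C * κ))
    filter_upwards [hdisj, hev, hT, hk, hμ, hlarge, tendsto_log_nat.eventually_ge_atTop 1,
      eventually_gt_atTop 0, (tendsto_log_sq_div_nat.eventually_lt_const
        (show 0 < c⁻¹ by positivity))] with n h1 h2 h3 h4 h5 h6 h7 hn h8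
    have hn' : (0 : ℝ) < n := by exact_mod_cast hn
    set l := Real.log n with hl
    have hl0 : 0 < l := by linarith
    set p := c * l / n with hp
    have hp0 : 0 ≤ p := by positivity
    have hp1 : p ≤ 1 := by
      rw [div_lt_iff₀ hn', inv_mul_eq_div, lt_div_iff₀ hc] at h8
      rw [hp, div_le_one hn']
      nlinarith
    set π := κ * Real.exp (-(ρ * l)) / (l + 1) with hπ
    have hπ0 : 0 < π := by positivity
    have ht := h2 (k n) h4
    calc P.real {ω | ∀ x ∈ T n, k n ≤ hits X n (S n x) ω}
        ≤ ∏ x ∈ T n, binomialTail (μ.real (S n x)) n (k n) :=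
          measureReal_forall_le_hits_le hX hind hlaw (T n) (hS n) h1 n fun _ => k n
      _ ≤ ∏ x ∈ T n, Real.exp (-π) := by
          refine Finset.prod_le_prod (fun x _ => binomialTail_nonneg measureReal_nonneg
            measureReal_le_one _ _) fun x hx => ?_
          refine (binomialTail_mono measureReal_nonneg (h5 x hx) hp1 n (k n)).trans ?_
          refine le_trans ?_ (Real.one_sub_le_exp_neg π)
          linarith
      _ = Real.exp (-((T n).card * π)) := by
          rw [Finset.prod_const, ← Real.exp_nat_mul]; congr 1; ring
      _ ≤ (n : ℝ) ^ (-(2 : ℝ)) := by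
          rw [Real.rpow_def_of_pos hn']
          refine Real.exp_le_exp.2 ?_
          have : 2 * l ≤ (C * (n / l : ℝ) ^ τ) * π := by
            have e1 : (n / l : ℝ) ^ τ = Real.exp (τ * l) / l ^ τ := by
              rw [Real.div_rpow hn'.le hl0.le, Real.rpow_def_of_pos hn', mul_comm (Real.log _)]
            have e2 : Real.exp ((τ - ρ) * l) = Real.exp (τ * l) * Real.exp (-(ρ * l)) := by
              rw [← Real.exp_add]; congr 1; ring
            rw [div_le_div_iff₀ (by positivity) (by positivity), e2, Real.rpow_add hl0,
              Real.rpow_two] at h6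
            rw [e1, hπ]
            have e3 : C * (Real.exp (τ * l) / l ^ τ) * (κ * Real.exp (-(ρ * l)) / (l + 1)) =
              (Real.exp (τ * l) * Real.exp (-(ρ * l)) * (C * κ)) / (l ^ τ * (l + 1)) := by
              field_simp
            rw [e3, le_div_iff₀ (by positivity)]
            refine le_trans ?_ h6
            have : 0 < l ^ τ := by positivity
            nlinarith [mul_nonneg this.le (show 0 ≤ l * (l - 1) by nlinarith)]
          have h' := mul_le_mul_of_nonneg_right h3 hπ0.le
          linarith
  filter_upwards [ae_eventually_notMem_of_summable hsum hF] with ω hω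
  filter_upwards [hω] with n hn
  simpa using hn

end AlmostSure

/-! ### Coverage by balls in a metric measure space -/

/-- The rate `c H(b / c)` at which the probability that a Poisson variable with mean `c t` is at
most `b t` decays as `t → ∞`. -/
def rate (c b : ℝ) : ℝ := c - b + b * Real.log (b / c)

/-- Written as c - b + c · (b/c) log(b/c), the rate inherits continuity from x log x, so b = 0 is
included. -/
lemma continuousAt_rate {c b : ℝ} (hc : c ≠ 0) :
    ContinuousAt (fun q : ℝ × ℝ => rate q.1 q.2) (c, b) := by
  have h : (fun q : ℝ × ℝ => q.1 - q.2 + q.1 * ((q.2 / q.1) * Real.log (q.2 / q.1))) =ᶠ[𝓝 (c, b)]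
      fun q => rate q.1 q.2 := by
    filter_upwards [(continuous_fst.tendsto (c, b)).eventually_ne hc] with q hq
    rw [rate]; field_simp
  refine ContinuousAt.congr ?_ h
  have hd : ContinuousAt (fun q : ℝ × ℝ => q.2 / q.1) (c, b) :=
    continuousAt_snd.div continuousAt_fst hc
  have hm : ContinuousAt (fun q : ℝ × ℝ => (q.2 / q.1) * Real.log (q.2 / q.1)) (c, b) :=
    Real.continuous_mul_log.continuousAt.comp hd
  exact (continuousAt_fst.sub continuousAt_snd).add (continuousAt_fst.mul hm)

lemma eventually_atTop_of_eventually_pow {K : ℕ} (hK : K ≠ 0) {Q : ℕ → Prop}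
    (h : ∀ᶠ j : ℕ in atTop, ∀ n, j ^ K ≤ n → n < (j + 1) ^ K → Q n) : ∀ᶠ n in atTop, Q n := by
  obtain ⟨J, hJ⟩ := eventually_atTop.1 h
  filter_upwards [eventually_ge_atTop (J ^ K)] with n hn
  have hJn : J ≤ n := (Nat.le_self_pow hK J).trans hn
  set j := Nat.findGreatest (fun j => j ^ K ≤ n) n with hj
  refine hJ j (Nat.le_findGreatest hJn hn) n
    (Nat.findGreatest_spec (P := fun j => j ^ K ≤ n) hJn hn) ?_
  rcases le_or_gt (j + 1) n with h1 | h1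
  · exact not_le.1 (Nat.findGreatest_is_greatest (P := fun j => j ^ K ≤ n) (Nat.lt_succ_self j) h1)
  · exact h1.trans_le (Nat.le_self_pow hK _)

/-- The radius `r` for which `r ^ d = t`. -/
def rad (d : ℕ) (t : ℝ) : ℝ := t ^ ((d : ℝ)⁻¹)

lemma rad_pow {d : ℕ} (hd : d ≠ 0) {t : ℝ} (ht : 0 ≤ t) : rad d t ^ d = t :=
  Real.rpow_inv_natCast_pow ht hd

lemma rad_pos {d : ℕ} {t : ℝ} (ht : 0 < t) : 0 < rad d t := Real.rpow_pos_of_pos ht _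

lemma mul_rad {d : ℕ} (hd : d ≠ 0) {s t : ℝ} (hs : 0 ≤ s) (ht : 0 ≤ t) :
    s * rad d t = rad d (s ^ d * t) := by
  rw [rad, rad, Real.mul_rpow (by positivity) ht, Real.pow_rpow_inv_natCast hs hd]

lemma rad_le_rad {d : ℕ} {s t : ℝ} (hs : 0 ≤ s) (hst : s ≤ t) : rad d s ≤ rad d t :=
  Real.rpow_le_rpow hs hst (by positivity)

lemma rad_pow_eq_rpow {d D : ℕ} {t : ℝ} (ht : 0 ≤ t) :
    rad d t ^ D = t ^ ((D : ℝ) / d) := by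
  rw [rad, ← Real.rpow_natCast, ← Real.rpow_mul ht]
  congr 1; ring

lemma tendsto_rad {d : ℕ} (hd : d ≠ 0) {t : ℕ → ℝ} (ht : Tendsto t atTop (𝓝 0)) :
    Tendsto (fun n => rad d (t n)) atTop (𝓝 0) := by
  have hd' : (0 : ℝ) < (d : ℝ)⁻¹ := by positivity
  have := ht.rpow_const (p := (d : ℝ)⁻¹) (Or.inr hd'.le)
  rwa [Real.zero_rpow hd'.ne'] at this

variable {E : Type*} [PseudoMetricSpace E] [MeasurableSpace E]

/-- For small `r`, the set `B` is covered by the `δ r`-balls around the points of two finite sets,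
of sizes `O(r ^ (-D₁))` and `O(r ^ (-D₂))`; the `r`-balls around their points have measure at least
`κ₁ r ^ d` and `κ₂ r ^ d`, respectively. -/
def HasCovers (μ : Measure E) (B : Set E) (d D₁ D₂ : ℕ) (κ₁ κ₂ : ℝ) : Prop :=
  ∀ δ > 0, ∃ C r₀ : ℝ, 0 < r₀ ∧ ∀ r, 0 < r → r < r₀ → ∃ T₁ T₂ : Finset E,
    (∀ y ∈ B, ∃ x, (x ∈ T₁ ∨ x ∈ T₂) ∧ dist x y ≤ δ * r) ∧
    T₁.card * r ^ D₁ ≤ C ∧ T₂.card * r ^ D₂ ≤ C ∧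
    (∀ x ∈ T₁, κ₁ * r ^ d ≤ μ.real (Metric.closedBall x r)) ∧
    ∀ x ∈ T₂, κ₂ * r ^ d ≤ μ.real (Metric.closedBall x r)

/-- For small `r`, there are at least of the order of `r ^ (-D)` disjoint `r`-balls centred in `B`
with measure at most `κ r ^ d`. -/
def HasPackings (μ : Measure E) (B : Set E) (d D : ℕ) (κ : ℝ) : Prop :=
  ∃ C r₀ : ℝ, 0 < C ∧ 0 < r₀ ∧ ∀ r, 0 < r → r < r₀ → ∃ T : Finset E, ↑T ⊆ B ∧
    C ≤ T.card * r ^ D ∧ (T : Set E).PairwiseDisjoint (Metric.closedBall · r) ∧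
    ∀ x ∈ T, μ.real (Metric.closedBall x r) ≤ κ * r ^ d

/-- Converts a cardinality bound in terms of the radius into one in terms of n. The factor `t`,
which will be log n or k(n), can be dropped because it is at least 1. -/
lemma card_le_of_card_mul_rad_pow_le {d D N : ℕ} {C u t x : ℝ} (hu : 0 < u) (ht : 1 ≤ t)
    (hx : 0 < x) (h : N * rad d (u * t / x) ^ D ≤ C) :
    (N : ℝ) ≤ C * (u ^ ((D : ℝ) / d))⁻¹ * x ^ ((D : ℝ) / d) := by
  rw [rad_pow_eq_rpow (by positivity)] at h
  have h1 : (u / x) ^ ((D : ℝ) / d) ≤ (u * t / x) ^ ((D : ℝ) / d) := by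
    gcongr
    nlinarith
  have h2 : N * (u / x) ^ ((D : ℝ) / d) ≤ C := (by gcongr : _ ≤ _).trans h
  rw [Real.div_rpow hu.le hx.le] at h2
  have : 0 < u ^ ((D : ℝ) / d) := by positivity
  have : 0 < x ^ ((D : ℝ) / d) := by positivity
  rw [mul_div_assoc', div_le_iff₀ (by positivity)] at h2
  rw [mul_right_comm, ← div_eq_mul_inv, le_div_iff₀ (by positivity)]
  exact h2

/-- The strict inequalities leave room: raising `b` absorbs the growth of k(n) between consecutive
subsequence times, dividing `c` pays for the mesh of the net and for those gaps. -/
lemma exists_one_add_of_continuousAt {c b τ : ℝ} (hc : 0 < c) (hbc : b < c) (hτ : τ < rate c b)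
    (q : ℕ) : ∀ᶠ δ : ℝ in 𝓝[>] 0, b + δ < c / (1 + δ) ^ q ∧ τ < rate (c / (1 + δ) ^ q) (b + δ) := by
  have hf : ContinuousAt (fun δ : ℝ => c / (1 + δ) ^ q) 0 := by
    refine ContinuousAt.div continuousAt_const (by fun_prop) (by simp)
  have hg : ContinuousAt (fun δ : ℝ => b + δ) 0 := by fun_prop
  have hr : ContinuousAt (fun δ : ℝ => rate (c / (1 + δ) ^ q) (b + δ)) 0 := by
    have h1 : ContinuousAt (fun q : ℝ × ℝ => rate q.1 q.2)
      ((fun δ : ℝ => (c / (1 + δ) ^ q, b + δ)) 0) := by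
      simpa using continuousAt_rate (b := b) hc.ne'
    exact ContinuousAt.comp (f := fun δ : ℝ => (c / (1 + δ) ^ q, b + δ)) h1 (hf.prodMk hg)
  refine Filter.Eventually.filter_mono nhdsWithin_le_nhds ?_
  refine (hg.tendsto.eventually_lt hf.tendsto (by simpa using hbc)).and ?_
  exact hr.tendsto.eventually_const_lt (by simpa using hτ)

/-! ### Almost sure covering and non-covering criteria -/

section AlmostSure

variable [OpensMeasurableSpace E] {Ω : Type*} [MeasurableSpace Ω] {P : Measure Ω}
  [IsProbabilityMeasure P] {μ : Measure E} {X : ℕ → Ω → E} {B : Set E} {d D D₁ D₂ : ℕ}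
  {κ κ₁ κ₂ u β : ℝ} {k : ℕ → ℕ}

/-- Every point of `B` is within δr of a net point, so a slightly larger ball contains the net
point's ball. The two nets have n^(D₁/d) and n^(D₂/d) points up to constants; each is handled by its
own rate condition. -/
theorem ae_eventually_covered_log (hX : ∀ i, Measurable (X i)) (hind : iIndepFun X P)
    (hlaw : ∀ i, P.map (X i) = μ) (hd : d ≠ 0) (hcov : HasCovers μ B d D₁ D₂ κ₁ κ₂)
    (hβ : 0 ≤ β) (hk : Tendsto (fun n : ℕ => (k n : ℝ) / Real.log n) atTop (𝓝 β)) (hu : 0 < u)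
    (h₁ : β < u * κ₁) (h₁' : (D₁ : ℝ) / d < rate (u * κ₁) β)
    (h₂ : β < u * κ₂) (h₂' : (D₂ : ℝ) / d < rate (u * κ₂) β) :
    ∀ᵐ ω ∂P, ∀ᶠ n : ℕ in atTop, ∀ x ∈ B,
      k n ≤ hits X n (Metric.closedBall x (rad d (u * Real.log n / n))) ω := by
  have hδex := ((exists_one_add_of_continuousAt (hβ.trans_lt h₁) h₁ h₁' (d + 1)).and
    (exists_one_add_of_continuousAt (hβ.trans_lt h₂) h₂ h₂' (d + 1))).and self_mem_nhdsWithin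
  obtain ⟨δ, ⟨⟨hb₁, hr₁⟩, hb₂, hr₂⟩, hδ⟩ := hδex.exists
  replace hδ : 0 < δ := hδ
  -- Of the d + 1 factors, d enlarge the radius from r to (1 + δ)r, and one bounds n/N, where N =
  -- j^K is the subsequence time just below n.
  set u₁ := u / (1 + δ) ^ (d + 1) with hu₁
  have hu₁0 : 0 < u₁ := by positivity
  have e₁ : u * κ₁ / (1 + δ) ^ (d + 1) = u₁ * κ₁ := by rw [hu₁]; ring
  have e₂ : u * κ₂ / (1 + δ) ^ (d + 1) = u₁ * κ₂ := by rw [hu₁]; ring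
  rw [e₁] at hb₁ hr₁
  rw [e₂] at hb₂ hr₂
  obtain ⟨C, r₀, hr₀, hT⟩ := hcov δ hδ
  set r : ℕ → ℝ := fun n => rad d (u₁ * Real.log n / n) with hr
  have hT' : ∀ n, ∃ T₁ T₂ : Finset E, 0 < r n → r n < r₀ →
    (∀ y ∈ B, ∃ x, (x ∈ T₁ ∨ x ∈ T₂) ∧ dist x y ≤ δ * r n) ∧
    T₁.card * r n ^ D₁ ≤ C ∧ T₂.card * r n ^ D₂ ≤ C ∧
    (∀ x ∈ T₁, κ₁ * r n ^ d ≤ μ.real (Metric.closedBall x (r n))) ∧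
    ∀ x ∈ T₂, κ₂ * r n ^ d ≤ μ.real (Metric.closedBall x (r n)) := by
    intro n
    by_cases h : 0 < r n ∧ r n < r₀
    · obtain ⟨T₁, T₂, h'⟩ := hT _ h.1 h.2
      exact ⟨T₁, T₂, fun _ _ => h'⟩
    -- A default for inadmissible radii, which `hgood` excludes for large n.
    · exact ⟨∅, ∅, fun a b => absurd ⟨a, b⟩ h⟩
  choose T₁ T₂ hTT using hT'
  have hlogn : Tendsto (fun n : ℕ => Real.log n / n) atTop (𝓝 0) := by
    have h := (Real.isLittleO_log_id_atTop).tendsto_div_nhds_zero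
    exact h.comp tendsto_natCast_atTop_atTop
  have hrlim : Tendsto r atTop (𝓝 0) := by
    refine tendsto_rad hd ?_
    simpa [mul_div_assoc] using hlogn.const_mul u₁
  have hgood : ∀ᶠ n : ℕ in atTop, 0 < r n ∧ r n < r₀ ∧ 1 ≤ Real.log n ∧ (0 : ℝ) < n := by
    filter_upwards [hrlim.eventually_lt_const hr₀, tendsto_log_nat.eventually_ge_atTop 1,
      eventually_gt_atTop 0] with n h1 h2 h3
    have h3' : (0 : ℝ) < n := by exact_mod_cast h3
    have : 0 < Real.log n := by linarith
    exact ⟨rad_pos (by positivity), h1, h2, h3'⟩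
  have hA₁ := ae_eventually_forall_log_le_hits hX hind hlaw (T := T₁)
    (S := fun n x => Metric.closedBall x (r n)) (fun n x => measurableSet_closedBall)
    (b := β + δ) (by linarith) hb₁ hr₁ (by
      filter_upwards [hgood] with n ⟨g1, g2, g3, g4⟩
      exact card_le_of_card_mul_rad_pow_le hu₁0 g3 g4 (hTT n g1 g2).2.1) (by
      filter_upwards [hgood] with n ⟨g1, g2, g3, g4⟩ x hx
      refine le_trans (le_of_eq ?_) ((hTT n g1 g2).2.2.2.1 x hx)
      rw [hr, rad_pow hd (by positivity)]; ring)
  have hA₂ := ae_eventually_forall_log_le_hits hX hind hlaw (T := T₂)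
    (S := fun n x => Metric.closedBall x (r n)) (fun n x => measurableSet_closedBall)
    (b := β + δ) (by linarith) hb₂ hr₂ (by
      filter_upwards [hgood] with n ⟨g1, g2, g3, g4⟩
      exact card_le_of_card_mul_rad_pow_le hu₁0 g3 g4 (hTT n g1 g2).2.2.1) (by
      filter_upwards [hgood] with n ⟨g1, g2, g3, g4⟩ x hx
      refine le_trans (le_of_eq ?_) ((hTT n g1 g2).2.2.2.2 x hx)
      rw [hr, rad_pow hd (by positivity)]; ring)
  obtain ⟨K₁, hK₁⟩ := hA₁
  obtain ⟨K₂, hK₂⟩ := hA₂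
  set K := max (max K₁ K₂) 1 with hK
  have hK0 : K ≠ 0 := by omega
  have hjK : Tendsto (fun j : ℕ => j ^ K) atTop atTop := tendsto_pow_atTop hK0
  have hratio : ∀ᶠ j : ℕ in atTop, (((j + 1) ^ K : ℕ) : ℝ) ≤ (1 + δ) * ((j ^ K : ℕ) : ℝ) := by
    have h1 : Tendsto (fun j : ℕ => (1 + 1 / (j : ℝ)) ^ K) atTop (𝓝 1) := by
      have := (tendsto_const_nhds (x := (1 : ℝ))).add (tendsto_one_div_atTop_nhds_zero_nat (𝕜 := ℝ))
      simpa using this.pow K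
    filter_upwards [h1.eventually_lt_const (show (1 : ℝ) < 1 + δ by linarith),
      eventually_gt_atTop 0] with j h2 h3
    have h3' : (0 : ℝ) < j := by exact_mod_cast h3
    push_cast
    have e : ((j : ℝ) + 1) ^ K = (1 + 1 / (j : ℝ)) ^ K * (j : ℝ) ^ K := by
      rw [← mul_pow]; congr 1; field_simp
    rw [e]
    gcongr
  have hkn : ∀ᶠ n : ℕ in atTop, (k n : ℝ) ≤ (β + δ / 2) * Real.log n := by
    filter_upwards [hk.eventually_lt_const (show β < β + δ / 2 by linarith), hgood] with
      n h1 ⟨_, _, h2, _⟩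
    rw [div_lt_iff₀ (by linarith)] at h1
    exact h1.le
  filter_upwards [hK₁ K (by omega), hK₂ K (by omega)] with ω hω₁ hω₂
  refine eventually_atTop_of_eventually_pow hK0 ?_
  obtain ⟨n₀, hn₀⟩ := eventually_atTop.1 hkn
  filter_upwards [hω₁, hω₂, hjK.eventually hgood, hratio, hjK.eventually_ge_atTop n₀,
    (tendsto_log_nat.comp hjK).eventually_ge_atTop ((β + δ / 2) * Real.log (1 + δ) / (δ / 2))]
    with j g₁ g₂ ⟨p1, p2, p3, p4⟩ g3 g4 g5 n hn1 hn2 y hy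
  -- The counts at time N are compared with the requirement at time n: k(n) ≤ (β + δ/2) log n ≤ (β +
  -- δ) log N, as log n - log N stays bounded by log(1 + δ).
  set N := j ^ K with hN
  have hNn : (N : ℝ) ≤ n := by exact_mod_cast hn1
  have hn0 : (0 : ℝ) < n := p4.trans_le hNn
  have hnN : (n : ℝ) ≤ (1 + δ) * N := by
    refine le_trans ?_ g3
    exact_mod_cast hn2.le
  have hlogle : Real.log N ≤ Real.log n := Real.log_le_log p4 hNn
  have hlog2 : Real.log n ≤ Real.log (1 + δ) + Real.log N := by
    rw [← Real.log_mul (by positivity) p4.ne']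
    exact Real.log_le_log hn0 hnN
  have hkb : (k n : ℝ) ≤ (β + δ) * Real.log N := by
    refine (hn₀ n (g4.trans hn1)).trans ?_
    simp only [Function.comp] at g5
    rw [div_le_iff₀ (by linarith)] at g5
    nlinarith
  obtain ⟨x, hx, hxy⟩ := (hTT N p1 p2).1 y hy
  have hhit : (β + δ) * Real.log N ≤ hits X N (Metric.closedBall x (r N)) ω := by
    rcases hx with hx | hx
    · exact g₁ x hx
    · exact g₂ x hx
  have hkh : k n ≤ hits X N (Metric.closedBall x (r N)) ω := by exact_mod_cast hkb.trans hhit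
  refine hkh.trans (hits_mono X hn1 (Metric.closedBall_subset_closedBall' ?_) ω)
  calc r N + dist x y ≤ (1 + δ) * r N := by linarith
    _ = rad d ((1 + δ) ^ d * (u₁ * Real.log N / N)) := mul_rad hd (by linarith) (by positivity)
    _ ≤ rad d (u * Real.log n / n) := by
      refine rad_le_rad (by positivity) ?_
      have e : (1 + δ) ^ d * (u₁ * Real.log N / N) = u * Real.log N / ((1 + δ) * N) := by
        rw [hu₁, pow_succ]; field_simp
      rw [e]
      gcongr

/-- Same net argument without a subsequence, hence only d factors 1 + δ. The exponents D₁ and D₂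
matter only through being at most d, so that the nets have O(n) points. -/
theorem ae_eventually_covered (hX : ∀ i, Measurable (X i)) (hind : iIndepFun X P)
    (hlaw : ∀ i, P.map (X i) = μ) (hd : d ≠ 0) (hcov : HasCovers μ B d D₁ D₂ κ₁ κ₂)
    (hD₁ : D₁ ≤ d) (hD₂ : D₂ ≤ d)
    (hk : Tendsto (fun n : ℕ => (k n : ℝ) / Real.log n) atTop atTop)
    (hkn : Tendsto (fun n : ℕ => (k n : ℝ) / n) atTop (𝓝 0)) (hu : 0 < u)
    (h₁ : 1 < u * κ₁) (h₂ : 1 < u * κ₂) :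
    ∀ᵐ ω ∂P, ∀ᶠ n : ℕ in atTop, ∀ x ∈ B,
      k n ≤ hits X n (Metric.closedBall x (rad d (u * k n / n))) ω := by
  have hδex : ∀ c : ℝ, 1 < c → ∀ᶠ δ : ℝ in 𝓝[>] 0, 1 < c / (1 + δ) ^ d := by
    intro c hc
    have hf : ContinuousAt (fun δ : ℝ => c / (1 + δ) ^ d) 0 :=
      ContinuousAt.div continuousAt_const (by fun_prop) (by simp)
    exact (hf.tendsto.eventually_const_lt (by simpa using hc)).filter_mono nhdsWithin_le_nhds
  obtain ⟨δ, ⟨hc₁, hc₂⟩, hδ⟩ := (((hδex _ h₁).and (hδex _ h₂)).and self_mem_nhdsWithin).exists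
  replace hδ : 0 < δ := hδ
  set u₁ := u / (1 + δ) ^ d with hu₁
  have hu₁0 : 0 < u₁ := by positivity
  have e₁ : u * κ₁ / (1 + δ) ^ d = u₁ * κ₁ := by rw [hu₁]; ring
  have e₂ : u * κ₂ / (1 + δ) ^ d = u₁ * κ₂ := by rw [hu₁]; ring
  rw [e₁] at hc₁
  rw [e₂] at hc₂
  obtain ⟨C, r₀, hr₀, hT⟩ := hcov δ hδ
  set r : ℕ → ℝ := fun n => rad d (u₁ * k n / n) with hr
  have hT' : ∀ n, ∃ T₁ T₂ : Finset E, 0 < r n → r n < r₀ →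
    (∀ y ∈ B, ∃ x, (x ∈ T₁ ∨ x ∈ T₂) ∧ dist x y ≤ δ * r n) ∧
    T₁.card * r n ^ D₁ ≤ C ∧ T₂.card * r n ^ D₂ ≤ C ∧
    (∀ x ∈ T₁, κ₁ * r n ^ d ≤ μ.real (Metric.closedBall x (r n))) ∧
    ∀ x ∈ T₂, κ₂ * r n ^ d ≤ μ.real (Metric.closedBall x (r n)) := by
    intro n
    by_cases h : 0 < r n ∧ r n < r₀
    · obtain ⟨T₁, T₂, h'⟩ := hT _ h.1 h.2
      exact ⟨T₁, T₂, fun _ _ => h'⟩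
    · exact ⟨∅, ∅, fun a b => absurd ⟨a, b⟩ h⟩
  choose T₁ T₂ hTT using hT'
  have hrlim : Tendsto r atTop (𝓝 0) := by
    refine tendsto_rad hd ?_
    simpa [mul_div_assoc] using hkn.const_mul u₁
  have hgood : ∀ᶠ n : ℕ in atTop, 0 < r n ∧ r n < r₀ ∧ 1 ≤ (k n : ℝ) ∧ (1 : ℝ) ≤ n := by
    filter_upwards [hrlim.eventually_lt_const hr₀, tendsto_log_nat.eventually_ge_atTop 1,
      eventually_gt_atTop 0, hk.eventually_ge_atTop 1] with n h1 h2 h3 h4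
    have h3' : (1 : ℝ) ≤ n := by exact_mod_cast h3
    rw [one_le_div (by linarith)] at h4
    have : (0 : ℝ) < k n := by linarith
    exact ⟨rad_pos (by positivity), h1, by linarith, h3'⟩
  have hcard : ∀ {D N n : ℕ}, D ≤ d → 1 ≤ (k n : ℝ) → (1 : ℝ) ≤ n → N * r n ^ D ≤ C →
      0 ≤ C → (N : ℝ) ≤ C * ((u₁ ^ ((D : ℝ) / d))⁻¹) * n := by
    intro D N n hD h1 h2 h3 h4
    refine (card_le_of_card_mul_rad_pow_le hu₁0 h1 (by linarith) h3).trans ?_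
    gcongr
    refine (Real.rpow_le_rpow_of_exponent_le h2 (z := 1) ?_).trans (Real.rpow_one _).le
    have : (D : ℝ) ≤ d := by exact_mod_cast hD
    exact div_le_one_of_le₀ this (by positivity)
  have hA₁ := ae_eventually_forall_le_hits hX hind hlaw (T := T₁)
    (S := fun n x => Metric.closedBall x (r n)) (fun n x => measurableSet_closedBall)
    hc₁ hk (C := C * ((u₁ ^ ((D₁ : ℝ) / d))⁻¹)) (by
      filter_upwards [hgood] with n ⟨g1, g2, g3, g4⟩
      have h := (hTT n g1 g2).2.1
      exact hcard hD₁ g3 g4 h (le_trans (by positivity) h)) (by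
      filter_upwards [hgood] with n ⟨g1, g2, g3, g4⟩ x hx
      refine le_trans (le_of_eq ?_) ((hTT n g1 g2).2.2.2.1 x hx)
      rw [hr, rad_pow hd (by positivity)]; ring)
  have hA₂ := ae_eventually_forall_le_hits hX hind hlaw (T := T₂)
    (S := fun n x => Metric.closedBall x (r n)) (fun n x => measurableSet_closedBall)
    hc₂ hk (C := C * ((u₁ ^ ((D₂ : ℝ) / d))⁻¹)) (by
      filter_upwards [hgood] with n ⟨g1, g2, g3, g4⟩
      have h := (hTT n g1 g2).2.2.1
      exact hcard hD₂ g3 g4 h (le_trans (by positivity) h)) (by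
      filter_upwards [hgood] with n ⟨g1, g2, g3, g4⟩ x hx
      refine le_trans (le_of_eq ?_) ((hTT n g1 g2).2.2.2.2 x hx)
      rw [hr, rad_pow hd (by positivity)]; ring)
  filter_upwards [hA₁, hA₂] with ω hω₁ hω₂
  filter_upwards [hω₁, hω₂, hgood] with n g₁ g₂ ⟨p1, p2, p3, p4⟩ y hy
  obtain ⟨x, hx, hxy⟩ := (hTT n p1 p2).1 y hy
  have hkh : k n ≤ hits X n (Metric.closedBall x (r n)) ω := by
    rcases hx with hx | hx
    · exact g₁ x hx
    · exact g₂ x hx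
  refine hkh.trans (hits_mono X le_rfl (Metric.closedBall_subset_closedBall' ?_) ω)
  calc r n + dist x y ≤ (1 + δ) * r n := by linarith
    _ = rad d ((1 + δ) ^ d * (u₁ * k n / n)) := mul_rad hd (by linarith) (by positivity)
    _ = rad d (u * k n / n) := by
      congr 1
      rw [hu₁]; field_simp

/-- At this radius a packing contains about (n / log n)^(D/d) disjoint balls, more than the
reciprocal of the probability that one of them is deficient. -/
theorem ae_eventually_not_covered_log (hX : ∀ i, Measurable (X i)) (hind : iIndepFun X P)
    (hlaw : ∀ i, P.map (X i) = μ) (hd : d ≠ 0) (hpack : HasPackings μ B d D κ)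
    (hk1 : ∀ n, 1 ≤ n → 1 ≤ k n)
    (hβ : 0 ≤ β) (hk : Tendsto (fun n : ℕ => (k n : ℝ) / Real.log n) atTop (𝓝 β)) (hu : 0 < u)
    (h₁ : β < u * κ) (h₁' : rate (u * κ) β < (D : ℝ) / d) :
    ∀ᵐ ω ∂P, ∀ᶠ n : ℕ in atTop, ∃ x ∈ B,
      hits X n (Metric.closedBall x (rad d (u * Real.log n / n))) ω < k n := by
  -- The tail estimate needs b log n < k(n) strictly. For β > 0 a value slightly below β works; for
  -- β = 0 take b = 0 and use k(n) ≥ 1.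
  have hb : ∃ b, 0 ≤ b ∧ b < u * κ ∧ rate (u * κ) b < (D : ℝ) / d ∧
      ∀ᶠ n : ℕ in atTop, b * Real.log n < k n := by
    rcases hβ.eq_or_lt with rfl | hβ0
    · refine ⟨0, le_rfl, h₁, h₁', ?_⟩
      filter_upwards [eventually_ge_atTop 1] with n hn
      have := hk1 n hn
      rw [zero_mul]
      exact_mod_cast this
    · have hr : ContinuousAt (fun b : ℝ => rate (u * κ) b) β :=
        ContinuousAt.comp (f := fun b : ℝ => (u * κ, b)) (continuousAt_rate (hβ0.trans h₁).ne')
          (by fun_prop)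
      have h3 : ∀ᶠ b in 𝓝[<] β, rate (u * κ) b < (D : ℝ) / d ∧ 0 < b :=
        ((hr.tendsto.eventually_lt_const h₁').and (lt_mem_nhds hβ0)).filter_mono
          nhdsWithin_le_nhds
      obtain ⟨b, ⟨hb1, hb2⟩, hb3⟩ := (h3.and self_mem_nhdsWithin).exists
      replace hb3 : b < β := hb3
      refine ⟨b, hb2.le, hb3.trans h₁, hb1, ?_⟩
      filter_upwards [hk.eventually_const_lt hb3, tendsto_log_nat.eventually_gt_atTop 0] with
        n g1 g2
      exact (lt_div_iff₀ g2).1 g1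
  obtain ⟨b, hb0, hb1, hb2, hb3⟩ := hb
  obtain ⟨C, r₀, hC, hr₀, hT⟩ := hpack
  set r : ℕ → ℝ := fun n => rad d (u * Real.log n / n) with hr
  have hT' : ∀ n, ∃ T : Finset E, 0 < r n → r n < r₀ → ↑T ⊆ B ∧
    C ≤ T.card * r n ^ D ∧ (T : Set E).PairwiseDisjoint (Metric.closedBall · (r n)) ∧
    ∀ x ∈ T, μ.real (Metric.closedBall x (r n)) ≤ κ * r n ^ d := by
    intro n
    by_cases h : 0 < r n ∧ r n < r₀
    · obtain ⟨T, h'⟩ := hT _ h.1 h.2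
      exact ⟨T, fun _ _ => h'⟩
    · exact ⟨∅, fun a b => absurd ⟨a, b⟩ h⟩
  choose T hTT using hT'
  have hlogn : Tendsto (fun n : ℕ => Real.log n / n) atTop (𝓝 0) := by
    have h := (Real.isLittleO_log_id_atTop).tendsto_div_nhds_zero
    exact h.comp tendsto_natCast_atTop_atTop
  have hrlim : Tendsto r atTop (𝓝 0) := by
    refine tendsto_rad hd ?_
    simpa [mul_div_assoc] using hlogn.const_mul u
  have hgood : ∀ᶠ n : ℕ in atTop, 0 < r n ∧ r n < r₀ ∧ 1 ≤ Real.log n ∧ (0 : ℝ) < n := by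
    filter_upwards [hrlim.eventually_lt_const hr₀, tendsto_log_nat.eventually_ge_atTop 1,
      eventually_gt_atTop 0] with n h1 h2 h3
    have h3' : (0 : ℝ) < n := by exact_mod_cast h3
    have : 0 < Real.log n := by linarith
    exact ⟨rad_pos (by positivity), h1, h2, h3'⟩
  have key := ae_eventually_exists_hits_lt hX hind hlaw (T := T)
    (S := fun n x => Metric.closedBall x (r n)) (fun n x => measurableSet_closedBall) (by
      filter_upwards [hgood] with n ⟨g1, g2, g3, g4⟩
      exact (hTT n g1 g2).2.2.1) hb0 hb1 (C := C * (u ^ ((D : ℝ) / d))⁻¹) (by positivity) hb2 (by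
      filter_upwards [hgood] with n ⟨g1, g2, g3, g4⟩
      have h := (hTT n g1 g2).2.1
      have hl : 0 < Real.log n := by linarith
      rw [hr, rad_pow_eq_rpow (by positivity), mul_div_assoc, Real.mul_rpow hu.le (by positivity),
        ← inv_div (n : ℝ), Real.inv_rpow (by positivity)] at h
      have : 0 < u ^ ((D : ℝ) / d) := by positivity
      have : 0 < (n / Real.log n : ℝ) ^ ((D : ℝ) / d) := by positivity
      rw [← div_eq_mul_inv, ← mul_div_assoc, le_div_iff₀ (by positivity)] at h
      rw [← div_eq_mul_inv, div_mul_eq_mul_div, div_le_iff₀ (by positivity)]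
      exact h) hb3 (by
      filter_upwards [hgood] with n ⟨g1, g2, g3, g4⟩ x hx
      refine ((hTT n g1 g2).2.2.2 x hx).trans (le_of_eq ?_)
      rw [hr, rad_pow hd (by positivity)]; ring)
  filter_upwards [key] with ω hω
  filter_upwards [hω, hgood] with n ⟨x, hx, hx'⟩ ⟨g1, g2, _, _⟩
  exact ⟨x, (hTT n g1 g2).1 hx, hx'⟩

/-- Of each packing only one ball is used; C > 0 guarantees that the packing is not empty. -/
theorem ae_eventually_not_covered (hX : ∀ i, Measurable (X i)) (hind : iIndepFun X P)
    (hlaw : ∀ i, P.map (X i) = μ) (hd : d ≠ 0) (hpack : HasPackings μ B d D κ)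
    (hk : Tendsto (fun n : ℕ => (k n : ℝ) / Real.log n) atTop atTop)
    (hkn : Tendsto (fun n : ℕ => (k n : ℝ) / n) atTop (𝓝 0)) (hu : 0 < u) (hκ : 0 < κ)
    (h₁ : u * κ < 1) :
    ∀ᵐ ω ∂P, ∀ᶠ n : ℕ in atTop, ∃ x ∈ B,
      hits X n (Metric.closedBall x (rad d (u * k n / n))) ω < k n := by
  obtain ⟨C, r₀, hC, hr₀, hT⟩ := hpack
  set r : ℕ → ℝ := fun n => rad d (u * k n / n) with hr
  have hne : Nonempty E := by
    obtain ⟨T, -, h, -⟩ := hT (r₀ / 2) (by linarith) (by linarith)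
    rcases T.eq_empty_or_nonempty with rfl | ⟨x, -⟩
    · simp at h; linarith
    · exact ⟨x⟩
  have hT' : ∀ n, ∃ x : E, 0 < r n → r n < r₀ → x ∈ B ∧
      μ.real (Metric.closedBall x (r n)) ≤ κ * r n ^ d := by
    intro n
    by_cases h : 0 < r n ∧ r n < r₀
    · obtain ⟨T, hTB, hcard, -, h'⟩ := hT _ h.1 h.2
      rcases T.eq_empty_or_nonempty with rfl | ⟨x, hx⟩
      · simp at hcard; linarith
      · exact ⟨x, fun _ _ => ⟨hTB hx, h' x hx⟩⟩
    · exact ⟨hne.some, fun a b => absurd ⟨a, b⟩ h⟩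
  choose x hx using hT'
  have hrlim : Tendsto r atTop (𝓝 0) := by
    refine tendsto_rad hd ?_
    simpa [mul_div_assoc] using hkn.const_mul u
  have hgood : ∀ᶠ n : ℕ in atTop, 0 < r n ∧ r n < r₀ := by
    filter_upwards [hrlim.eventually_lt_const hr₀, tendsto_log_nat.eventually_ge_atTop 1,
      eventually_gt_atTop 0, hk.eventually_ge_atTop 1] with n h1 h2 h3 h4
    have h3' : (0 : ℝ) < n := by exact_mod_cast h3
    rw [one_le_div (by linarith)] at h4
    have : (0 : ℝ) < k n := by linarith
    exact ⟨rad_pos (by positivity), h1⟩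
  have key := ae_eventually_hits_lt hX hind hlaw
    (S := fun n => Metric.closedBall (x n) (r n)) (fun n => measurableSet_closedBall)
    (mul_pos hu hκ) h₁ hk (by
      filter_upwards [hgood] with n ⟨g1, g2⟩
      refine ((hx n g1 g2).2).trans (le_of_eq ?_)
      rw [hr, rad_pow hd (by positivity)]; ring)
  filter_upwards [key] with ω hω
  filter_upwards [hω, hgood] with n h ⟨g1, g2⟩
  exact ⟨x n, (hx n g1 g2).1, h⟩

end AlmostSure

/-! ### The Riemannian volume in a chart -/

section Volume

variable {d m : ℕ} {M : Set (EuclideanSpace ℝ (Fin m))} {U V : Set (EuclideanSpace ℝ (Fin d))}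
  {g h : EuclideanSpace ℝ (Fin d) → EuclideanSpace ℝ (Fin m)}

lemma IsChart.contDiffAt (hg : IsChart M U g) {u : EuclideanSpace ℝ (Fin d)} (hu : u ∈ U) :
    ContDiffAt ℝ 2 g u :=
  hg.contDiffOn.contDiffAt (hg.isOpen.mem_nhds hu)

lemma IsChart.hasStrictFDerivAt (hg : IsChart M U g) {u : EuclideanSpace ℝ (Fin d)}
    (hu : u ∈ U) : HasStrictFDerivAt g (fderiv ℝ g u) u :=
  (hg.contDiffAt hu).hasStrictFDerivAt (by norm_num)

lemma IsChart.continuousOn (hg : IsChart M U g) : ContinuousOn g U := hg.contDiffOn.continuousOn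

lemma IsChart.aemeasurable (hg : IsChart M U g) :
    AEMeasurable g ((volume.restrict U).withDensity fun u => ENNReal.ofReal (volumeDensity g u)) :=
  (hg.continuousOn.aemeasurable hg.isOpen.measurableSet).mono_ac
    (withDensity_absolutelyContinuous _ _)

lemma chartVolume_apply (hg : IsChart M U g) {S : Set (EuclideanSpace ℝ (Fin m))}
    (hS : MeasurableSet S) :
    chartVolume U g S = ∫⁻ u in g ⁻¹' S ∩ U, ENNReal.ofReal (volumeDensity g u) := by
  rw [chartVolume, Measure.map_apply_of_aemeasurable hg.aemeasurable hS, withDensity_apply',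
    Measure.restrict_restrict' hg.isOpen.measurableSet]

lemma jacobian_eq_mul {v u : EuclideanSpace ℝ (Fin d)}
    {φ' : EuclideanSpace ℝ (Fin d) →L[ℝ] EuclideanSpace ℝ (Fin d)}
    (h' : fderiv ℝ h v = (fderiv ℝ g u).comp φ') :
    jacobian h v = jacobian g u * LinearMap.toMatrix (EuclideanSpace.basisFun (Fin d) ℝ).toBasis
      (EuclideanSpace.basisFun (Fin d) ℝ).toBasis (φ' : EuclideanSpace ℝ (Fin d) →ₗ[ℝ] _) := by
  ext i j
  rw [Matrix.mul_apply]
  simp only [jacobian, Matrix.of_apply, LinearMap.toMatrix_apply, h',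
    ContinuousLinearMap.comp_apply, OrthonormalBasis.coe_toBasis, EuclideanSpace.basisFun_apply,
    OrthonormalBasis.coe_toBasis_repr_apply, EuclideanSpace.basisFun_repr,
    ContinuousLinearMap.coe_coe]
  set w := φ' (EuclideanSpace.single j 1) with hw
  have hsum : w = ∑ k, w k • EuclideanSpace.single k (1 : ℝ) := by
    have := (EuclideanSpace.basisFun (Fin d) ℝ).sum_repr w
    simpa using this.symm
  conv_lhs => rw [hsum, map_sum]
  simp [mul_comm]

lemma volumeDensity_eq_mul {v u : EuclideanSpace ℝ (Fin d)}
    {φ' : EuclideanSpace ℝ (Fin d) →L[ℝ] EuclideanSpace ℝ (Fin d)}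
    (h' : fderiv ℝ h v = (fderiv ℝ g u).comp φ') :
    volumeDensity h v = |φ'.det| * volumeDensity g u := by
  have e : φ'.det = (LinearMap.toMatrix (EuclideanSpace.basisFun (Fin d) ℝ).toBasis
      (EuclideanSpace.basisFun (Fin d) ℝ).toBasis
      (φ' : EuclideanSpace ℝ (Fin d) →ₗ[ℝ] _)).det := by
    rw [LinearMap.det_toMatrix]
  rw [volumeDensity, volumeDensity, jacobian_eq_mul h', e]
  set A := LinearMap.toMatrix (EuclideanSpace.basisFun (Fin d) ℝ).toBasis
      (EuclideanSpace.basisFun (Fin d) ℝ).toBasis (φ' : EuclideanSpace ℝ (Fin d) →ₗ[ℝ] _)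
  have : ((jacobian g u * A).transpose * (jacobian g u * A)).det =
      A.det ^ 2 * ((jacobian g u).transpose * jacobian g u).det := by
    rw [Matrix.transpose_mul, Matrix.mul_assoc, ← Matrix.mul_assoc (jacobian g u).transpose,
      Matrix.det_mul, Matrix.det_mul, Matrix.det_transpose]
    ring
  rw [this, Real.sqrt_mul (sq_nonneg _), Real.sqrt_sq_eq_abs]

/-- A map between parameter domains that is continuous and commutes with two charts is
differentiable. -/
lemma exists_hasFDerivAt_transition (hg : IsChart M U g) (hh : IsChart M V h)
    {φ : EuclideanSpace ℝ (Fin d) → EuclideanSpace ℝ (Fin d)} {v : EuclideanSpace ℝ (Fin d)}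
    (hv : v ∈ V) (hφU : φ v ∈ U) (hφ : ContinuousAt φ v) (hcomm : ∀ᶠ w in 𝓝 v, g (φ w) = h w) :
    ∃ φ' : EuclideanSpace ℝ (Fin d) →L[ℝ] EuclideanSpace ℝ (Fin d), HasFDerivAt φ φ' v ∧
      fderiv ℝ h v = (fderiv ℝ g (φ v)).comp φ' := by
  -- A left inverse of the derivative of `g` projects to equal dimensions, where the inverse
  -- function theorem applies; near `v`, `φ` is then a local inverse composed with the projection of
  -- `h`.
  obtain ⟨L, hL⟩ := LinearMap.exists_leftInverse_of_injective
    (fderiv ℝ g (φ v) : EuclideanSpace ℝ (Fin d) →ₗ[ℝ] EuclideanSpace ℝ (Fin m))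
    (LinearMap.ker_eq_bot.2 (hg.fullRank _ hφU))
  set L' := L.toContinuousLinearMap with hL'
  have hG : HasStrictFDerivAt (fun u => L' (g u))
      ((ContinuousLinearEquiv.refl ℝ (EuclideanSpace ℝ (Fin d)) :
        EuclideanSpace ℝ (Fin d) →L[ℝ] EuclideanSpace ℝ (Fin d))) (φ v) := by
    have h1 := L'.hasStrictFDerivAt.comp (φ v) (hg.hasStrictFDerivAt hφU)
    have e : L'.comp (fderiv ℝ g (φ v)) =
        (ContinuousLinearEquiv.refl ℝ (EuclideanSpace ℝ (Fin d)) :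
        EuclideanSpace ℝ (Fin d) →L[ℝ] EuclideanSpace ℝ (Fin d)) := by
      ext1 x
      exact LinearMap.congr_fun hL x
    rw [e] at h1
    exact h1
  have hev : ∀ᶠ w in 𝓝 v, hG.localInverse _ _ _ (L' (h w)) = φ w := by
    filter_upwards [hcomm, hφ.eventually hG.eventually_left_inverse] with w h1 h2
    rw [← h1]
    exact h2
  have hh' : HasFDerivAt h (fderiv ℝ h v) v := (hh.hasStrictFDerivAt hv).hasFDerivAt
  have hcv : g (φ v) = h v := hcomm.self_of_nhds
  have hinv := hG.to_localInverse.hasFDerivAt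
  rw [hcv] at hinv
  have hc := (hinv.comp v (L'.hasFDerivAt.comp v hh')).congr_of_eventuallyEq
    (hev.mono fun w hw => hw.symm)
  refine ⟨_, hc, ?_⟩
  have h2 := ((hg.hasStrictFDerivAt hφU).hasFDerivAt.comp v hc).congr_of_eventuallyEq
    (hcomm.mono fun w hw => hw.symm)
  exact hh'.unique h2

/-- On the range of a chart, every other chart volume is dominated by that of the chart. -/
lemma chartVolume_le_chartVolume (hg : IsChart M U g) (hh : IsChart M V h)
    {W : Set (EuclideanSpace ℝ (Fin m))} (hW : IsOpen W) (hWM : g '' U = W ∩ M)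
    {S : Set (EuclideanSpace ℝ (Fin m))} (hS : MeasurableSet S) (hSW : S ⊆ W) :
    chartVolume V h S ≤ chartVolume U g S := by
  classical
  -- This is the transition map g⁻¹ ∘ h. Its continuity comes from openness of `g` onto its image,
  -- its derivative from the preceding lemma, and the rest is the change of variables formula.
  set φ : EuclideanSpace ℝ (Fin d) → EuclideanSpace ℝ (Fin d) :=
    fun v => Function.invFunOn g U (h v) with hφ
  set V' := V ∩ h ⁻¹' W with hV'
  have hV'o : IsOpen V' := hh.continuousOn.isOpen_inter_preimage hh.isOpen hW
  have hmem : ∀ v ∈ V', h v ∈ g '' U := fun v hv => by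
    rw [hWM]; exact ⟨hv.2, hh.image_subset ⟨v, hv.1, rfl⟩⟩
  have hφU : ∀ v ∈ V', φ v ∈ U := fun v hv => Function.invFunOn_mem (hmem v hv)
  have hgφ : ∀ v ∈ V', g (φ v) = h v := fun v hv => Function.invFunOn_eq (hmem v hv)
  have hcont : ∀ v ∈ V', ContinuousAt φ v := by
    intro v hv
    rw [ContinuousAt, tendsto_def]
    intro N hN
    obtain ⟨N', hN'N, hN'o, hvN'⟩ := mem_nhds_iff.1 hN
    obtain ⟨O, hO, hOM⟩ := hg.isOpen_image (N' ∩ U) Set.inter_subset_right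
      (hN'o.inter hg.isOpen)
    have hvO : h v ∈ O := by
      have : h v ∈ g '' (N' ∩ U) := ⟨φ v, ⟨hvN', hφU v hv⟩, hgφ v hv⟩
      rw [hOM] at this
      exact this.1
    have hc : ContinuousAt h v := hh.continuousOn.continuousAt (hh.isOpen.mem_nhds hv.1)
    filter_upwards [hV'o.mem_nhds hv, hc.preimage_mem_nhds (hO.mem_nhds hvO)] with w hw hwO
    have : h w ∈ g '' (N' ∩ U) := by
      rw [hOM]; exact ⟨hwO, hh.image_subset ⟨w, hw.1, rfl⟩⟩
    obtain ⟨z, hz, hzw⟩ := this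
    have : z = φ w := hg.injOn hz.2 (hφU w hw) (by rw [hzw, hgφ w hw])
    exact hN'N (this ▸ hz.1)
  have hder : ∀ v, ∃ φ' : EuclideanSpace ℝ (Fin d) →L[ℝ] EuclideanSpace ℝ (Fin d), v ∈ V' →
      HasFDerivAt φ φ' v ∧ fderiv ℝ h v = (fderiv ℝ g (φ v)).comp φ' := by
    intro v
    by_cases hv : v ∈ V'
    · obtain ⟨φ', h'⟩ := exists_hasFDerivAt_transition hg hh hv.1 (hφU v hv) (hcont v hv)
        (by filter_upwards [hV'o.mem_nhds hv] with w hw using hgφ w hw)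
      exact ⟨φ', fun _ => h'⟩
    · exact ⟨0, fun h => absurd h hv⟩
  choose φ' hφ' using hder
  have hsub : h ⁻¹' S ∩ V ⊆ V' := fun v hv => ⟨hv.2, hSW hv.1⟩
  have hmeas : MeasurableSet (h ⁻¹' S ∩ V) := by
    rw [Set.inter_comm]
    have hm : Measurable (V.piecewise h fun _ => 0) :=
      hh.continuousOn.measurable_piecewise continuousOn_const hh.isOpen.measurableSet
    have e : V ∩ h ⁻¹' S = V ∩ (V.piecewise h fun _ => 0) ⁻¹' S := by
      ext v
      by_cases hv : v ∈ V <;> simp [hv]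
    rw [e]
    exact hh.isOpen.measurableSet.inter (hm hS)
  have hinj : Set.InjOn φ (h ⁻¹' S ∩ V) := by
    intro v hv w hw hvw
    refine hh.injOn hv.2 hw.2 ?_
    rw [← hgφ v (hsub hv), ← hgφ w (hsub hw), hvw]
  rw [chartVolume_apply hg hS, chartVolume_apply hh hS]
  calc ∫⁻ v in h ⁻¹' S ∩ V, ENNReal.ofReal (volumeDensity h v)
      = ∫⁻ v in h ⁻¹' S ∩ V, ENNReal.ofReal |(φ' v).det| *
          ENNReal.ofReal (volumeDensity g (φ v)) := by
        refine setLIntegral_congr_fun hmeas fun v hv => ?_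
        rw [volumeDensity_eq_mul (hφ' v (hsub hv)).2, ENNReal.ofReal_mul (abs_nonneg _)]
    _ = ∫⁻ u in φ '' (h ⁻¹' S ∩ V), ENNReal.ofReal (volumeDensity g u) :=
        (lintegral_image_eq_lintegral_abs_det_fderiv_mul volume hmeas
          (fun v hv => (hφ' v (hsub hv)).1.hasFDerivWithinAt) hinj
          fun u => ENNReal.ofReal (volumeDensity g u)).symm
    _ ≤ ∫⁻ u in g ⁻¹' S ∩ U, ENNReal.ofReal (volumeDensity g u) := by
        refine lintegral_mono_set ?_
        rintro _ ⟨v, hv, rfl⟩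
        refine ⟨?_, hφU v (hsub hv)⟩
        rw [Set.mem_preimage, hgφ v (hsub hv)]
        exact hv.1

lemma chartVolume_le_riemannianVolume (hg : IsChart M U g) :
    chartVolume U g ≤ riemannianVolume d M :=
  le_iSup_of_le U (le_iSup_of_le g (le_iSup_of_le hg le_rfl))

lemma riemannianVolume_le {ν : Measure (EuclideanSpace ℝ (Fin m))}
    (hν : ∀ (U : Set (EuclideanSpace ℝ (Fin d)))
      (g : EuclideanSpace ℝ (Fin d) → EuclideanSpace ℝ (Fin m)), IsChart M U g →
      chartVolume U g ≤ ν) : riemannianVolume d M ≤ ν :=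
  iSup_le fun U => iSup_le fun g => iSup_le fun hg => hν U g hg

/-- A supremum of measures is bounded above only by exhibiting a measure that dominates each of
them. Infinite mass at every point off `W` makes domination trivial for sets not contained in `W`,
while adding nothing inside `W`. -/
lemma le_top_smul_count_restrict {ν : Measure (EuclideanSpace ℝ (Fin m))}
    {W S : Set (EuclideanSpace ℝ (Fin m))} (hW : MeasurableSet W) (h : ¬ S ⊆ W) :
    ν S ≤ ((∞ : ℝ≥0∞) • (Measure.count.restrict Wᶜ)) S := by
  obtain ⟨x, hx, hxW⟩ := Set.not_subset.1 h
  have : ((∞ : ℝ≥0∞) • (Measure.count.restrict Wᶜ : Measure (EuclideanSpace ℝ (Fin m)))) S = ∞ := by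
    rw [Measure.smul_apply, Measure.restrict_apply' hW.compl, smul_eq_mul, ENNReal.top_mul]
    exact (Measure.count_ne_zero ⟨x, hx, hxW⟩)
  rw [this]
  exact le_top

/-- The volume of this chart plus infinite counting measure off `W` dominates every chart volume,
hence their supremum, and it reduces to the chart volume inside `W`. -/
lemma riemannianVolume_apply (hg : IsChart M U g)
    {W : Set (EuclideanSpace ℝ (Fin m))} (hW : IsOpen W) (hWM : g '' U = W ∩ M)
    {S : Set (EuclideanSpace ℝ (Fin m))} (hS : MeasurableSet S) (hSW : S ⊆ W) :
    riemannianVolume d M S = ∫⁻ u in g ⁻¹' S ∩ U, ENNReal.ofReal (volumeDensity g u) := by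
  rw [← chartVolume_apply hg hS]
  refine le_antisymm ?_ (chartVolume_le_riemannianVolume hg S)
  have hle : riemannianVolume d M ≤
      chartVolume U g + (∞ : ℝ≥0∞) • (Measure.count.restrict Wᶜ) := by
    refine riemannianVolume_le fun V h hh => Measure.le_iff.2 fun S' hS' => ?_
    rw [Measure.add_apply]
    by_cases hSW' : S' ⊆ W
    · exact (chartVolume_le_chartVolume hg hh hW hWM hS' hSW').trans le_self_add
    · exact (le_top_smul_count_restrict hW.measurableSet hSW').trans le_add_self
  refine (hle S).trans ?_
  rw [Measure.add_apply, Measure.smul_apply, Measure.restrict_apply hS,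
    Set.disjoint_iff_inter_eq_empty.1 (Set.disjoint_compl_right_iff_subset.2 hSW)]
  simp

lemma riemannianVolume_eq_zero_of_disjoint {S : Set (EuclideanSpace ℝ (Fin m))}
    (hS : MeasurableSet S) (hSM : Disjoint S M) : riemannianVolume d M S = 0 := by
  have hle : riemannianVolume d M ≤ (∞ : ℝ≥0∞) • (Measure.count.restrict Sᶜ) := by
    refine riemannianVolume_le fun V h hh => Measure.le_iff.2 fun S' hS' => ?_
    by_cases hSS : S' ⊆ S
    · rw [chartVolume_apply hh hS']
      have : h ⁻¹' S' ∩ V = ∅ := by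
        rw [Set.eq_empty_iff_forall_notMem]
        rintro v ⟨hv, hvV⟩
        exact Set.disjoint_left.1 hSM (hSS hv) (hh.image_subset ⟨v, hvV, rfl⟩)
      simp [this]
    · exact le_top_smul_count_restrict hS hSS
  refine le_antisymm ((hle S).trans ?_) bot_le
  rw [Measure.smul_apply, Measure.restrict_apply hS]
  simp

/-- By the Lindelöf property countably many chart ranges cover `M`, and each is the image of a Borel
set under a continuous injection, hence Borel. -/
lemma IsC2Submanifold.measurableSet (hM : IsC2Submanifold d M) : MeasurableSet M := by
  have h : ∀ y : M, ∃ W : Set (EuclideanSpace ℝ (Fin m)), IsOpen W ∧ y.1 ∈ W ∧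
      MeasurableSet (W ∩ M) := by
    rintro ⟨y, hy⟩
    obtain ⟨U, g, hg, hyU⟩ := hM.2 y hy
    obtain ⟨W, hW, hWM⟩ := hg.isOpen_image U le_rfl hg.isOpen
    refine ⟨W, hW, (hWM ▸ hyU : y ∈ W ∩ M).1, ?_⟩
    rw [← hWM]
    exact hg.isOpen.measurableSet.image_of_continuousOn_injOn hg.continuousOn hg.injOn
  choose W hW hyW hWM using h
  obtain ⟨T, hT, hTW⟩ := TopologicalSpace.isOpen_iUnion_countable W hW
  have : M = ⋃ y ∈ T, W y ∩ M := by
    rw [← Set.iUnion₂_inter, hTW, eq_comm, Set.inter_eq_right]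
    exact fun y hy => Set.mem_iUnion.2 ⟨⟨y, hy⟩, hyW ⟨y, hy⟩⟩
  rw [this]
  exact MeasurableSet.biUnion hT fun y _ => hWM y

lemma IsC2Submanifold.riemannianVolume_compl (hM : IsC2Submanifold d M) :
    riemannianVolume d M Mᶜ = 0 :=
  riemannianVolume_eq_zero_of_disjoint hM.measurableSet.compl disjoint_compl_left

end Volume

/-! ### Almost isometric charts -/

section Flat

variable {d m : ℕ} {M : Set (EuclideanSpace ℝ (Fin m))} {U : Set (EuclideanSpace ℝ (Fin d))}
  {g : EuclideanSpace ℝ (Fin d) → EuclideanSpace ℝ (Fin m)}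

lemma IsChart.comp_affine (hg : IsChart M U g) (u₀ : EuclideanSpace ℝ (Fin d))
    (L : EuclideanSpace ℝ (Fin d) ≃L[ℝ] EuclideanSpace ℝ (Fin d)) :
    IsChart M ((fun u => u₀ + L u) ⁻¹' U) (fun u => g (u₀ + L u)) where
  isOpen := hg.isOpen.preimage (by fun_prop)
  contDiffOn := hg.contDiffOn.comp (t := U)
    (contDiff_const.add L.contDiff).contDiffOn fun _ hu => hu
  injOn := fun u hu w hw h => by
    have := hg.injOn hu hw h
    simpa using this
  image_subset := by
    rintro _ ⟨u, hu, rfl⟩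
    exact hg.image_subset ⟨_, hu, rfl⟩
  isOpen_image := fun W hW hWo => by
    have hopen : IsOpen ((fun u => u₀ + L u) '' W) := by
      have e : (fun u => u₀ + L u) = (Homeomorph.addLeft u₀) ∘ L.toHomeomorph := rfl
      rw [e, Set.image_comp, Homeomorph.isOpen_image, Homeomorph.isOpen_image]
      exact hWo
    obtain ⟨V, hV, h⟩ := hg.isOpen_image ((fun u => u₀ + L u) '' W)
      (Set.image_subset_iff.2 hW) hopen
    exact ⟨V, hV, by rw [← h, Set.image_image]⟩
  fullRank := fun u hu => by
    have h1 : HasFDerivAt (fun u => u₀ + L u)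
        (L : EuclideanSpace ℝ (Fin d) →L[ℝ] EuclideanSpace ℝ (Fin d)) u :=
      L.hasFDerivAt.const_add u₀
    have h2 := (hg.hasStrictFDerivAt hu).hasFDerivAt.comp u h1
    have h3 : fderiv ℝ (fun u => g (u₀ + L u)) u = _ := h2.fderiv
    rw [h3]
    exact (hg.fullRank _ hu).comp L.injective

/-- An orthonormal basis of the range of `g'`, pulled back through `g'`, gives the coordinates in
which `g'` is isometric. -/
lemma exists_equiv_norm_comp_eq
    {g' : EuclideanSpace ℝ (Fin d) →L[ℝ] EuclideanSpace ℝ (Fin m)} (hg' : Function.Injective g') :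
    ∃ L : EuclideanSpace ℝ (Fin d) ≃L[ℝ] EuclideanSpace ℝ (Fin d), ∀ u, ‖g' (L u)‖ = ‖u‖ := by
  set D := LinearEquiv.ofInjective
    (g' : EuclideanSpace ℝ (Fin d) →ₗ[ℝ] EuclideanSpace ℝ (Fin m)) hg'
  have hfin : Module.finrank ℝ (LinearMap.range
      (g' : EuclideanSpace ℝ (Fin d) →ₗ[ℝ] EuclideanSpace ℝ (Fin m))) = d := by
    rw [← D.finrank_eq, finrank_euclideanSpace_fin]
  set e := ((stdOrthonormalBasis ℝ (LinearMap.range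
      (g' : EuclideanSpace ℝ (Fin d) →ₗ[ℝ] EuclideanSpace ℝ (Fin m)))).reindex
      (finCongr hfin)).repr.symm
  refine ⟨(e.toLinearEquiv.trans D.symm).toContinuousLinearEquiv, fun u => ?_⟩
  have h1 : g' (D.symm (e u)) = (e u : EuclideanSpace ℝ (Fin m)) := by
    have : D (D.symm (e u)) = e u := D.apply_symm_apply _
    exact congrArg Subtype.val this
  have h2 : ((e.toLinearEquiv.trans D.symm).toContinuousLinearEquiv) u = D.symm (e u) := rfl
  rw [h2, h1, Submodule.norm_coe, e.norm_map]

lemma volumeDensity_eq_one {u : EuclideanSpace ℝ (Fin d)}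
    (h : ∀ w, ‖fderiv ℝ g u w‖ = ‖w‖) : volumeDensity g u = 1 := by
  have hinner : ∀ v w, inner ℝ (fderiv ℝ g u v) (fderiv ℝ g u w) = inner ℝ v w := by
    set I : EuclideanSpace ℝ (Fin d) →ₗᵢ[ℝ] EuclideanSpace ℝ (Fin m) :=
      ⟨(fderiv ℝ g u : EuclideanSpace ℝ (Fin d) →ₗ[ℝ] EuclideanSpace ℝ (Fin m)), h⟩
    exact fun v w => I.inner_map_map v w
  have : (jacobian g u).transpose * jacobian g u = 1 := by
    ext i j
    rw [Matrix.mul_apply, Matrix.one_apply]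
    simp only [Matrix.transpose_apply, jacobian, Matrix.of_apply]
    have h1 := hinner (EuclideanSpace.single j 1) (EuclideanSpace.single i 1)
    rw [PiLp.inner_apply] at h1
    simp only [RCLike.inner_apply, conj_trivial] at h1
    rw [h1]
    simp [EuclideanSpace.inner_single_left, eq_comm]
  rw [volumeDensity, this, Matrix.det_one, Real.sqrt_one]

lemma IsChart.continuousAt_volumeDensity (hg : IsChart M U g) {u : EuclideanSpace ℝ (Fin d)}
    (hu : u ∈ U) : ContinuousAt (volumeDensity g) u := by
  have h1 : ContinuousAt (fderiv ℝ g) u :=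
    ((hg.contDiffAt hu).fderiv_right (m := 1) (by norm_num)).continuousAt
  set F : (EuclideanSpace ℝ (Fin d) →L[ℝ] EuclideanSpace ℝ (Fin m)) → ℝ := fun T =>
    Real.sqrt ((Matrix.of fun i j => (T (EuclideanSpace.single j 1)) i :
      Matrix (Fin m) (Fin d) ℝ).transpose *
      (Matrix.of fun i j => (T (EuclideanSpace.single j 1)) i : Matrix (Fin m) (Fin d) ℝ)).det
  have hJ : Continuous fun T : EuclideanSpace ℝ (Fin d) →L[ℝ] EuclideanSpace ℝ (Fin m) =>
      (Matrix.of fun i j => (T (EuclideanSpace.single j 1)) i : Matrix (Fin m) (Fin d) ℝ) := by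
    refine continuous_matrix fun i j => ?_
    simp only [Matrix.of_apply]
    fun_prop
  have hF : Continuous F := ((hJ.matrix_transpose.matrix_mul hJ).matrix_det).sqrt
  exact hF.continuousAt.comp h1

/-- A chart whose parametrization is, on the ball of radius `ρ` about the origin, `ε`-close to an
isometry. -/
structure IsFlatChart (M : Set (EuclideanSpace ℝ (Fin m))) (y : EuclideanSpace ℝ (Fin m))
    (ε ρ : ℝ) (U : Set (EuclideanSpace ℝ (Fin d)))
    (g : EuclideanSpace ℝ (Fin d) → EuclideanSpace ℝ (Fin m)) : Prop where
  isChart : IsChart M U g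
  ball_subset : Metric.ball 0 ρ ⊆ U
  map_zero : g 0 = y
  le_dist : ∀ u ∈ Metric.ball 0 ρ, ∀ w ∈ Metric.ball 0 ρ, (1 - ε) * dist u w ≤ dist (g u) (g w)
  dist_le : ∀ u ∈ Metric.ball 0 ρ, ∀ w ∈ Metric.ball 0 ρ, dist (g u) (g w) ≤ (1 + ε) * dist u w
  le_density : ∀ u ∈ Metric.ball 0 ρ, 1 - ε ≤ volumeDensity g u
  density_le : ∀ u ∈ Metric.ball 0 ρ, volumeDensity g u ≤ 1 + ε

/-- After a linear change making the derivative at the base point isometric, strict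
differentiability controls the distances of all pairs of nearby points. Allowing every smaller `ρ`
lets the ball shrink later with the chart fixed. -/
lemma IsChart.exists_flat (hg : IsChart M U g) {u₀ : EuclideanSpace ℝ (Fin d)} (hu₀ : u₀ ∈ U)
    {ε : ℝ} (hε : 0 < ε) :
    ∃ (L : EuclideanSpace ℝ (Fin d) ≃L[ℝ] EuclideanSpace ℝ (Fin d)) (ρ₀ : ℝ), 0 < ρ₀ ∧
      ∀ ρ ≤ ρ₀, IsFlatChart M (g u₀) ε ρ ((fun u => u₀ + L u) ⁻¹' U) (fun u => g (u₀ + L u)) := by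
  obtain ⟨L, hL⟩ := exists_equiv_norm_comp_eq (hg.fullRank u₀ hu₀)
  have hc := hg.comp_affine u₀ L
  set g₁ := fun u => g (u₀ + L u) with hg₁
  set U₁ := (fun u => u₀ + L u) ⁻¹' U with hU₁
  have h0 : (0 : EuclideanSpace ℝ (Fin d)) ∈ U₁ := by simpa [hU₁] using hu₀
  have hfd : ∀ w, ‖fderiv ℝ g₁ 0 w‖ = ‖w‖ := by
    intro w
    have h1 : HasFDerivAt (fun u => u₀ + L u)
        (L : EuclideanSpace ℝ (Fin d) →L[ℝ] EuclideanSpace ℝ (Fin d)) 0 :=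
      L.hasFDerivAt.const_add u₀
    have h2 := (hg.hasStrictFDerivAt (u := u₀ + L 0) (by simpa using hu₀)).hasFDerivAt.comp
      (0 : EuclideanSpace ℝ (Fin d)) h1
    have h3 : fderiv ℝ g₁ 0 = _ := h2.fderiv
    rw [h3]
    simpa using hL w
  have e1 : ∀ᶠ u in 𝓝 (0 : EuclideanSpace ℝ (Fin d)), u ∈ U₁ ∧ 1 - ε ≤ volumeDensity g₁ u ∧
      volumeDensity g₁ u ≤ 1 + ε := by
    have hv := (hc.continuousAt_volumeDensity h0).tendsto
    rw [volumeDensity_eq_one hfd] at hv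
    filter_upwards [hc.isOpen.mem_nhds h0, hv.eventually_const_le (show 1 - ε < 1 by linarith),
      hv.eventually_le_const (show 1 < 1 + ε by linarith)] with u a b c using ⟨a, b, c⟩
  have e2 := (hc.hasStrictFDerivAt h0).isLittleO.def hε
  rw [nhds_prod_eq, eventually_prod_self_iff'] at e2
  obtain ⟨N, hN, hNe⟩ := e2
  obtain ⟨ρ₀, hρ₀, hball⟩ := Metric.eventually_nhds_iff_ball.1 (e1.and hN)
  refine ⟨L, ρ₀, hρ₀, fun ρ hρ => ?_⟩
  have hsub : Metric.ball (0 : EuclideanSpace ℝ (Fin d)) ρ ⊆ Metric.ball 0 ρ₀ :=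
    Metric.ball_subset_ball hρ
  have key : ∀ u ∈ Metric.ball (0 : EuclideanSpace ℝ (Fin d)) ρ, ∀ w ∈ Metric.ball 0 ρ,
      |dist (g₁ u) (g₁ w) - dist u w| ≤ ε * dist u w := by
    intro u hu w hw
    have h := hNe u (hball u (hsub hu)).2 w (hball w (hsub hw)).2
    rw [dist_eq_norm, dist_eq_norm, ← hfd (u - w)]
    refine (abs_norm_sub_norm_le _ _).trans ?_
    rw [hfd]
    exact h
  exact
    { isChart := hc
      ball_subset := fun u hu => (hball u (hsub hu)).1.1
      map_zero := by simp
      le_dist := fun u hu w hw => by linarith [(abs_le.1 (key u hu w hw)).1]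
      dist_le := fun u hu w hw => by linarith [(abs_le.1 (key u hu w hw)).2]
      le_density := fun u hu => (hball u (hsub hu)).1.2.1
      density_le := fun u hu => (hball u (hsub hu)).1.2.2 }

namespace IsFlatChart

variable {y : EuclideanSpace ℝ (Fin m)} {ε ρ : ℝ}

lemma mem (hg : IsFlatChart M y ε ρ U g) {u : EuclideanSpace ℝ (Fin d)}
    (hu : u ∈ Metric.ball 0 ρ) : g u ∈ M :=
  hg.isChart.image_subset ⟨u, hg.ball_subset hu, rfl⟩

lemma continuousOn (hg : IsFlatChart M y ε ρ U g) : ContinuousOn g (Metric.ball 0 ρ) :=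
  hg.isChart.continuousOn.mono hg.ball_subset

lemma measurableSet_image (hg : IsFlatChart M y ε ρ U g) {S : Set (EuclideanSpace ℝ (Fin d))}
    (hS : MeasurableSet S) (hSρ : S ⊆ Metric.ball 0 ρ) : MeasurableSet (g '' S) :=
  hS.image_of_continuousOn_injOn (hg.continuousOn.mono hSρ)
    (hg.isChart.injOn.mono (hSρ.trans hg.ball_subset))

lemma riemannianVolume_image (hg : IsFlatChart M y ε ρ U g) {S : Set (EuclideanSpace ℝ (Fin d))}
    (hS : MeasurableSet S) (hSρ : S ⊆ Metric.ball 0 ρ) :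
    riemannianVolume d M (g '' S) = ∫⁻ u in S, ENNReal.ofReal (volumeDensity g u) := by
  obtain ⟨W, hW, hWM⟩ := hg.isChart.isOpen_image U le_rfl hg.isChart.isOpen
  have hSU := hSρ.trans hg.ball_subset
  rw [riemannianVolume_apply hg.isChart hW hWM (hg.measurableSet_image hS hSρ)
    ((Set.image_mono hSU).trans (hWM.le.trans Set.inter_subset_left))]
  congr 2
  ext u
  constructor
  · rintro ⟨⟨w, hw, hwu⟩, hu⟩
    exact hg.isChart.injOn (hSU hw) hu hwu ▸ hw
  · exact fun hu => ⟨⟨u, hu, rfl⟩, hSU hu⟩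

lemma le_riemannianVolume_image (hg : IsFlatChart M y ε ρ U g)
    {S : Set (EuclideanSpace ℝ (Fin d))} (hS : MeasurableSet S) (hSρ : S ⊆ Metric.ball 0 ρ) :
    ENNReal.ofReal (1 - ε) * volume S ≤ riemannianVolume d M (g '' S) := by
  rw [hg.riemannianVolume_image hS hSρ, ← setLIntegral_const]
  exact setLIntegral_mono' hS fun u hu => ENNReal.ofReal_le_ofReal (hg.le_density u (hSρ hu))

lemma riemannianVolume_image_le (hg : IsFlatChart M y ε ρ U g)
    {S : Set (EuclideanSpace ℝ (Fin d))} (hS : MeasurableSet S) (hSρ : S ⊆ Metric.ball 0 ρ) :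
    riemannianVolume d M (g '' S) ≤ ENNReal.ofReal (1 + ε) * volume S := by
  rw [hg.riemannianVolume_image hS hSρ, ← setLIntegral_const]
  exact setLIntegral_mono' hS fun u hu => ENNReal.ofReal_le_ofReal (hg.density_le u (hSρ hu))

/-- Points of `M` near `g 0` are values of `g`. -/
lemma exists_ball_subset (hg : IsFlatChart M y ε ρ U g) (hρ : 0 < ρ) :
    ∃ η > 0, Metric.ball y η ∩ M ⊆ g '' Metric.ball 0 ρ := by
  obtain ⟨W, hW, hWM⟩ := hg.isChart.isOpen_image _ hg.ball_subset Metric.isOpen_ball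
  have hy : y ∈ W := by
    have : y ∈ g '' Metric.ball 0 ρ := ⟨0, Metric.mem_ball_self hρ, hg.map_zero⟩
    rw [hWM] at this
    exact this.1
  obtain ⟨η, hη, hηW⟩ := Metric.isOpen_iff.1 hW y hy
  exact ⟨η, hη, fun z hz => hWM ▸ ⟨hηW hz.1, hz.2⟩⟩

/-- The geodesic distance of nearby points is almost their Euclidean distance. -/
lemma geodesicEDist_le (hg : IsFlatChart M y ε ρ U g) (hε : 0 < ε) {u w : EuclideanSpace ℝ (Fin d)}
    (hu : u ∈ Metric.ball 0 ρ) (hw : w ∈ Metric.ball 0 ρ) :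
    geodesicEDist M (g u) (g w) ≤ ENNReal.ofReal ((1 + ε) * dist u w) := by
  -- The competitor is the image of the parameter segment; its speed is bounded by the Lipschitz
  -- constant of `g` times the segment length.
  set c : ℝ → EuclideanSpace ℝ (Fin d) := fun t => AffineMap.lineMap u w t with hc
  have hcs : ∀ t ∈ Set.Icc (0 : ℝ) 1, c t ∈ Metric.ball 0 ρ := fun t ht =>
    (convex_ball (0 : EuclideanSpace ℝ (Fin d)) ρ).lineMap_mem hu hw ht
  have hcd : ContDiff ℝ 1 c := by
    have : c = fun t => t • (w - u) + u := by
      ext1 t; simp [hc, AffineMap.lineMap_apply]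
    rw [this]; fun_prop
  have hγ : ContDiffOn ℝ 1 (fun t => g (c t)) (Set.Icc 0 1) :=
    (hg.isChart.contDiffOn.of_le (by norm_num)).comp hcd.contDiffOn
      fun t ht => hg.ball_subset (hcs t ht)
  refine (iInf₂_le (fun t => g (c t)) ⟨hγ, fun t ht => hg.mem (hcs t ht), by simp [hc],
    by simp [hc]⟩).trans ?_
  have hlip : LipschitzOnWith (Real.toNNReal ((1 + ε) * dist u w)) (fun t => g (c t))
      (Set.Icc 0 1) := by
    refine LipschitzOnWith.of_dist_le_mul fun s hs t ht => ?_
    refine (hg.dist_le _ (hcs s hs) _ (hcs t ht)).trans (le_of_eq ?_)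
    rw [Real.coe_toNNReal _ (by positivity)]
    simp only [hc, dist_lineMap_lineMap]
    ring
  calc ∫⁻ t in Set.Icc (0 : ℝ) 1, ‖derivWithin (fun t => g (c t)) (Set.Icc 0 1) t‖ₑ
      = ∫⁻ t in Set.Ioo (0 : ℝ) 1, ‖derivWithin (fun t => g (c t)) (Set.Icc 0 1) t‖ₑ :=
        setLIntegral_congr Ioo_ae_eq_Icc.symm
    _ ≤ ∫⁻ t in Set.Ioo (0 : ℝ) 1, ENNReal.ofReal ((1 + ε) * dist u w) := by
        refine setLIntegral_mono' measurableSet_Ioo fun t ht => ?_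
        have ht' : Set.Icc (0 : ℝ) 1 ∈ 𝓝 t := Icc_mem_nhds ht.1 ht.2
        rw [← ofReal_norm]
        refine ENNReal.ofReal_le_ofReal ?_
        have h := norm_deriv_le_of_lipschitzOn ht' hlip
        rw [Real.coe_toNNReal _ (by positivity)] at h
        rwa [derivWithin_of_mem_nhds ht']
    _ = _ := by simp

end IsFlatChart

lemma edist_le_geodesicEDist (M : Set (EuclideanSpace ℝ (Fin m))) (x y : EuclideanSpace ℝ (Fin m)) :
    edist x y ≤ geodesicEDist M x y := by
  refine le_iInf₂ fun γ hγ => ?_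
  obtain ⟨h1, -, rfl, rfl⟩ := hγ
  have := enorm_sub_le_lintegral_derivWithin_Icc_of_contDiffOn_Icc h1 zero_le_one
  rwa [edist_comm, edist_eq_enorm_sub]

end Flat

/-! ### Volumes and separated sets in Euclidean space -/

section Euclidean

variable {d : ℕ}

lemma unitBallVolume_pos (d : ℕ) : 0 < unitBallVolume d := by
  unfold unitBallVolume
  have : 0 < Real.Gamma (1 + (d : ℝ) / 2) := Real.Gamma_pos_of_pos (by positivity)
  positivity

lemma volumeReal_closedBall (hd : d ≠ 0) (u : EuclideanSpace ℝ (Fin d)) {r : ℝ} (hr : 0 ≤ r) :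
    volume.real (Metric.closedBall u r) = unitBallVolume d * r ^ d := by
  have : Nonempty (Fin d) := Fin.pos_iff_nonempty.1 (Nat.pos_of_ne_zero hd)
  have e : √Real.pi ^ d = Real.pi ^ ((d : ℝ) / 2) := by
    rw [Real.sqrt_eq_rpow, ← Real.rpow_natCast, ← Real.rpow_mul Real.pi_nonneg]
    congr 1; ring
  rw [Measure.real, EuclideanSpace.volume_closedBall, Fintype.card_fin, ENNReal.toReal_mul,
    ENNReal.toReal_pow, ENNReal.toReal_ofReal hr, e, add_comm ((d : ℝ) / 2) 1,
    ← unitBallVolume, ENNReal.toReal_ofReal (unitBallVolume_pos d).le, mul_comm]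

/-- After centring, w ↦ -w exchanges the two half balls, and they overlap in a piece of a
hyperplane, which is null. -/
lemma two_mul_volumeReal_halfBall (hd : d ≠ 0) {a : EuclideanSpace ℝ (Fin d) →L[ℝ] ℝ} (ha : a ≠ 0)
    (u : EuclideanSpace ℝ (Fin d)) {r : ℝ} (hr : 0 ≤ r) :
    2 * volume.real (Metric.closedBall u r ∩ {w | a u ≤ a w}) = unitBallVolume d * r ^ d := by
  set S : Set (EuclideanSpace ℝ (Fin d)) := Metric.closedBall 0 r ∩ {w | 0 ≤ a w} with hS
  have hSc : MeasurableSet S :=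
    (Metric.isClosed_closedBall.inter (isClosed_le continuous_const a.continuous)).measurableSet
  have htrans : volume.real (Metric.closedBall u r ∩ {w | a u ≤ a w}) = volume.real S := by
    rw [Measure.real, Measure.real, ← measure_preimage_add_right volume (-u) S]
    congr 2
    ext w
    simp [hS, dist_eq_norm, ← sub_eq_add_neg]
  have hneg : volume.real (-S) = volume.real S := by
    rw [Measure.real, Measure.real, Measure.measure_neg]
  have hker : volume.real (S ∩ -S) = 0 := by
    rw [measureReal_eq_zero_iff ((measure_mono Set.inter_subset_left).trans_lt
      ((measure_mono Set.inter_subset_left).trans_lt measure_closedBall_lt_top)).ne]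
    refine measure_mono_null ?_ (Measure.addHaar_submodule volume
      (LinearMap.ker (a : EuclideanSpace ℝ (Fin d) →ₗ[ℝ] ℝ)) ?_)
    · rintro w ⟨h1, h2⟩
      have h3 : 0 ≤ a w := h1.2
      have h4 : 0 ≤ a (-w) := h2.2
      rw [map_neg] at h4
      exact le_antisymm (show a w ≤ 0 by linarith) h3
    · intro h
      exact ha (by ext1 w; exact LinearMap.congr_fun (LinearMap.ker_eq_top.1 h) w)
  have hunion : S ∪ -S = Metric.closedBall 0 r := by
    ext w
    simp only [hS, Set.mem_union, Set.mem_inter_iff, Set.mem_neg, Metric.mem_closedBall,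
      dist_zero_right, norm_neg, Set.mem_ofPred_eq, map_neg]
    constructor
    · rintro (h | h) <;> exact h.1
    · intro h
      rcases le_total 0 (a w) with h' | h'
      · exact Or.inl ⟨h, h'⟩
      · exact Or.inr ⟨h, by linarith⟩
  have hfin : volume S ≠ ∞ :=
    ((measure_mono Set.inter_subset_left).trans_lt measure_closedBall_lt_top).ne
  have hfin' : volume (-S) ≠ ∞ := by rwa [Measure.measure_neg]
  have key := measureReal_union_add_inter (μ := volume) (s := S) hSc.neg hfin hfin'
  rw [hunion, hker, hneg, volumeReal_closedBall hd 0 hr] at key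
  rw [htrans]
  linarith

/-- About 1/(3t) translates of the slab, by multiples of 3t along a vector `e` with a(e) = 1, are
disjoint and stay in a fixed ball of volume V, so each has volume at most 6tV. For t ≥ 1/6 the bound
is trivial. -/
lemma exists_volumeReal_slab_le {a : EuclideanSpace ℝ (Fin d) →L[ℝ] ℝ} (ha : a ≠ 0) (ρ : ℝ) :
    ∃ C, 0 ≤ C ∧ ∀ t > 0, volume.real (Metric.ball 0 ρ ∩ {w | |a w| ≤ t}) ≤ C * t := by
  obtain ⟨e, he⟩ : ∃ e, a e = 1 := by
    obtain ⟨x, hx⟩ := DFunLike.ne_iff.1 ha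
    exact ⟨(a x)⁻¹ • x, by simpa using inv_mul_cancel₀ hx⟩
  set V := volume.real (Metric.ball (0 : EuclideanSpace ℝ (Fin d)) (ρ + ‖e‖)) with hV
  refine ⟨6 * V, by positivity, fun t ht => ?_⟩
  set S := Metric.ball (0 : EuclideanSpace ℝ (Fin d)) ρ ∩ {w | |a w| ≤ t} with hS
  have hSm : MeasurableSet S := Metric.isOpen_ball.measurableSet.inter
    (isClosed_le a.continuous.abs continuous_const).measurableSet
  rcases le_or_gt (1 / 6) t with h6 | h6
  · have : volume.real S ≤ V := by
      refine measureReal_mono (Set.inter_subset_left.trans (Metric.ball_subset_ball ?_))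
        measure_ball_lt_top.ne
      linarith [norm_nonneg e]
    nlinarith [measureReal_nonneg (μ := volume) (s := S)]
  · set N := ⌊1 / (3 * t)⌋₊ with hN
    have hN1 : (N : ℝ) * (3 * t) ≤ 1 := by
      have := Nat.floor_le (show 0 ≤ 1 / (3 * t) by positivity)
      rwa [le_div_iff₀ (by positivity)] at this
    have hN2 : 1 ≤ 6 * t * N := by
      have := Nat.lt_floor_add_one (1 / (3 * t))
      rw [div_lt_iff₀ (by positivity)] at this
      nlinarith
    set S' : ℕ → Set (EuclideanSpace ℝ (Fin d)) := fun j => (· + -((3 * t * j) • e)) ⁻¹' S with hS'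
    have hvol : ∀ j, volume.real (S' j) = volume.real S := fun j => by
      rw [Measure.real, Measure.real]
      exact congrArg _ (measure_preimage_add_right volume _ S)
    have hdisj : ((Finset.range N : Finset ℕ) : Set ℕ).PairwiseDisjoint S' := by
      intro i _ j _ hij
      refine Set.disjoint_left.2 fun w hi hj => ?_
      have h1 : |a w - 3 * t * i| ≤ t := by simpa [he, ← sub_eq_add_neg] using hi.2
      have h2 : |a w - 3 * t * j| ≤ t := by simpa [he, ← sub_eq_add_neg] using hj.2
      rw [abs_le] at h1 h2
      rcases lt_or_gt_of_ne hij with h | h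
      · have : (i : ℝ) + 1 ≤ j := by exact_mod_cast h
        nlinarith
      · have : (j : ℝ) + 1 ≤ i := by exact_mod_cast h
        nlinarith
    have hsub : (⋃ j ∈ Finset.range N, S' j) ⊆ Metric.ball 0 (ρ + ‖e‖) := by
      refine Set.iUnion₂_subset fun j hj w hw => ?_
      have h1 : ‖w - (3 * t * j) • e‖ < ρ := by simpa [← sub_eq_add_neg] using hw.1
      rw [mem_ball_zero_iff]
      have h2 : ‖(3 * t * j) • e‖ ≤ ‖e‖ := by
        rw [norm_smul, Real.norm_of_nonneg (by positivity)]
        have : (j : ℝ) ≤ N := by exact_mod_cast (Finset.mem_range.1 hj).le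
        have h3 : 3 * t * j ≤ 1 := by nlinarith
        nlinarith [norm_nonneg e]
      calc ‖w‖ = ‖(w - (3 * t * j) • e) + (3 * t * j) • e‖ := by simp
        _ ≤ _ := norm_add_le _ _
        _ < _ := by linarith
    have hsum : (N : ℝ) * volume.real S ≤ V := by
      have h1 := measureReal_mono (μ := volume) hsub measure_ball_lt_top.ne
      rw [measureReal_biUnion_finset hdisj (fun j _ => hSm.preimage (by fun_prop)) (fun j _ =>
        ((measure_mono ((Set.subset_biUnion_of_mem (u := S') (by assumption)).trans hsub)).trans_lt
          measure_ball_lt_top).ne)] at h1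
      simpa [hvol] using h1
    nlinarith [measureReal_nonneg (μ := volume) (s := S)]

/-- A cubic grid of step `s` with (q + 1)^D points, each coordinate at most ρ/(2D), so that the sum
of coordinates bounds the norm by ρ/2. Since q + 1 ≥ 1, large `s` is no exception. -/
lemma exists_separated_grid {D : ℕ} (hD : D ≠ 0) {ρ : ℝ} (hρ : 0 < ρ) :
    ∃ C : ℝ, 0 < C ∧ ∀ s : ℝ, 0 < s → ∃ T : Finset (EuclideanSpace ℝ (Fin D)),
      ↑T ⊆ Metric.ball (0 : EuclideanSpace ℝ (Fin D)) ρ ∧ C ≤ T.card * s ^ D ∧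
      (T : Set (EuclideanSpace ℝ (Fin D))).Pairwise fun x y => s ≤ dist x y := by
  have hD' : (0 : ℝ) < D := by positivity
  refine ⟨(ρ / (2 * D)) ^ D, by positivity, fun s hs => ?_⟩
  set q := ⌊ρ / (2 * D) / s⌋₊ with hq
  have hq1 : (q : ℝ) * s ≤ ρ / (2 * D) := by
    have := Nat.floor_le (show 0 ≤ ρ / (2 * D) / s by positivity)
    rwa [le_div_iff₀ hs] at this
  have hq2 : ρ / (2 * D) ≤ (q + 1 : ℝ) * s := by
    have := Nat.lt_floor_add_one (ρ / (2 * D) / s)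
    rw [div_lt_iff₀ hs] at this
    exact this.le
  set p : (Fin D → Fin (q + 1)) → EuclideanSpace ℝ (Fin D) :=
    fun z => WithLp.toLp 2 fun i => s * (z i : ℕ) with hp
  have hsep : ∀ z z', z ≠ z' → s ≤ dist (p z) (p z') := by
    intro z z' h
    obtain ⟨i, hi⟩ := Function.ne_iff.1 h
    rw [dist_eq_norm]
    refine le_trans ?_ (PiLp.norm_apply_le _ i)
    simp only [hp, PiLp.sub_apply, ← mul_sub]
    rw [norm_mul, Real.norm_of_nonneg hs.le]
    have h1 : (1 : ℝ) ≤ ‖(((z i : ℕ) : ℝ) - ((z' i : ℕ) : ℝ))‖ := by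
      have h2 : ((z i : ℕ) : ℤ) - ((z' i : ℕ) : ℤ) ≠ 0 := by
        intro h0
        exact hi (Fin.ext (by omega))
      have h3 := Int.one_le_abs h2
      rw [Real.norm_eq_abs]
      exact_mod_cast h3
    nlinarith
  have hinj : Function.Injective p := by
    intro z z' h
    by_contra hne
    have := hsep z z' hne
    rw [h, dist_self] at this
    linarith
  refine ⟨Finset.univ.image p, ?_, ?_, ?_⟩
  · intro x hx
    simp only [Finset.coe_image, Finset.coe_univ, Set.image_univ, Set.mem_range] at hx
    obtain ⟨z, rfl⟩ := hx
    rw [mem_ball_zero_iff]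
    have h1 : ‖p z‖ ≤ ∑ i : Fin D, ‖p z i‖ := by
      have h2 : p z = ∑ i, (p z i) • EuclideanSpace.single i (1 : ℝ) := by
        have := (EuclideanSpace.basisFun (Fin D) ℝ).sum_repr (p z)
        simpa using this.symm
      calc ‖p z‖ = ‖∑ i, (p z i) • EuclideanSpace.single i (1 : ℝ)‖ := by rw [← h2]
        _ ≤ ∑ i, ‖(p z i) • EuclideanSpace.single i (1 : ℝ)‖ := norm_sum_le _ _
        _ = _ := by simp [norm_smul]
    have h2 : ∀ i, ‖p z i‖ ≤ ρ / (2 * D) := by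
      intro i
      have h3 : (((z i : ℕ)) : ℝ) ≤ q := by
        have := (z i).2
        exact_mod_cast Nat.lt_succ_iff.1 this
      have h4 : ‖p z i‖ = s * (z i : ℕ) := by
        simp only [hp]
        exact Real.norm_of_nonneg (by positivity)
      rw [h4]
      nlinarith
    calc ‖p z‖ ≤ ∑ i : Fin D, ‖p z i‖ := h1
      _ ≤ ∑ i : Fin D, ρ / (2 * D) := Finset.sum_le_sum fun i _ => h2 i
      _ = ρ / 2 := by simp; field_simp
      _ < ρ := by linarith
  · rw [Finset.card_image_of_injective _ hinj, Finset.card_univ, Fintype.card_fun,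
      Fintype.card_fin, Fintype.card_fin]
    push_cast
    rw [← mul_pow]
    gcongr
  · intro x hx y hy hxy
    simp only [Finset.coe_image, Finset.coe_univ, Set.image_univ, Set.mem_range] at hx hy
    obtain ⟨z, rfl⟩ := hx
    obtain ⟨z', rfl⟩ := hy
    exact hsep z z' fun h => hxy (h ▸ rfl)

lemma exists_isometry_range_eq_ker {a : EuclideanSpace ℝ (Fin d) →L[ℝ] ℝ} (ha : a ≠ 0) :
    ∃ ψ : EuclideanSpace ℝ (Fin (d - 1)) →ₗᵢ[ℝ] EuclideanSpace ℝ (Fin d), ∀ v, a (ψ v) = 0 := by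
  set K := LinearMap.ker (a : EuclideanSpace ℝ (Fin d) →ₗ[ℝ] ℝ) with hK
  have hfin : Module.finrank ℝ K = d - 1 := by
    have h1 := LinearMap.finrank_range_add_finrank_ker (a : EuclideanSpace ℝ (Fin d) →ₗ[ℝ] ℝ)
    have h2 : LinearMap.range (a : EuclideanSpace ℝ (Fin d) →ₗ[ℝ] ℝ) = ⊤ := by
      refine LinearMap.range_eq_top.2 (LinearMap.surjective ?_)
      intro h
      exact ha (by ext1 w; exact LinearMap.congr_fun h w)
    rw [h2, finrank_top, Module.finrank_self, finrank_euclideanSpace_fin] at h1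
    change 1 + Module.finrank ℝ K = d at h1
    omega
  set e := ((stdOrthonormalBasis ℝ K).reindex (finCongr hfin)).repr.symm
  refine ⟨K.subtypeₗᵢ.comp e.toLinearIsometry, fun v => ?_⟩
  have : ((e v : K) : EuclideanSpace ℝ (Fin d)) ∈ K := (e v).2
  exact this

end Euclidean

/-- A separated set of maximal cardinality is a net. -/
lemma exists_separated_net {E : Type*} [PseudoMetricSpace E] {B : Set E} {s : ℝ} (hs : 0 ≤ s) {N : ℕ}
    (hN : ∀ T : Finset E, ↑T ⊆ B → (T : Set E).Pairwise (fun x y => s < dist x y) → T.card ≤ N) :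
    ∃ T : Finset E, ↑T ⊆ B ∧ (T : Set E).Pairwise (fun x y => s < dist x y) ∧
      ∀ y ∈ B, ∃ x ∈ T, dist x y ≤ s := by
  classical
  set Q : ℕ → Prop := fun n => ∃ T : Finset E, ↑T ⊆ B ∧
    (T : Set E).Pairwise (fun x y => s < dist x y) ∧ T.card = n with hQ
  have h0 : Q 0 := ⟨∅, by simp, by simp, rfl⟩
  obtain ⟨T, hTB, hT, hcard⟩ := Nat.findGreatest_spec (P := Q) (Nat.zero_le N) h0
  rcases em (∀ y ∈ B, ∃ x ∈ T, dist x y ≤ s) with h | h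
  · exact ⟨T, hTB, hT, h⟩
  · exfalso
    push Not at h
    obtain ⟨y, hyB, hy⟩ := h
    have hyT : y ∉ T := fun hyT => by linarith [hy y hyT, dist_self y]
    have hins : Q (Nat.findGreatest Q N + 1) := by
      refine ⟨insert y T, ?_, ?_, ?_⟩
      · rw [Finset.coe_insert]
        exact Set.insert_subset hyB hTB
      · rw [Finset.coe_insert]
        exact hT.insert fun b hb _ => ⟨by rw [dist_comm]; exact hy b hb, hy b hb⟩
      · rw [Finset.card_insert_of_notMem hyT, hcard]
    obtain ⟨T', h1, h2, h3⟩ := hins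
    have h4 := hN T' h1 h2
    rw [h3] at h4
    have := Nat.le_findGreatest (P := Q) h4 ⟨T', h1, h2, h3⟩
    omega

/-! ### The local structure of a submanifold with boundary -/

section Local

variable {d m : ℕ} {M A : Set (EuclideanSpace ℝ (Fin m))}

lemma mem_relBoundary_iff (hAM : A ⊆ M) (hA : IsClosed A) {x : EuclideanSpace ℝ (Fin m)} :
    x ∈ relBoundary M A ↔ x ∈ A ∧ x ∈ closure (M \ A) := by
  rw [relBoundary, relInterior, hA.closure_eq, Set.mem_sdiff, Set.mem_sdiff]
  constructor
  · rintro ⟨h1, h2⟩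
    exact ⟨h1, by_contra fun h => h2 ⟨hAM h1, h⟩⟩
  · rintro ⟨h1, h2⟩
    exact ⟨h1, fun h => h.2 h2⟩

lemma isClosed_relBoundary (hAM : A ⊆ M) (hA : IsClosed A) : IsClosed (relBoundary M A) := by
  have : relBoundary M A = A ∩ closure (M \ A) := by
    ext x; rw [mem_relBoundary_iff hAM hA]; rfl
  rw [this]
  exact hA.inter isClosed_closure

lemma mem_halfSpace_iff (hd : d ≠ 0) {x : EuclideanSpace ℝ (Fin d)} :
    x ∈ halfSpace d ↔ 0 ≤ x ⟨d - 1, by omega⟩ := by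
  constructor
  · exact fun h => h ⟨d - 1, by omega⟩ (by simp; omega)
  · intro h i hi
    have : i = ⟨d - 1, by omega⟩ := Fin.ext (by simp; omega)
    rw [this]; exact h

/-- In suitable almost isometric coordinates near a point of `A`, the set `A` is either everything
or a half-space. -/
lemma exists_flat_local (hd : d ≠ 0) (hM : IsC2Submanifold d M)
    (hA : IsSubmanifoldWithBoundary d M A) (hAc : IsClosed A) {y : EuclideanSpace ℝ (Fin m)}
    (hy : y ∈ A) {ε : ℝ} (hε : 0 < ε) :
    ∃ (U : Set (EuclideanSpace ℝ (Fin d)))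
      (g : EuclideanSpace ℝ (Fin d) → EuclideanSpace ℝ (Fin m)) (ρ₀ : ℝ), 0 < ρ₀ ∧
      (∀ ρ ≤ ρ₀, IsFlatChart M y ε ρ U g) ∧
      ((y ∉ relBoundary M A ∧ ∀ u ∈ Metric.ball 0 ρ₀, g u ∈ A ∧ g u ∉ relBoundary M A) ∨
        (y ∈ relBoundary M A ∧ ∃ a : EuclideanSpace ℝ (Fin d) →L[ℝ] ℝ, a ≠ 0 ∧
          ∀ u ∈ Metric.ball 0 ρ₀, (g u ∈ A ↔ 0 ≤ a u) ∧ (g u ∈ relBoundary M A ↔ a u = 0))) := by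
  by_cases hyb : y ∈ relBoundary M A
  · obtain ⟨U, g, hg, h0, rfl, hgA⟩ := hA.2 y hyb
    obtain ⟨L, ρ₀, hρ₀, hflat⟩ := hg.exists_flat h0 hε
    refine ⟨_, _, ρ₀, hρ₀, hflat, Or.inr ⟨hyb, ?_⟩⟩
    set g₁ := fun u => g (0 + L u) with hg₁
    have hf := hflat ρ₀ le_rfl
    set i₀ : Fin d := ⟨d - 1, by omega⟩ with hi₀
    -- The flattening change of coordinates is linear, so it turns the half-space into {a ≥ 0}, with
    -- `a` the last coordinate after `L`.
    set a : EuclideanSpace ℝ (Fin d) →L[ℝ] ℝ :=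
      (EuclideanSpace.proj i₀ : EuclideanSpace ℝ (Fin d) →L[ℝ] ℝ).comp
        (L : EuclideanSpace ℝ (Fin d) →L[ℝ] EuclideanSpace ℝ (Fin d)) with ha
    have hau : ∀ u, a u = (L u) i₀ := fun u => rfl
    set e := L.symm (EuclideanSpace.single i₀ 1) with he
    have hae : a e = 1 := by simp [hau, he]
    have hAiff : ∀ u ∈ Metric.ball 0 ρ₀, (g₁ u ∈ A ↔ 0 ≤ a u) := by
      intro u hu
      have huU : 0 + L u ∈ U := hf.ball_subset hu
      rw [hau, ← mem_halfSpace_iff hd]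
      constructor
      · intro h
        have h1 : g₁ u ∈ g '' (U ∩ halfSpace d) := by
          rw [hgA]; exact ⟨⟨_, huU, rfl⟩, h⟩
        obtain ⟨w, hw, hwu⟩ := h1
        have := hg.injOn hw.1 huU hwu
        rw [zero_add] at this
        exact this ▸ hw.2
      · intro h
        have h1 : g₁ u ∈ g '' (U ∩ halfSpace d) :=
          ⟨0 + L u, ⟨huU, by rw [zero_add]; exact h⟩, rfl⟩
        rw [hgA] at h1
        exact h1.2
    refine ⟨a, fun h => by simp [h] at hae, fun u hu => ⟨hAiff u hu, ?_⟩⟩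
    rw [mem_relBoundary_iff hA.1 hAc, hAiff u hu]
    constructor
    · rintro ⟨h1, h2⟩
      by_contra hne
      have hpos : 0 < a u := lt_of_le_of_ne h1 (Ne.symm hne)
      -- The part of the chart with a > 0 has relatively open image contained in `A`, so the point
      -- is not a limit of points of `M \ A`.
      obtain ⟨O, hO, hOM⟩ := hf.isChart.isOpen_image (Metric.ball 0 ρ₀ ∩ {w | 0 < a w})
        (Set.inter_subset_left.trans hf.ball_subset)
        (Metric.isOpen_ball.inter (isOpen_lt continuous_const a.continuous))
      have huO : g₁ u ∈ O := by
        have : g₁ u ∈ g₁ '' (Metric.ball 0 ρ₀ ∩ {w | 0 < a w}) := ⟨u, ⟨hu, hpos⟩, rfl⟩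
        rw [hOM] at this
        exact this.1
      obtain ⟨z, hzO, hzM, hzA⟩ := mem_closure_iff.1 h2 O hO huO
      have hz : z ∈ g₁ '' (Metric.ball 0 ρ₀ ∩ {w | 0 < a w}) := by
        rw [hOM]; exact ⟨hzO, hzM⟩
      obtain ⟨w, hw, rfl⟩ := hz
      have hw2 : 0 < a w := hw.2
      exact hzA ((hAiff w hw.1).2 hw2.le)
    · intro h
      refine ⟨h.ge, ?_⟩
      -- From a zero of `a`, moving against `e` makes `a` negative, which exhibits the point as a
      -- limit of points of `M \ A`.
      have hlim : Tendsto (fun t : ℝ => u - t • e) (𝓝[>] 0) (𝓝 u) := by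
        have h1 : Continuous fun t : ℝ => u - t • e := by fun_prop
        have h2 := h1.tendsto 0
        simp only [zero_smul, sub_zero] at h2
        exact h2.mono_left nhdsWithin_le_nhds
      have hcont : ContinuousAt g₁ u := hf.isChart.continuousOn.continuousAt
        (hf.isChart.isOpen.mem_nhds (hf.ball_subset hu))
      refine mem_closure_of_tendsto (hcont.tendsto.comp hlim) ?_
      filter_upwards [hlim.eventually (Metric.isOpen_ball.mem_nhds hu), self_mem_nhdsWithin] with
        t ht ht0
      refine ⟨hf.mem ht, fun hmem => ?_⟩
      have := (hAiff _ ht).1 hmem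
      rw [map_sub, map_smul, h, hae] at this
      have ht0' : 0 < t := ht0
      simp at this
      linarith
  · obtain ⟨U, g, hg, u₀, hu₀, rfl⟩ := hM.2 y (hA.1 hy)
    obtain ⟨L, ρ₁, hρ₁, hflat⟩ := hg.exists_flat hu₀ hε
    have hO : g u₀ ∈ (closure (M \ A))ᶜ := fun h => hyb ((mem_relBoundary_iff hA.1 hAc).2 ⟨hy, h⟩)
    have hf := hflat ρ₁ le_rfl
    set g₁ := fun u => g (u₀ + L u) with hg₁
    have hcont : ContinuousAt g₁ 0 := hf.isChart.continuousOn.continuousAt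
      (hf.isChart.isOpen.mem_nhds (hf.ball_subset (Metric.mem_ball_self hρ₁)))
    have hev : ∀ᶠ u in 𝓝 0, g₁ u ∈ (closure (M \ A))ᶜ :=
      hcont.preimage_mem_nhds (isClosed_closure.isOpen_compl.mem_nhds (by rwa [hf.map_zero]))
    obtain ⟨ρ₂, hρ₂, hball⟩ := Metric.eventually_nhds_iff_ball.1 hev
    refine ⟨_, _, min ρ₁ ρ₂, lt_min hρ₁ hρ₂, fun ρ hρ => hflat ρ (hρ.trans (min_le_left _ _)),
      Or.inl ⟨hyb, fun u hu => ?_⟩⟩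
    have h1 : g₁ u ∈ M := hf.mem (Metric.ball_subset_ball (min_le_left _ _) hu)
    have h2 := hball u (Metric.ball_subset_ball (min_le_right _ _) hu)
    refine ⟨by_contra fun h => h2 (subset_closure ⟨h1, h⟩), fun h => ?_⟩
    exact h2 ((mem_relBoundary_iff hA.1 hAc).1 h).2

end Local

/-! ### The measure of small balls -/

section Density

variable {d m : ℕ} {M A B : Set (EuclideanSpace ℝ (Fin m))} {f : EuclideanSpace ℝ (Fin m) → ℝ}
  {U : Set (EuclideanSpace ℝ (Fin d))}
  {g : EuclideanSpace ℝ (Fin d) → EuclideanSpace ℝ (Fin m)} {y : EuclideanSpace ℝ (Fin m)}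
  {ε ρ : ℝ}

lemma IsDensityOn.isProbabilityMeasure (hf : IsDensityOn d M A f) :
    IsProbabilityMeasure (densityMeasure d M f) :=
  ⟨by rw [densityMeasure, withDensity_apply _ MeasurableSet.univ, Measure.restrict_univ,
    hf.lintegral_eq_one]⟩

lemma IsFlatChart.le_densityMeasure_image (hg : IsFlatChart M y ε ρ U g)
    (hf : IsDensityOn d M A f) {S : Set (EuclideanSpace ℝ (Fin d))} (hS : MeasurableSet S)
    (hSρ : S ⊆ Metric.ball 0 ρ) {c : ℝ} (hc0 : 0 ≤ c) (hε : ε ≤ 1) (hc : ∀ u ∈ S, c ≤ f (g u)) :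
    c * (1 - ε) * volume.real S ≤ (densityMeasure d M f).real (g '' S) := by
  have := hf.isProbabilityMeasure
  have h1 : ENNReal.ofReal c * (ENNReal.ofReal (1 - ε) * volume S) ≤
      densityMeasure d M f (g '' S) := by
    rw [densityMeasure, withDensity_apply _ (hg.measurableSet_image hS hSρ)]
    calc ENNReal.ofReal c * (ENNReal.ofReal (1 - ε) * volume S)
        ≤ ENNReal.ofReal c * riemannianVolume d M (g '' S) := by
          gcongr; exact hg.le_riemannianVolume_image hS hSρ
      _ = ∫⁻ x in g '' S, ENNReal.ofReal c ∂(riemannianVolume d M) := by rw [setLIntegral_const]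
      _ ≤ _ := setLIntegral_mono' (hg.measurableSet_image hS hSρ) (by
          rintro _ ⟨u, hu, rfl⟩
          exact ENNReal.ofReal_le_ofReal (hc u hu))
  have h2 := ENNReal.toReal_mono (measure_ne_top _ _) h1
  rw [ENNReal.toReal_mul, ENNReal.toReal_mul, ENNReal.toReal_ofReal hc0,
    ENNReal.toReal_ofReal (by linarith)] at h2
  rw [mul_assoc]
  exact h2

lemma IsC2Submanifold.ae_mem (hM : IsC2Submanifold d M) : ∀ᵐ x ∂(riemannianVolume d M), x ∈ M :=
  hM.riemannianVolume_compl

/-- Only `Q ∩ A` has to be parametrized: the density vanishes on `M \ A`, and the complement of `M`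
has volume zero. -/
lemma IsFlatChart.densityMeasure_le (hg : IsFlatChart M y ε ρ U g) (hM : IsC2Submanifold d M)
    (hA : MeasurableSet A)
    (hf : IsDensityOn d M A f) {S : Set (EuclideanSpace ℝ (Fin d))} (hS : MeasurableSet S)
    (hSρ : S ⊆ Metric.ball 0 ρ) {Q : Set (EuclideanSpace ℝ (Fin m))} (hQ : MeasurableSet Q)
    (hQS : Q ∩ A ⊆ g '' S) {c : ℝ} (hc0 : 0 ≤ c) (hε : 0 ≤ ε)
    (hc : ∀ u ∈ S, g u ∈ A → f (g u) ≤ c) :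
    (densityMeasure d M f).real Q ≤ c * (1 + ε) * volume.real S := by
  have h1 : densityMeasure d M f Q ≤ ENNReal.ofReal c * (ENNReal.ofReal (1 + ε) * volume S) := by
    rw [densityMeasure, withDensity_apply _ hQ]
    calc ∫⁻ x in Q, ENNReal.ofReal (f x) ∂(riemannianVolume d M)
        ≤ ∫⁻ x in Q, A.indicator (fun _ => ENNReal.ofReal c) x ∂(riemannianVolume d M) := by
          refine setLIntegral_mono_ae' hQ ?_
          filter_upwards [hM.ae_mem] with x hx hxQ
          by_cases hxA : x ∈ A
          · rw [Set.indicator_of_mem hxA]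
            obtain ⟨u, hu, rfl⟩ := hQS ⟨hxQ, hxA⟩
            exact ENNReal.ofReal_le_ofReal (hc u hu hxA)
          · rw [hf.eq_zero x ⟨hx, hxA⟩]; simp
      _ = ENNReal.ofReal c * riemannianVolume d M (Q ∩ A) := by
          rw [lintegral_indicator_const hA, Measure.restrict_apply hA, Set.inter_comm]
      _ ≤ ENNReal.ofReal c * riemannianVolume d M (g '' S) := by gcongr
      _ ≤ _ := by gcongr; exact hg.riemannianVolume_image_le hS hSρ
  have hfin : volume S ≠ ∞ := ((measure_mono hSρ).trans_lt measure_ball_lt_top).ne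
  have h2 := ENNReal.toReal_mono (by finiteness) h1
  rw [ENNReal.toReal_mul, ENNReal.toReal_mul, ENNReal.toReal_ofReal hc0,
    ENNReal.toReal_ofReal (by linarith)] at h2
  rw [mul_assoc]
  exact h2

/-- For ball measures in an ε-flat chart, 1 - ε is the loss in volume density and (1 + ε)^d the loss
from shrinking the radius. -/
lemma eventually_lt_mul_div_pow {φ φ' : ℝ} (h : φ < φ') (d : ℕ) :
    ∀ᶠ ε : ℝ in 𝓝[>] 0, φ < φ' * (1 - ε) / (1 + ε) ^ d := by
  have hf : ContinuousAt (fun ε : ℝ => φ' * (1 - ε) / (1 + ε) ^ d) 0 :=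
    ContinuousAt.div (by fun_prop) (by fun_prop) (by simp)
  exact (hf.tendsto.eventually_const_lt (by simpa using h)).filter_mono nhdsWithin_le_nhds

lemma eventually_mul_div_pow_lt {φ φ' : ℝ} (h : φ' < φ) (d : ℕ) :
    ∀ᶠ ε : ℝ in 𝓝[>] 0, φ' * (1 + ε) / (1 - ε) ^ d < φ := by
  have hf : ContinuousAt (fun ε : ℝ => φ' * (1 + ε) / (1 - ε) ^ d) 0 :=
    ContinuousAt.div (by fun_prop) (by fun_prop) (by simp)
  exact (hf.tendsto.eventually_lt_const (by simpa using h)).filter_mono nhdsWithin_le_nhds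

/-- Lower bounds for the measure of small balls centred near a given point of `A`. -/
lemma exists_le_densityMeasure_closedBall (hd : d ≠ 0) (hM : IsC2Submanifold d M)
    (hA : IsSubmanifoldWithBoundary d M A) (hAc : IsClosed A) (hf : IsDensityOn d M A f)
    (hfc : ContinuousOn f A) (hy : y ∈ A) {φ : ℝ} (hφ0 : 0 ≤ φ) (hφ : φ < f y) :
    ∃ r₀ > 0, ∀ x ∈ A, dist x y < r₀ → ∀ r, 0 < r → r < r₀ →
      φ * unitBallVolume d / 2 * r ^ d ≤ (densityMeasure d M f).real (Metric.closedBall x r) ∧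
      (Disjoint (Metric.closedBall x r) (relBoundary M A) →
        φ * unitBallVolume d * r ^ d ≤ (densityMeasure d M f).real (Metric.closedBall x r)) := by
  have := hf.isProbabilityMeasure
  obtain ⟨φ', hφ1, hφ2⟩ := exists_between hφ
  obtain ⟨ε, ⟨hε, hε1⟩, hε0⟩ := (((eventually_lt_mul_div_pow hφ1 d).and
    ((gt_mem_nhds (show (0 : ℝ) < 1 by norm_num)).filter_mono nhdsWithin_le_nhds)).and
    self_mem_nhdsWithin).exists
  replace hε0 : 0 < ε := hε0
  obtain ⟨U, g, ρ₀, hρ₀, hflat, hloc⟩ := exists_flat_local hd hM hA hAc hy hε0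
  have hf₀ := hflat ρ₀ le_rfl
  -- the density exceeds `φ'` near `y`
  obtain ⟨η, hη, hfη⟩ : ∃ η > 0, ∀ x ∈ A, dist x y < η → φ' < f x := by
    have := (hfc y hy).eventually_const_lt hφ2
    rw [eventually_nhdsWithin_iff, Metric.eventually_nhds_iff] at this
    obtain ⟨η, hη, h⟩ := this
    exact ⟨η, hη, fun x hx hxy => h hxy hx⟩
  set ρ := min ρ₀ (η / 2) with hρ
  have hρ0 : 0 < ρ := lt_min hρ₀ (by linarith)
  have hg := hflat ρ (min_le_left _ _)
  have hgη : ∀ u ∈ Metric.ball 0 ρ, dist (g u) y < η := by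
    intro u hu
    rw [← hg.map_zero]
    have h1 := hg.dist_le u hu 0 (Metric.mem_ball_self hρ0)
    have h2 : dist u 0 < η / 2 := (Metric.mem_ball.1 hu).trans_le (min_le_right _ _)
    nlinarith [dist_nonneg (x := u) (y := (0 : EuclideanSpace ℝ (Fin d)))]
  obtain ⟨η', hη', hsub⟩ := (hflat (ρ / 2) (by
    have := min_le_left ρ₀ (η / 2); linarith)).exists_ball_subset (by linarith)
  refine ⟨min η' (ρ / 2), lt_min hη' (by linarith), fun x hxA hxy r hr0 hr => ?_⟩
  obtain ⟨u, hu, rfl⟩ := hsub ⟨hxy.trans_le (min_le_left _ _), hA.1 hxA⟩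
  have hrρ : r < ρ / 2 := hr.trans_le (min_le_right _ _)
  -- The chart expands distances by at most 1 + ε, so the parameter ball of radius `s` maps into the
  -- ball of radius `r`.
  set s := r / (1 + ε) with hs
  have hs0 : 0 < s := by positivity
  have hsr : (1 + ε) * s = r := by rw [hs]; field_simp
  have hball : Metric.closedBall u s ⊆ Metric.ball 0 ρ := by
    intro w hw
    rw [Metric.mem_closedBall] at hw
    rw [Metric.mem_ball] at hu ⊢
    have := dist_triangle w u 0
    nlinarith
  have huρ : u ∈ Metric.ball 0 ρ := hball (Metric.mem_closedBall_self hs0.le)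
  have hsubρ : Metric.ball (0 : EuclideanSpace ℝ (Fin d)) ρ ⊆ Metric.ball 0 ρ₀ :=
    Metric.ball_subset_ball (min_le_left _ _)
  have himg : ∀ w ∈ Metric.closedBall u s, dist (g w) (g u) ≤ r := by
    intro w hw
    refine (hg.dist_le w (hball hw) u huρ).trans ?_
    rw [← hsr]
    have := Metric.mem_closedBall.1 hw
    gcongr
  -- it suffices to find parameter sets of the right volume mapped into `A`
  have main : ∀ S ⊆ Metric.closedBall u s, MeasurableSet S → (∀ w ∈ S, g w ∈ A) → ∀ q ≥ 0,
      q * s ^ d = volume.real S →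
      φ * q * r ^ d ≤ (densityMeasure d M f).real (Metric.closedBall (g u) r) := by
    intro S hSs hSm hSA q hq hqS
    have h1 := hg.le_densityMeasure_image hf hSm (hSs.trans hball) (c := φ') (by linarith) hε1.le
      fun w hw => (hfη _ (hSA w hw) (hgη w (hball (hSs hw)))).le
    have h2 : (densityMeasure d M f).real (g '' S) ≤
        (densityMeasure d M f).real (Metric.closedBall (g u) r) := by
      refine measureReal_mono ?_
      rintro _ ⟨w, hw, rfl⟩
      exact himg w (hSs hw)
    refine le_trans ?_ (h1.trans h2)
    rw [← hqS, hs, div_pow]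
    have e : φ' * (1 - ε) * (q * (r ^ d / (1 + ε) ^ d)) =
      φ' * (1 - ε) / (1 + ε) ^ d * q * r ^ d := by ring
    rw [e]
    gcongr
  have hθ := (unitBallVolume_pos d).le
  have full : (∀ w ∈ Metric.closedBall u s, g w ∈ A) → φ * unitBallVolume d * r ^ d ≤
      (densityMeasure d M f).real (Metric.closedBall (g u) r) := fun h =>
    main _ le_rfl measurableSet_closedBall h _ hθ (volumeReal_closedBall hd u hs0.le).symm
  have hhalf : φ * unitBallVolume d / 2 * r ^ d ≤ φ * unitBallVolume d * r ^ d := by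
    gcongr
    have : 0 ≤ φ * unitBallVolume d := by positivity
    linarith
  rcases hloc with ⟨-, hint⟩ | ⟨-, a, ha, hbd⟩
  · have h := full fun w hw => (hint w (hsubρ (hball hw))).1
    exact ⟨hhalf.trans h, fun _ => h⟩
  · have hau : 0 ≤ a u := (hbd u (hsubρ huρ)).1.1 hxA
    constructor
    -- The half ball through the centre u, rather than through the boundary, lies in {a ≥ 0}
    -- wherever u is in `A`. This makes the estimate uniform up to the boundary.
    · have h := main (Metric.closedBall u s ∩ {w | a u ≤ a w}) Set.inter_subset_left
        (measurableSet_closedBall.inter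
          (isClosed_le continuous_const a.continuous).measurableSet)
        (fun w hw => (hbd w (hsubρ (hball hw.1))).1.2 (hau.trans hw.2)) (unitBallVolume d / 2)
        (by positivity) (by
          have := two_mul_volumeReal_halfBall hd ha u hs0.le
          linarith)
      rwa [← mul_div_assoc] at h
    · intro hdisj
      refine full fun w hw => (hbd w (hsubρ (hball hw))).1.2 ?_
      by_contra hneg
      push Not at hneg
      -- the segment from `u` to `w` meets the boundary
      set t := a u / (a u - a w) with ht
      have hden : 0 < a u - a w := by linarith
      have ht0 : 0 ≤ t := by positivity
      have ht1 : t ≤ 1 := by rw [ht, div_le_one hden]; linarith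
      set z := AffineMap.lineMap u w t with hz
      have hzs : z ∈ Metric.closedBall u s :=
        (convex_closedBall u s).lineMap_mem (Metric.mem_closedBall_self hs0.le) hw ⟨ht0, ht1⟩
      have haz : a z = 0 := by
        rw [hz, AffineMap.lineMap_apply]
        simp only [vsub_eq_sub, vadd_eq_add, map_add, map_smul, map_sub, smul_eq_mul]
        rw [ht]; field_simp; ring
      exact Set.disjoint_left.1 hdisj (Metric.mem_closedBall.2 (himg z hzs))
        ((hbd z (hsubρ (hball hzs))).2.2 haz)

end Density

/-! ### Uniform estimates, coverings and packings -/

/-- Compactness makes local radii uniform: finitely many neighbourhoods suffice, and the least of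
their radii works. -/
lemma exists_forall_of_isCompact {E : Type*} [PseudoMetricSpace E] {K : Set E} (hK : IsCompact K)
    {Q : E → ℝ → Prop}
    (h : ∀ y ∈ K, ∃ r₀ > 0, ∀ x ∈ K, dist x y < r₀ → ∀ r, 0 < r → r < r₀ → Q x r) :
    ∃ r₀ > 0, ∀ x ∈ K, ∀ r, 0 < r → r < r₀ → Q x r := by
  refine hK.induction_on (p := fun s => ∃ r₀ > 0, ∀ x ∈ s, ∀ r, 0 < r → r < r₀ → Q x r) ?_ ?_ ?_ ?_
  · exact ⟨1, one_pos, by simp⟩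
  · rintro s t hst ⟨r₀, hr₀, h⟩
    exact ⟨r₀, hr₀, fun x hx => h x (hst hx)⟩
  · rintro s t ⟨r₁, hr₁, h₁⟩ ⟨r₂, hr₂, h₂⟩
    refine ⟨min r₁ r₂, lt_min hr₁ hr₂, fun x hx r hr0 hr => ?_⟩
    rcases hx with hx | hx
    · exact h₁ x hx r hr0 (hr.trans_le (min_le_left _ _))
    · exact h₂ x hx r hr0 (hr.trans_le (min_le_right _ _))
  · intro y hy
    obtain ⟨r₀, hr₀, h⟩ := h y hy
    refine ⟨Metric.ball y r₀ ∩ K, ?_, r₀, hr₀, fun x hx => h x hx.2 hx.1⟩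
    exact inter_mem (mem_nhdsWithin_of_mem_nhds (Metric.ball_mem_nhds y hr₀)) self_mem_nhdsWithin

section Uniform

variable {d m : ℕ} {M A B : Set (EuclideanSpace ℝ (Fin m))} {f : EuclideanSpace ℝ (Fin m) → ℝ}
  {y : EuclideanSpace ℝ (Fin m)}

/-- Uniformly on a compact subset of `M`, the geodesic distance of nearby points is almost their
Euclidean distance. -/
lemma exists_geodesicEDist_le (hM : IsC2Submanifold d M) {K : Set (EuclideanSpace ℝ (Fin m))}
    (hK : IsCompact K) (hKM : K ⊆ M) {η : ℝ} (hη : 0 < η) :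
    ∃ r₀ > 0, ∀ x ∈ K, ∀ r, 0 < r → r < r₀ → ∀ z ∈ M, dist x z ≤ r →
      geodesicEDist M x z ≤ ENNReal.ofReal ((1 + η) * r) := by
  refine exists_forall_of_isCompact hK fun y hy => ?_
  obtain ⟨U, g, hg, u₀, hu₀, rfl⟩ := hM.2 y (hKM hy)
  obtain ⟨ε, ⟨hε, hε1⟩, hε0⟩ := (((eventually_mul_div_pow_lt
    (show (1 : ℝ) < 1 + η by linarith) 1).and
    ((gt_mem_nhds (show (0 : ℝ) < 1 by norm_num)).filter_mono nhdsWithin_le_nhds)).and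
    self_mem_nhdsWithin).exists
  replace hε0 : 0 < ε := hε0
  obtain ⟨L, ρ, hρ, hflat⟩ := hg.exists_flat hu₀ hε0
  have hf := hflat ρ le_rfl
  obtain ⟨η', hη', hsub⟩ := hf.exists_ball_subset hρ
  refine ⟨η' / 2, by linarith, fun x hx hxy r hr0 hr z hz hxz => ?_⟩
  obtain ⟨u, hu, rfl⟩ := hsub ⟨Metric.mem_ball.2 (show dist x _ < η' by linarith), hKM hx⟩
  obtain ⟨w, hw, rfl⟩ := hsub ⟨Metric.mem_ball.2 (show dist z _ < η' by
    rw [dist_comm] at hxz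
    linarith [dist_triangle z (g (u₀ + L u)) (g u₀)]), hz⟩
  refine (hf.geodesicEDist_le hε0 hu hw).trans (ENNReal.ofReal_le_ofReal ?_)
  have h1 := hf.le_dist u hu w hw
  have h2 : dist u w ≤ r / (1 - ε) := by
    rw [le_div_iff₀ (by linarith)]
    linarith
  rw [one_mul, pow_one, div_lt_iff₀ (by linarith)] at hε
  calc (1 + ε) * dist u w ≤ (1 + ε) * (r / (1 - ε)) := by gcongr
    _ = (1 + ε) * r / (1 - ε) := by ring
    _ ≤ (1 + η) * r := by
      rw [div_le_iff₀ (by linarith)]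
      nlinarith

/-- The measure of a neighbourhood of the boundary is at most proportional to its width. -/
lemma exists_densityMeasure_collar_le (hd : d ≠ 0) (hM : IsC2Submanifold d M)
    (hA : IsSubmanifoldWithBoundary d M A) (hAc : IsCompact A) (hf : IsDensityOn d M A f)
    (hfc : ContinuousOn f A) :
    ∃ C r₀ : ℝ, 0 < r₀ ∧ ∀ r, 0 < r → r < r₀ →
      (densityMeasure d M f).real (Metric.cthickening r (relBoundary M A)) ≤ C * r := by
  have hprob := hf.isProbabilityMeasure
  have hbc : IsCompact (relBoundary M A) := hAc.of_isClosed_subset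
    (isClosed_relBoundary hA.1 hAc.isClosed)
    fun x hx => ((mem_relBoundary_iff hA.1 hAc.isClosed).1 hx).1
  obtain ⟨F, hF⟩ := hAc.exists_bound_of_continuousOn hfc
  have key : ∃ (O : Set (EuclideanSpace ℝ (Fin m))) (C r₀ : ℝ), relBoundary M A ⊆ O ∧ IsOpen O ∧
      0 < r₀ ∧ ∀ r, 0 < r → r < r₀ →
      (densityMeasure d M f).real (O ∩ Metric.cthickening r (relBoundary M A)) ≤ C * r := by
    refine hbc.induction_on (p := fun s => ∃ (O : Set (EuclideanSpace ℝ (Fin m))) (C r₀ : ℝ),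
      s ⊆ O ∧ IsOpen O ∧ 0 < r₀ ∧ ∀ r, 0 < r → r < r₀ →
      (densityMeasure d M f).real (O ∩ Metric.cthickening r (relBoundary M A)) ≤ C * r)
      ?_ ?_ ?_ ?_
    · exact ⟨∅, 0, 1, le_rfl, isOpen_empty, one_pos, by simp⟩
    · rintro s t hst ⟨O, C, r₀, h, h'⟩
      exact ⟨O, C, r₀, hst.trans h, h'⟩
    · rintro s t ⟨O₁, C₁, r₁, h₁, ho₁, hr₁, hm₁⟩ ⟨O₂, C₂, r₂, h₂, ho₂, hr₂, hm₂⟩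
      refine ⟨O₁ ∪ O₂, C₁ + C₂, min r₁ r₂, Set.union_subset_union h₁ h₂, ho₁.union ho₂,
        lt_min hr₁ hr₂, fun r hr0 hr => ?_⟩
      rw [Set.union_inter_distrib_right, add_mul]
      exact (measureReal_union_le _ _).trans (add_le_add
        (hm₁ r hr0 (hr.trans_le (min_le_left _ _))) (hm₂ r hr0 (hr.trans_le (min_le_right _ _))))
    · intro y hy
      have hyA := ((mem_relBoundary_iff hA.1 hAc.isClosed).1 hy).1
      have hF0 : 0 ≤ F := (norm_nonneg _).trans (hF y hyA)
      obtain ⟨U, g, ρ, hρ, hflat, hloc⟩ :=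
        exists_flat_local hd hM hA hAc.isClosed hyA (show (0 : ℝ) < 1 / 2 by norm_num)
      have hg := hflat ρ le_rfl
      obtain ⟨a, ha, hbd⟩ := (hloc.resolve_left fun h => h.1 hy).2
      obtain ⟨η, hη, hsub⟩ := hg.exists_ball_subset hρ
      obtain ⟨C, hC, hslab⟩ := exists_volumeReal_slab_le ha ρ
      refine ⟨Metric.ball y (η / 2), mem_nhdsWithin_of_mem_nhds
        (Metric.ball_mem_nhds y (by linarith)), Metric.ball y (η / 2),
        F * (1 + 1 / 2) * (C * (2 * ‖a‖ + 1)), η / 2, le_rfl, Metric.isOpen_ball, by linarith,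
        fun r hr0 hr => ?_⟩
      -- A point within r of the boundary has a parameter within 2r of a zero of `a`, as the chart
      -- shrinks distances at most by half; the extra 1 makes `t` positive even without information
      -- on ‖a‖.
      set t := (2 * ‖a‖ + 1) * r with ht
      have ht0 : 0 < t := by positivity
      have h := hg.densityMeasure_le hM hAc.isClosed.measurableSet hf
        (S := Metric.ball 0 ρ ∩ {w | |a w| ≤ t})
        (Metric.isOpen_ball.measurableSet.inter
          (isClosed_le a.continuous.abs continuous_const).measurableSet) Set.inter_subset_left
        (Q := Metric.ball y (η / 2) ∩ Metric.cthickening r (relBoundary M A))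
        (Metric.isOpen_ball.measurableSet.inter Metric.isClosed_cthickening.measurableSet) (by
          rintro z ⟨⟨hzy, hzr⟩, hzA⟩
          rw [hbc.cthickening_eq_biUnion_closedBall hr0.le] at hzr
          simp only [Set.mem_iUnion, Metric.mem_closedBall, exists_prop] at hzr
          obtain ⟨z', hz', hzz'⟩ := hzr
          have hz'A := ((mem_relBoundary_iff hA.1 hAc.isClosed).1 hz').1
          rw [Metric.mem_ball] at hzy
          obtain ⟨w, hw, rfl⟩ := hsub ⟨Metric.mem_ball.2 (by linarith), hA.1 hzA⟩
          obtain ⟨w', hw', rfl⟩ := hsub ⟨Metric.mem_ball.2 (by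
            have := dist_triangle z' (g w) y
            rw [dist_comm] at hzz'
            linarith), hA.1 hz'A⟩
          refine ⟨w, ⟨hw, ?_⟩, rfl⟩
          have h1 : a w' = 0 := (hbd w' hw').2.1 hz'
          have h2 := hg.le_dist w hw w' hw'
          have h3 : |a w| ≤ ‖a‖ * dist w w' := by
            have := a.le_opNorm (w - w')
            rwa [map_sub, h1, sub_zero, Real.norm_eq_abs, ← dist_eq_norm] at this
          have h4 : dist w w' ≤ 2 * r := by linarith
          show |a w| ≤ t
          calc |a w| ≤ ‖a‖ * (2 * r) := h3.trans (by gcongr)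
            _ ≤ t := by rw [ht]; linarith)
        hF0 (by norm_num) fun u _ huA => (le_abs_self _).trans (hF _ huA)
      refine h.trans ?_
      have h5 := hslab t ht0
      calc F * (1 + 1 / 2) * volume.real (Metric.ball 0 ρ ∩ {w | |a w| ≤ t})
          ≤ F * (1 + 1 / 2) * (C * t) := by gcongr
        _ = _ := by rw [ht]; ring
  obtain ⟨O, C, r₀, hO, hOo, hr₀, hm⟩ := key
  -- The local estimates hold inside an open set containing the compact boundary; thin enough
  -- thickenings lie entirely in it.
  obtain ⟨r₁, hr₁, hsub⟩ := hbc.exists_cthickening_subset_open hOo hO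
  refine ⟨C, min r₀ r₁, lt_min hr₀ hr₁, fun r hr0 hr => ?_⟩
  have h := hm r hr0 (hr.trans_le (min_le_left _ _))
  rwa [Set.inter_eq_right.2 ((Metric.cthickening_mono (hr.le.trans (min_le_right _ _)) _).trans
    hsub)] at h

/-- Coverings of `B`, whose cardinalities and measures distinguish the boundary from the
interior. -/
lemma hasCovers (hd : 2 ≤ d) (hM : IsC2Submanifold d M)
    (hA : IsSubmanifoldWithBoundary d M A) (hAc : IsCompact A) (hBA : B ⊆ A) (hBc : IsClosed B)
    (hf : IsDensityOn d M A f) (hfc : ContinuousOn f A) {φ₀ φ₁ : ℝ} (hφ₀ : 0 < φ₀)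
    (hφ₀B : ∀ x ∈ B, φ₀ < f x) (hφ₁ : 0 ≤ φ₁) (hφ₁B : ∀ x ∈ B ∩ relBoundary M A, φ₁ < f x) :
    HasCovers (densityMeasure d M f) B d d (d - 1) (φ₀ * unitBallVolume d)
      (φ₁ * unitBallVolume d / 2) := by
  classical
  have hd0 : d ≠ 0 := by omega
  have hprob := hf.isProbabilityMeasure
  have hBcomp : IsCompact B := hAc.of_isClosed_subset hBc hBA
  set μ := densityMeasure d M f with hμ
  set θ := unitBallVolume d with hθ
  have hθ0 : 0 < θ := unitBallVolume_pos d
  obtain ⟨r₁, hr₁, h₁⟩ : ∃ r₀ > 0, ∀ x ∈ B, ∀ r, 0 < r → r < r₀ →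
      φ₀ * θ / 2 * r ^ d ≤ μ.real (Metric.closedBall x r) ∧
      (Disjoint (Metric.closedBall x r) (relBoundary M A) →
        φ₀ * θ * r ^ d ≤ μ.real (Metric.closedBall x r)) := by
    refine exists_forall_of_isCompact hBcomp fun y hy => ?_
    obtain ⟨r₀, hr₀, h⟩ := exists_le_densityMeasure_closedBall hd0 hM hA hAc.isClosed hf hfc
      (hBA hy) hφ₀.le (hφ₀B y hy)
    exact ⟨r₀, hr₀, fun x hx => h x (hBA hx)⟩
  obtain ⟨r₂, hr₂, h₂⟩ : ∃ r₀ > 0, ∀ x ∈ B, ∀ r, 0 < r → r < r₀ →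
      (¬ Disjoint (Metric.closedBall x r) (relBoundary M A) →
        φ₁ * θ / 2 * r ^ d ≤ μ.real (Metric.closedBall x r)) := by
    refine exists_forall_of_isCompact hBcomp fun y hy => ?_
    by_cases hyb : y ∈ relBoundary M A
    · obtain ⟨r₀, hr₀, h⟩ := exists_le_densityMeasure_closedBall hd0 hM hA hAc.isClosed hf hfc
        (hBA hy) hφ₁ (hφ₁B y ⟨hy, hyb⟩)
      exact ⟨r₀, hr₀, fun x hx hxy r h1 h2 _ => (h x (hBA hx) hxy r h1 h2).1⟩
    -- Off the boundary the claim is vacuous for small radii, which is why `φ₁` need only lie below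
    -- `f` on `B ∩ ∂A`.
    · have hopen : (relBoundary M A)ᶜ ∈ 𝓝 y :=
        (isClosed_relBoundary hA.1 hAc.isClosed).isOpen_compl.mem_nhds hyb
      obtain ⟨δ, hδ, hball⟩ := Metric.mem_nhds_iff.1 hopen
      refine ⟨δ / 2, by linarith, fun x hx hxy r _ h2 hnd => absurd ?_ hnd⟩
      refine Set.disjoint_left.2 fun z hz hzb => hball ?_ hzb
      rw [Metric.mem_closedBall] at hz
      rw [Metric.mem_ball]
      linarith [dist_triangle z x y]
  obtain ⟨C, r₃, hr₃, h₃⟩ := exists_densityMeasure_collar_le hd0 hM hA hAc hf hfc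
  intro δ hδ
  -- Balls of radius δr/2 centred in `B` have measure at least κ r^d by the half-ball estimate.
  -- Disjoint ones are counted by comparing total measures.
  set κ := φ₀ * θ / 2 * (δ / 2) ^ d with hκ
  have hκ0 : 0 < κ := by positivity
  refine ⟨max (κ⁻¹) (κ⁻¹ * (C * (1 + δ / 2))),
    min (min r₁ (r₁ / (δ / 2))) (min r₂ (r₃ / (1 + δ / 2))), by positivity, fun r hr0 hr => ?_⟩
  have hra : r < r₁ := hr.trans_le ((min_le_left _ _).trans (min_le_left _ _))
  have hrb : δ / 2 * r < r₁ := by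
    have : r < r₁ / (δ / 2) := hr.trans_le ((min_le_left _ _).trans (min_le_right _ _))
    rw [lt_div_iff₀ (by positivity)] at this
    linarith
  have hrc : r < r₂ := hr.trans_le ((min_le_right _ _).trans (min_le_left _ _))
  have hrd : (1 + δ / 2) * r < r₃ := by
    have : r < r₃ / (1 + δ / 2) := hr.trans_le ((min_le_right _ _).trans (min_le_right _ _))
    rw [lt_div_iff₀ (by positivity)] at this
    linarith
  -- packing: disjoint balls of radius `δ r / 2`
  have hpack : ∀ (T : Finset (EuclideanSpace ℝ (Fin m))) (Q : Set (EuclideanSpace ℝ (Fin m))),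
      ↑T ⊆ B → (T : Set (EuclideanSpace ℝ (Fin m))).Pairwise (fun x y => δ * r < dist x y) →
      (∀ x ∈ T, Metric.closedBall x (δ / 2 * r) ⊆ Q) → T.card * (κ * r ^ d) ≤ μ.real Q := by
    intro T Q hTB hT hTQ
    have hdisj : (T : Set (EuclideanSpace ℝ (Fin m))).PairwiseDisjoint
        fun x => Metric.closedBall x (δ / 2 * r) := fun x hx y hy hxy =>
      Metric.closedBall_disjoint_closedBall (by
        have : δ * r < dist x y := hT hx hy hxy
        linarith)
    calc T.card * (κ * r ^ d) = ∑ x ∈ T, κ * r ^ d := by simp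
      _ ≤ ∑ x ∈ T, μ.real (Metric.closedBall x (δ / 2 * r)) := by
        refine Finset.sum_le_sum fun x hx => ?_
        refine le_trans (le_of_eq ?_) (h₁ x (hTB hx) (δ / 2 * r) (by positivity) hrb).1
        rw [hκ, mul_pow]; ring
      _ = μ.real (⋃ x ∈ T, Metric.closedBall x (δ / 2 * r)) :=
        (measureReal_biUnion_finset hdisj fun x _ => measurableSet_closedBall).symm
      _ ≤ μ.real Q := measureReal_mono (Set.iUnion₂_subset hTQ)
  obtain ⟨T, hTB, hT, hcov⟩ := exists_separated_net (B := B) (s := δ * r) (by positivity)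
    (N := ⌈(κ * r ^ d)⁻¹⌉₊) fun T hTB hT => by
      have h := (hpack T Set.univ hTB hT fun _ _ => Set.subset_univ _).trans measureReal_le_one
      have h' : (T.card : ℝ) ≤ (κ * r ^ d)⁻¹ := by
        rwa [← one_div, le_div_iff₀ (by positivity)]
      exact_mod_cast h'.trans (Nat.le_ceil _)
  -- The net splits according to whether the r-ball meets ∂A: if not, the full density bound holds;
  -- if so, only half of the bound, but there are fewer such centres.
  refine ⟨T.filter fun x => Disjoint (Metric.closedBall x r) (relBoundary M A),
    T.filter fun x => ¬ Disjoint (Metric.closedBall x r) (relBoundary M A), ?_, ?_, ?_, ?_, ?_⟩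
  · intro y hy
    obtain ⟨x, hx, hxy⟩ := hcov y hy
    refine ⟨x, ?_, hxy⟩
    simp only [Finset.mem_filter, hx, true_and]
    exact em _
  · refine le_trans ?_ (le_max_left _ _)
    have h := (hpack (T.filter fun x => Disjoint (Metric.closedBall x r) (relBoundary M A))
      Set.univ (fun x hx => hTB (Finset.mem_of_mem_filter x hx))
      (hT.mono fun x hx => Finset.mem_of_mem_filter x hx)
      fun _ _ => Set.subset_univ _).trans measureReal_le_one
    rw [← one_div, le_div_iff₀ hκ0]
    linarith
  · refine le_trans ?_ (le_max_right _ _)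
    -- The small balls around these centres lie in a collar of width (1 + δ/2)r, of measure O(r)
    -- instead of O(1). This lowers the exponent from d to d - 1.
    have h := (hpack (T.filter fun x => ¬ Disjoint (Metric.closedBall x r) (relBoundary M A))
      (Metric.cthickening ((1 + δ / 2) * r) (relBoundary M A))
      (fun x hx => hTB (Finset.mem_of_mem_filter x hx))
      (hT.mono fun x hx => Finset.mem_of_mem_filter x hx) (by
        intro x hx z hz
        obtain ⟨w, hw, hwb⟩ := Set.not_disjoint_iff.1 (Finset.mem_filter.1 hx).2
        rw [Metric.mem_closedBall] at hz hw
        refine Metric.mem_cthickening_of_dist_le z w _ _ hwb ?_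
        rw [dist_comm] at hw
        linarith [dist_triangle z x w])).trans
      (h₃ _ (by positivity) hrd)
    have e : r ^ d = r ^ (d - 1) * r := by rw [← pow_succ]; congr 1; omega
    rw [inv_mul_eq_div, le_div_iff₀ hκ0]
    rw [e] at h
    refine le_of_mul_le_mul_right ?_ hr0
    linarith
  · intro x hx
    rw [Finset.mem_filter] at hx
    exact (h₁ x (hTB hx.1) r hr0 hra).2 hx.2
  · intro x hx
    rw [Finset.mem_filter] at hx
    exact h₂ x (hTB hx.1) r hr0 hrc hx.2

/-- Packings by balls centred on a linear subspace in the coordinates of an almost isometric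
chart. -/
lemma IsFlatChart.hasPackings {U : Set (EuclideanSpace ℝ (Fin d))}
    {g : EuclideanSpace ℝ (Fin d) → EuclideanSpace ℝ (Fin m)} {ε ρ : ℝ}
    (hg : IsFlatChart M y ε ρ U g) (hρ : 0 < ρ) (hε0 : 0 < ε) (hε : ε ≤ 1 / 2)
    (hM : IsC2Submanifold d M) (hA : MeasurableSet A) (hAM : A ⊆ M) (hf : IsDensityOn d M A f)
    {D : ℕ} (hD : D ≠ 0) (ψ : EuclideanSpace ℝ (Fin D) →ₗᵢ[ℝ] EuclideanSpace ℝ (Fin d))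
    (hψB : ∀ v, ψ v ∈ Metric.ball 0 ρ → g (ψ v) ∈ B)
    {H : Set (EuclideanSpace ℝ (Fin d))} (hH : MeasurableSet H)
    (hAH : ∀ u ∈ Metric.ball 0 ρ, g u ∈ A → u ∈ H) {q : ℝ}
    (hq : ∀ v s, 0 ≤ s → volume.real (Metric.closedBall (ψ v) s ∩ H) ≤ q * s ^ d) {φ : ℝ}
    (hφ0 : 0 ≤ φ) (hφ : ∀ u ∈ Metric.ball 0 ρ, g u ∈ A → f (g u) ≤ φ) :
    HasPackings (densityMeasure d M f) B d D (φ * (1 + ε) / (1 - ε) ^ d * q) := by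
  classical
  obtain ⟨η, hη, hsub⟩ := hg.exists_ball_subset hρ
  set ρ' := min ρ (η / 4) with hρ'
  have hρ'0 : 0 < ρ' := lt_min hρ (by linarith)
  obtain ⟨C, hC, hgrid⟩ := exists_separated_grid hD hρ'0
  refine ⟨C / 5 ^ D, η / 2, by positivity, by linarith, fun r hr0 hr => ?_⟩
  -- Since ε ≤ 1/2, points 5r apart have images at least 5r/2 apart, so closed r-balls around the
  -- images are disjoint.
  obtain ⟨T, hTρ, hTC, hTs⟩ := hgrid (5 * r) (by positivity)
  have hψρ : ∀ v ∈ T, ψ v ∈ Metric.ball 0 ρ' := fun v hv => by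
    have := hTρ hv
    rw [mem_ball_zero_iff] at this ⊢
    rwa [ψ.norm_map]
  have hsubρ : Metric.ball (0 : EuclideanSpace ℝ (Fin d)) ρ' ⊆ Metric.ball 0 ρ :=
    Metric.ball_subset_ball (min_le_left _ _)
  have hsep : ∀ v ∈ T, ∀ w ∈ T, v ≠ w → 2 * r < dist (g (ψ v)) (g (ψ w)) := by
    intro v hv w hw hvw
    have h1 := hg.le_dist _ (hsubρ (hψρ v hv)) _ (hsubρ (hψρ w hw))
    have h2 : 5 * r ≤ dist v w := hTs hv hw hvw
    rw [ψ.dist_map] at h1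
    nlinarith
  have hinj : Set.InjOn (fun v => g (ψ v)) T := by
    intro v hv w hw hvw
    by_contra hne
    have := hsep v hv w hw hne
    simp only at hvw
    rw [hvw, dist_self] at this
    linarith
  refine ⟨T.image fun v => g (ψ v), ?_, ?_, ?_, ?_⟩
  · intro x hx
    rw [Finset.coe_image] at hx
    obtain ⟨v, hv, rfl⟩ := hx
    exact hψB v (hsubρ (hψρ v hv))
  · rw [Finset.card_image_of_injOn hinj, div_le_iff₀ (by positivity)]
    rw [mul_pow] at hTC
    linarith
  · intro x hx x' hx' hxx'
    rw [Finset.coe_image] at hx hx'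
    obtain ⟨v, hv, rfl⟩ := hx
    obtain ⟨w, hw, rfl⟩ := hx'
    refine Metric.closedBall_disjoint_closedBall ?_
    have := hsep v hv w hw fun h => hxx' (h ▸ rfl)
    simp only
    linarith
  · intro x hx
    obtain ⟨v, hv, rfl⟩ := Finset.mem_image.1 hx
    -- The chart shrinks distances at most by the factor 1 - ε, so the parameters of points in the
    -- r-ball lie in the ball of radius `s`.
    set s := r / (1 - ε) with hs
    have hs0 : 0 ≤ s := div_nonneg hr0.le (by linarith)
    have hvy : dist (g (ψ v)) y < η / 2 := by
      rw [← hg.map_zero]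
      have h1 := hg.dist_le _ (hsubρ (hψρ v hv)) 0 (Metric.mem_ball_self hρ)
      have h2 : dist (ψ v) 0 < η / 4 := (Metric.mem_ball.1 (hψρ v hv)).trans_le (min_le_right _ _)
      nlinarith [dist_nonneg (x := ψ v) (y := 0)]
    have h := hg.densityMeasure_le hM hA hf (S := (Metric.closedBall (ψ v) s ∩ H) ∩ Metric.ball 0 ρ)
      ((measurableSet_closedBall.inter hH).inter measurableSet_ball) Set.inter_subset_right
      (Q := Metric.closedBall (g (ψ v)) r) measurableSet_closedBall (by
        rintro z ⟨hz, hzA⟩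
        rw [Metric.mem_closedBall] at hz
        obtain ⟨w, hw, rfl⟩ := hsub ⟨Metric.mem_ball.2 (by
          linarith [dist_triangle z (g (ψ v)) y]), hAM hzA⟩
        refine ⟨w, ⟨⟨?_, hAH w hw hzA⟩, hw⟩, rfl⟩
        have h1 := hg.le_dist w hw _ (hsubρ (hψρ v hv))
        rw [Metric.mem_closedBall, hs, le_div_iff₀ (by linarith)]
        linarith) hφ0 hε0.le fun u hu huA => hφ u hu.2 huA
    refine h.trans ?_
    have h2 : volume.real ((Metric.closedBall (ψ v) s ∩ H) ∩ Metric.ball 0 ρ) ≤ q * s ^ d := by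
      refine (measureReal_mono Set.inter_subset_left ?_).trans (hq v s hs0)
      exact ((measure_mono Set.inter_subset_left).trans_lt measure_closedBall_lt_top).ne
    calc φ * (1 + ε) * volume.real ((Metric.closedBall (ψ v) s ∩ H) ∩ Metric.ball 0 ρ)
        ≤ φ * (1 + ε) * (q * s ^ d) := by gcongr
      _ = _ := by rw [hs, div_pow]; ring

lemma HasPackings.mono {E : Type*} [PseudoMetricSpace E] [MeasurableSpace E] {μ : Measure E}
    {B : Set E} {d D : ℕ} {κ κ' : ℝ} (h : HasPackings μ B d D κ) (hκ : κ ≤ κ') :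
    HasPackings μ B d D κ' := by
  obtain ⟨C, r₀, hC, hr₀, h⟩ := h
  refine ⟨C, r₀, hC, hr₀, fun r hr0 hr => ?_⟩
  obtain ⟨T, h1, h2, h3, h4⟩ := h r hr0 hr
  exact ⟨T, h1, h2, h3, fun x hx => (h4 x hx).trans (by gcongr)⟩

lemma exists_ball_lt_of_continuousOn (hfc : ContinuousOn f A) (hy : y ∈ A) {φ : ℝ} (hφ : f y < φ) :
    ∃ η > 0, ∀ x ∈ A, dist x y < η → f x < φ := by
  have := (hfc y hy).eventually_lt_const hφ
  rw [eventually_nhdsWithin_iff, Metric.eventually_nhds_iff] at this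
  obtain ⟨η, hη, h⟩ := this
  exact ⟨η, hη, fun x hx hxy => h hxy hx⟩

/-- Packings by balls centred in the interior, near a point of small density. -/
lemma hasPackings_interior (hd : d ≠ 0) (hM : IsC2Submanifold d M)
    (hA : IsSubmanifoldWithBoundary d M A) (hAc : IsClosed A) (hBA : B ⊆ A)
    (hf : IsDensityOn d M A f) (hfc : ContinuousOn f A) (hy : y ∈ relInterior M B) {φ : ℝ}
    (hφ : f y < φ) : HasPackings (densityMeasure d M f) B d d (φ * unitBallVolume d) := by
  have hyB : y ∈ B := by_contra fun h => hy.2 (subset_closure ⟨hy.1, h⟩)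
  have hyA := hBA hyB
  obtain ⟨φ', h1, h2⟩ := exists_between hφ
  have hφ'0 : 0 ≤ φ' := (hf.nonneg y hy.1).trans h1.le
  obtain ⟨ε, ⟨hε, hε1⟩, hε0⟩ := (((eventually_mul_div_pow_lt h2 d).and
    ((gt_mem_nhds (show (0 : ℝ) < 1 / 2 by norm_num)).filter_mono nhdsWithin_le_nhds)).and
    self_mem_nhdsWithin).exists
  replace hε0 : 0 < ε := hε0
  obtain ⟨U, g, ρ₀, hρ₀, hflat, -⟩ := exists_flat_local hd hM hA hAc hyA hε0
  obtain ⟨η, hη, hfη⟩ := exists_ball_lt_of_continuousOn hfc hyA h1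
  obtain ⟨η', hη', hball⟩ := Metric.mem_nhds_iff.1 (isClosed_closure.isOpen_compl.mem_nhds hy.2)
  set ρ := min ρ₀ (min (η / 2) (η' / 2)) with hρ
  have hρ0 : 0 < ρ := by positivity
  have hg := hflat ρ (min_le_left _ _)
  have hgη : ∀ u ∈ Metric.ball 0 ρ, dist (g u) y < min η η' := by
    intro u hu
    rw [← hg.map_zero]
    have h1 := hg.dist_le u hu 0 (Metric.mem_ball_self hρ0)
    have h2 : dist u 0 < η / 2 :=
      (Metric.mem_ball.1 hu).trans_le ((min_le_right _ _).trans (min_le_left _ _))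
    have h3 : dist u 0 < η' / 2 :=
      (Metric.mem_ball.1 hu).trans_le ((min_le_right _ _).trans (min_le_right _ _))
    have := dist_nonneg (x := u) (y := (0 : EuclideanSpace ℝ (Fin d)))
    exact lt_min (by nlinarith) (by nlinarith)
  refine (hg.hasPackings hρ0 hε0 hε1.le hM hAc.measurableSet hA.1 hf hd LinearIsometry.id
    (fun v hv => ?_) MeasurableSet.univ (fun _ _ _ => trivial) (q := unitBallVolume d)
    (fun v s hs => ?_) hφ'0 fun u hu huA => ?_).mono ?_
  · by_contra h
    refine hball (Metric.mem_ball.2 ((hgη _ hv).trans_le (min_le_right _ _))) ?_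
    exact subset_closure ⟨hg.mem hv, h⟩
  · rw [Set.inter_univ, volumeReal_closedBall hd _ hs]
  · exact (hfη _ huA ((hgη u hu).trans_le (min_le_left _ _))).le
  · have := (unitBallVolume_pos d).le
    gcongr

/-- Packings by balls centred on the boundary, near a point of small density. -/
lemma hasPackings_boundary (hd : 2 ≤ d) (hM : IsC2Submanifold d M)
    (hA : IsSubmanifoldWithBoundary d M A) (hAc : IsClosed A)
    (hf : IsDensityOn d M A f) (hfc : ContinuousOn f A)
    (hy : y ∈ relInterior A B ∩ relBoundary M A) {φ : ℝ}
    (hφ : f y < φ) :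
    HasPackings (densityMeasure d M f) B d (d - 1) (φ * unitBallVolume d / 2) := by
  have hd0 : d ≠ 0 := by omega
  have hyA : y ∈ A := hy.1.1
  obtain ⟨φ', h1, h2⟩ := exists_between hφ
  have hφ'0 : 0 ≤ φ' := (hf.nonneg y (hA.1 hyA)).trans h1.le
  obtain ⟨ε, ⟨hε, hε1⟩, hε0⟩ := (((eventually_mul_div_pow_lt h2 d).and
    ((gt_mem_nhds (show (0 : ℝ) < 1 / 2 by norm_num)).filter_mono nhdsWithin_le_nhds)).and
    self_mem_nhdsWithin).exists
  replace hε0 : 0 < ε := hε0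
  obtain ⟨U, g, ρ₀, hρ₀, hflat, hloc⟩ := exists_flat_local hd0 hM hA hAc hyA hε0
  obtain ⟨a, ha, hbd⟩ := (hloc.resolve_left fun h => h.1 hy.2).2
  obtain ⟨ψ, hψ⟩ := exists_isometry_range_eq_ker ha
  obtain ⟨η, hη, hfη⟩ := exists_ball_lt_of_continuousOn hfc hyA h1
  obtain ⟨η', hη', hball⟩ := Metric.mem_nhds_iff.1 (isClosed_closure.isOpen_compl.mem_nhds hy.1.2)
  set ρ := min ρ₀ (min (η / 2) (η' / 2)) with hρ
  have hρ0 : 0 < ρ := by positivity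
  have hg := hflat ρ (min_le_left _ _)
  have hsubρ : Metric.ball (0 : EuclideanSpace ℝ (Fin d)) ρ ⊆ Metric.ball 0 ρ₀ :=
    Metric.ball_subset_ball (min_le_left _ _)
  have hgη : ∀ u ∈ Metric.ball 0 ρ, dist (g u) y < min η η' := by
    intro u hu
    rw [← hg.map_zero]
    have h1 := hg.dist_le u hu 0 (Metric.mem_ball_self hρ0)
    have h2 : dist u 0 < η / 2 :=
      (Metric.mem_ball.1 hu).trans_le ((min_le_right _ _).trans (min_le_left _ _))
    have h3 : dist u 0 < η' / 2 :=
      (Metric.mem_ball.1 hu).trans_le ((min_le_right _ _).trans (min_le_right _ _))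
    have := dist_nonneg (x := u) (y := (0 : EuclideanSpace ℝ (Fin d)))
    exact lt_min (by nlinarith) (by nlinarith)
  -- The centres have parameters in the hyperplane a = 0, a copy of ℝ^(d-1); the part of a ball
  -- inside `A` then has parameters in exactly half a ball.
  refine (hg.hasPackings hρ0 hε0 hε1.le hM hAc.measurableSet hA.1 hf (by omega) ψ
    (fun v hv => ?_) (isClosed_le continuous_const a.continuous).measurableSet
    (fun u hu huA => (hbd u (hsubρ hu)).1.1 huA) (q := unitBallVolume d / 2)
    (fun v s hs => ?_) hφ'0 fun u hu huA => ?_).mono ?_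
  · have hvA : g (ψ v) ∈ A := (hbd _ (hsubρ hv)).1.2 (hψ v).ge
    by_contra h
    refine hball (Metric.mem_ball.2 ((hgη _ hv).trans_le (min_le_right _ _))) ?_
    exact subset_closure ⟨hvA, h⟩
  · have := two_mul_volumeReal_halfBall hd0 ha (ψ v) hs
    rw [hψ v] at this
    linarith
  · exact (hfη _ huA ((hgη u hu).trans_le (min_le_left _ _))).le
  · have := (unitBallVolume_pos d).le
    have e : φ * unitBallVolume d / 2 = φ * (unitBallVolume d / 2) := by ring
    rw [e]
    gcongr

/-- The law of the sample points has no atoms. -/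
lemma densityMeasure_singleton (hd : d ≠ 0) (hM : IsC2Submanifold d M)
    (x : EuclideanSpace ℝ (Fin m)) : densityMeasure d M f {x} = 0 := by
  refine withDensity_absolutelyContinuous _ _ ?_
  by_cases hx : x ∈ M
  · obtain ⟨U, g, hg, u₀, hu₀, rfl⟩ := hM.2 x hx
    obtain ⟨L, ρ, hρ, hflat⟩ := hg.exists_flat hu₀ one_pos
    have hf := hflat ρ le_rfl
    have : Nonempty (Fin d) := Fin.pos_iff_nonempty.1 (Nat.pos_of_ne_zero hd)
    have h := hf.riemannianVolume_image_le (S := {0}) (measurableSet_singleton _)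
      (by simpa using hρ)
    have h0 : volume ({0} : Set (EuclideanSpace ℝ (Fin d))) = 0 := measure_singleton _
    rw [Set.image_singleton, hf.map_zero, h0, mul_zero] at h
    exact le_antisymm h bot_le
  · exact riemannianVolume_eq_zero_of_disjoint (measurableSet_singleton x) (by simpa using hx)

end Uniform

/-! ### The rate function and its inverse -/

lemma mul_rateH_eq_rate {y b : ℝ} (hb : 0 ≤ b) (hy : b ≤ y) : y * rateH (b / y) = rate y b := by
  rcases hb.eq_or_lt with rfl | hb
  · simp [rateH, rate]
  · have hy0 : 0 < y := hb.trans_le hy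
    rw [rateH, if_pos (div_pos hb hy0), rate]
    field_simp

/-- The increment is (z - y) - b log(z/y), positive because log(z/y) < z/y - 1 and b ≤ y. -/
lemma rate_strictMono {b y z : ℝ} (hb : 0 ≤ b) (hy : b ≤ y) (hyz : y < z) :
    rate y b < rate z b := by
  rcases hb.eq_or_lt with rfl | hb
  · simpa [rate] using hyz
  · have hy0 : 0 < y := hb.trans_le hy
    have hz0 : 0 < z := hy0.trans hyz
    have h1 : Real.log (z / y) < z / y - 1 :=
      Real.log_lt_sub_one_of_pos (by positivity) (by rw [Ne, div_eq_one_iff_eq hy0.ne']; exact hyz.ne')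
    have h2 : Real.log (b / y) - Real.log (b / z) = Real.log (z / y) := by
      rw [Real.log_div hb.ne' hy0.ne', Real.log_div hb.ne' hz0.ne',
        Real.log_div hz0.ne' hy0.ne']
      ring
    have h3 : b * (z / y - 1) ≤ z - y := by
      have : b * (z / y - 1) = b / y * (z - y) := by field_simp
      rw [this]
      have h4 : b / y ≤ 1 := (div_le_one hy0).2 hy
      nlinarith
    rw [rate, rate]
    nlinarith

lemma exists_rate_eq {b x : ℝ} (hb : 0 ≤ b) (hx : 0 ≤ x) : ∃ y, b ≤ y ∧ rate y b = x := by
  rcases hb.eq_or_lt with rfl | hb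
  · exact ⟨x, hx, by simp [rate]⟩
  -- Since log(Y/b) ≤ Y/(2b), the rate at Y is at least Y/2 - b = x, which sets up the intermediate
  -- value theorem.
  · set Y := 2 * (x + b) with hY
    have hbY : b ≤ Y := by linarith
    have hY0 : 0 < Y := hb.trans_le hbY
    have hcont : ContinuousOn (fun y => rate y b) (Set.Icc b Y) := by
      intro y hy
      refine ContinuousAt.continuousWithinAt ?_
      exact ContinuousAt.comp (f := fun y : ℝ => (y, b))
        (continuousAt_rate (hb.trans_le hy.1).ne') (by fun_prop)
    have h0 : rate b b = 0 := by simp [rate, div_self hb.ne']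
    have h1 : x ≤ rate Y b := by
      have h2 : Real.log (Y / b / 2) ≤ Y / b / 2 - 1 := Real.log_le_sub_one_of_pos (by positivity)
      rw [Real.log_div (by positivity) (by norm_num)] at h2
      have h3 : Real.log 2 ≤ 2 - 1 := Real.log_le_sub_one_of_pos (by norm_num)
      have h4 : Real.log (b / Y) = -Real.log (Y / b) := by rw [← Real.log_inv, inv_div]
      rw [rate, h4]
      have h5 : b * Real.log (Y / b) ≤ b * (Y / b / 2) := by gcongr; linarith
      have h6 : b * (Y / b / 2) = Y / 2 := by field_simp
      linarith
    obtain ⟨y, hy, hyx⟩ := intermediate_value_Icc hbY hcont ⟨h0.trans_le hx, h1⟩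
    exact ⟨y, hy.1, hyx⟩

lemma hatH_spec {b x : ℝ} (hb : 0 ≤ b) (hx : 0 ≤ x) : b ≤ hatH b x ∧ rate (hatH b x) b = x := by
  obtain ⟨y, hy, hyx⟩ := exists_rate_eq hb hx
  have hex : ∃ y ∈ Set.Ici b, (fun y : ℝ => y * rateH (b / y)) y = x :=
    ⟨y, hy, by simpa [mul_rateH_eq_rate hb hy] using hyx⟩
  have h1 : hatH b x ∈ Set.Ici b := Function.invFunOn_mem hex
  refine ⟨h1, ?_⟩
  rw [← mul_rateH_eq_rate hb h1]
  exact Function.invFunOn_eq hex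

lemma hatH_zero {x : ℝ} (hx : 0 ≤ x) : hatH 0 x = x := by
  have := (hatH_spec le_rfl hx).2
  simpa [rate] using this

lemma lt_hatH {b x : ℝ} (hb : 0 ≤ b) (hx : 0 < x) : b < hatH b x := by
  obtain ⟨h1, h2⟩ := hatH_spec hb hx.le
  refine lt_of_le_of_ne h1 fun h => ?_
  rw [← h] at h2
  have h0 : rate b b = 0 := by
    rcases hb.eq_or_lt with rfl | hb
    · simp [rate]
    · simp [rate, div_self hb.ne']
  linarith

lemma lt_rate_of_hatH_lt {b x c : ℝ} (hb : 0 ≤ b) (hx : 0 ≤ x) (h : hatH b x < c) :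
    x < rate c b := by
  obtain ⟨h1, h2⟩ := hatH_spec hb hx
  rw [← h2]
  exact rate_strictMono hb h1 h

lemma rate_lt_of_lt_hatH {b x c : ℝ} (hb : 0 ≤ b) (hx : 0 ≤ x) (hc : b ≤ c) (h : c < hatH b x) :
    rate c b < x := by
  conv_rhs => rw [← (hatH_spec hb hx).2]
  exact rate_strictMono hb hc h

/-! ### The coverage threshold -/

section Threshold

variable {Ω : Type*} {d m : ℕ} {M B : Set (EuclideanSpace ℝ (Fin m))}
  {X : ℕ → Ω → EuclideanSpace ℝ (Fin m)}

lemma encard_setOf_eq_hits (n : ℕ) (S : Set (EuclideanSpace ℝ (Fin m))) (ω : Ω) :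
    {i | i < n ∧ X i ω ∈ S}.encard = hits X n S ω := by
  classical
  have e : {i | i < n ∧ X i ω ∈ S} = ((Finset.range n).filter fun i => X i ω ∈ S : Finset ℕ) := by
    ext i; simp
  rw [e, Set.encard_coe_eq_coe_finsetCard, hits, Finset.card_filter]

lemma sample_inter (n : ℕ) (S : Set (EuclideanSpace ℝ (Fin m))) (ω : Ω) :
    sample X n ω ∩ S = (fun i => X i ω) '' {i | i < n ∧ X i ω ∈ S} := by
  ext z
  constructor
  · rintro ⟨⟨i, hi, rfl⟩, hz⟩
    exact ⟨i, ⟨hi, hz⟩, rfl⟩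
  · rintro ⟨i, ⟨hi, hz⟩, rfl⟩
    exact ⟨⟨i, hi, rfl⟩, hz⟩

lemma encard_sample_inter_le (n : ℕ) (S : Set (EuclideanSpace ℝ (Fin m))) (ω : Ω) :
    (sample X n ω ∩ S).encard ≤ hits X n S ω := by
  rw [sample_inter, ← encard_setOf_eq_hits]
  exact Set.encard_image_le _ _

/-- The sample is a set, so coinciding points count once; `hits` counts indices. They agree when the
points are distinct, which is needed only for the upper bound on the threshold. -/
lemma encard_sample_inter_eq {ω : Ω} (hinj : Function.Injective fun i => X i ω) (n : ℕ)
    (S : Set (EuclideanSpace ℝ (Fin m))) : (sample X n ω ∩ S).encard = hits X n S ω := by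
  rw [sample_inter, ← encard_setOf_eq_hits]
  exact hinj.encard_image _

/-- Geodesic balls lie in Euclidean balls of the same radius, so a deficient Euclidean ball rules
out all smaller radii. -/
lemma le_coverageThreshold {n k : ℕ} {ω : Ω} {r : ℝ}
    (h : ∃ x ∈ B, hits X n (Metric.closedBall x r) ω < k) :
    ENNReal.ofReal r ≤ coverageThreshold M B (sample X n ω) k := by
  obtain ⟨x, hx, hlt⟩ := h
  refine le_iInf₂ fun s hs => ?_
  by_contra hlt'
  push Not at hlt'
  have hsr : (s : ℝ) < r := by
    rw [← ENNReal.ofReal_coe_nnreal] at hlt'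
    exact lt_of_not_ge fun h => absurd (ENNReal.ofReal_le_ofReal h) (not_le.2 hlt')
  have hsub : geodesicBall M x s ⊆ Metric.closedBall x r := by
    intro z hz
    have h1 := (edist_le_geodesicEDist M x z).trans hz.2
    rw [edist_dist, ← ENNReal.ofReal_coe_nnreal] at h1
    rw [Metric.mem_closedBall, dist_comm]
    exact ((ENNReal.ofReal_le_ofReal_iff s.coe_nonneg).1 h1).trans hsr.le
  have h2 : (k : ℕ∞) ≤ hits X n (Metric.closedBall x r) ω :=
    (hs.2 x hx).trans ((Set.encard_le_encard (Set.inter_subset_inter_right _ hsub)).trans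
      (encard_sample_inter_le n _ ω))
  exact absurd (by exact_mod_cast h2) (not_le.2 hlt)

lemma coverageThreshold_le {n k : ℕ} {ω : Ω} {r s : ℝ} (hs : 0 < s)
    (hinj : Function.Injective fun i => X i ω) (hXM : ∀ i, X i ω ∈ M)
    (hgeo : ∀ x ∈ B, ∀ z ∈ M, dist x z ≤ r → geodesicEDist M x z ≤ ENNReal.ofReal s)
    (h : ∀ x ∈ B, k ≤ hits X n (Metric.closedBall x r) ω) :
    coverageThreshold M B (sample X n ω) k ≤ ENNReal.ofReal s := by
  refine iInf₂_le (Real.toNNReal s) ⟨Real.toNNReal_pos.2 hs, fun x hx => ?_⟩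
  have h1 : (k : ℕ∞) ≤ hits X n (Metric.closedBall x r) ω := by exact_mod_cast h x hx
  refine h1.trans ?_
  rw [← encard_sample_inter_eq hinj]
  refine Set.encard_le_encard ?_
  rintro z ⟨⟨i, hi, rfl⟩, hz⟩
  refine ⟨⟨i, hi, rfl⟩, hXM i, hgeo x hx _ (hXM i) ?_⟩
  rw [dist_comm]
  exact hz

end Threshold

/-! ### From events at fixed levels to almost sure limits -/

lemma ofReal_mul_pow_div {n : ℕ} {d : ℕ} {θ r t w : ℝ} (hθ : 0 ≤ θ) (hr : 0 ≤ r) (ht : 0 < t)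
    (hn : (0 : ℝ) < n) (hrt : r ^ d = w * t / n) :
    (n : ℝ≥0∞) * ENNReal.ofReal θ * ENNReal.ofReal r ^ d / ENNReal.ofReal t =
      ENNReal.ofReal (θ * w) := by
  rw [← ENNReal.ofReal_natCast, ← ENNReal.ofReal_pow hr, ← ENNReal.ofReal_mul hn.le,
    ← ENNReal.ofReal_mul (by positivity), ← ENNReal.ofReal_div_of_pos ht, hrt]
  congr 1
  field_simp

/-- The exceptional null set depends on the level, so only levels in a countable dense set are used.
-/
lemma ae_tendsto_of_forall_lt {Ω : Type*} [MeasurableSpace Ω] {P : Measure Ω} {V : Ω → ℕ → ℝ≥0∞}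
    {L : ℝ≥0∞} (h₁ : ∀ a < L, ∀ᵐ ω ∂P, ∀ᶠ n in atTop, a ≤ V ω n)
    (h₂ : ∀ b > L, ∀ᵐ ω ∂P, ∀ᶠ n in atTop, V ω n ≤ b) :
    ∀ᵐ ω ∂P, Tendsto (V ω) atTop (𝓝 L) := by
  obtain ⟨D, hDc, hD⟩ := TopologicalSpace.exists_countable_dense ℝ≥0∞
  have h₁' : ∀ᵐ ω ∂P, ∀ a ∈ D, a < L → ∀ᶠ n in atTop, a ≤ V ω n := by
    rw [ae_ball_iff hDc]
    intro a _
    by_cases ha : a < L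
    · filter_upwards [h₁ a ha] with ω hω _ using hω
    · exact Eventually.of_forall fun ω h => absurd h ha
  have h₂' : ∀ᵐ ω ∂P, ∀ b ∈ D, L < b → ∀ᶠ n in atTop, V ω n ≤ b := by
    rw [ae_ball_iff hDc]
    intro b _
    by_cases hb : L < b
    · filter_upwards [h₂ b hb] with ω hω _ using hω
    · exact Eventually.of_forall fun ω h => absurd h hb
  filter_upwards [h₁', h₂'] with ω g₁ g₂
  refine tendsto_order.2 ⟨fun a ha => ?_, fun b hb => ?_⟩
  · obtain ⟨q, hq, h1, h2⟩ := hD.exists_between ha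
    exact (g₁ q hq h2).mono fun n hn => h1.trans_le hn
  · obtain ⟨q, hq, h1, h2⟩ := hD.exists_between hb
    exact (g₂ q hq h1).mono fun n hn => hn.trans_lt h2

/-- `F` may be infinite, as `infOn` over the empty set is; a finite `φ` below it still exists, so
the case of no boundary in `B` needs no separate treatment. -/
lemma exists_lt_of_div_lt {F : ℝ≥0∞} (hF : 0 < F) {h v : ℝ} (hh : 0 ≤ h) (hv : 0 < v)
    (hlt : ENNReal.ofReal h / F < ENNReal.ofReal v) :
    ∃ φ : ℝ, 0 < φ ∧ ENNReal.ofReal φ < F ∧ h < v * φ := by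
  have h1 : ENNReal.ofReal (h / v) < F := by
    rw [ENNReal.ofReal_div_of_pos hv]
    exact ENNReal.div_lt_of_lt_mul (by
      rw [mul_comm]
      exact (ENNReal.div_lt_iff (Or.inl hF.ne') (Or.inr (by simp))).1 hlt)
  obtain ⟨q, hq1, hq2⟩ := ENNReal.lt_iff_exists_nnreal_btwn.1 h1
  have h2 : h / v < q := by
    rw [← ENNReal.ofReal_coe_nnreal] at hq1
    exact (ENNReal.ofReal_lt_ofReal_iff_of_nonneg (by positivity)).1 hq1
  refine ⟨q, lt_of_le_of_lt (by positivity) h2, by rwa [ENNReal.ofReal_coe_nnreal], ?_⟩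
  rw [div_lt_iff₀ hv] at h2
  linarith

/-- The condition b < vφ keeps the mean in the range where the rate is monotone. A level below the
quotient forces `F` to be finite. -/
lemma exists_lt_of_lt_div {F a : ℝ≥0∞} (hF : 0 < F) {h b : ℝ} (hb : 0 ≤ b) (hbh : b < h)
    (hlt : a < ENNReal.ofReal h / F) :
    ∃ v φ : ℝ, 0 < v ∧ 0 < φ ∧ a ≤ ENNReal.ofReal v ∧ F < ENNReal.ofReal φ ∧ b < v * φ ∧
      v * φ < h := by
  have hFt : F ≠ ∞ := by
    rintro rfl
    simp at hlt
  set F' := F.toReal with hF'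
  have hF0 : 0 < F' := ENNReal.toReal_pos hF.ne' hFt
  have hFF : F = ENNReal.ofReal F' := (ENNReal.ofReal_toReal hFt).symm
  have hat : a ≠ ∞ := hlt.ne_top
  rw [hFF, ← ENNReal.ofReal_div_of_pos hF0] at hlt
  have ha : a.toReal < h / F' := by
    rw [← ENNReal.ofReal_toReal hat] at hlt
    exact (ENNReal.ofReal_lt_ofReal_iff_of_nonneg ENNReal.toReal_nonneg).1 hlt
  have hbF : b / F' < h / F' := by gcongr
  obtain ⟨v, hv1, hv2⟩ := exists_between (max_lt ha hbF)
  have hv0 : 0 < v := lt_of_le_of_lt (by positivity) ((le_max_right _ _).trans_lt hv1)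
  have hvF : F' < h / v := by
    rw [lt_div_iff₀ hF0] at hv2
    rw [lt_div_iff₀ hv0]
    linarith
  obtain ⟨φ, hφ1, hφ2⟩ := exists_between hvF
  refine ⟨v, φ, hv0, hF0.trans hφ1, ?_, ?_, ?_, ?_⟩
  · rw [← ENNReal.ofReal_toReal hat]
    exact ENNReal.ofReal_le_ofReal ((le_max_left _ _).trans hv1.le)
  · rw [hFF]
    exact (ENNReal.ofReal_lt_ofReal_iff (hF0.trans hφ1)).2 hφ1
  · have h1 := (le_max_right a.toReal (b / F')).trans_lt hv1
    rw [div_lt_iff₀ hF0] at h1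
    nlinarith
  · rw [lt_div_iff₀ hv0] at hφ2
    linarith

/-- Without atoms the diagonal is null for the product law, and there are countably many pairs of
indices. -/
lemma ae_injective {Ω E : Type*} [MeasurableSpace Ω] [TopologicalSpace E] [T2Space E]
    [SecondCountableTopology E] [MeasurableSpace E] [BorelSpace E] {P : Measure Ω}
    [IsProbabilityMeasure P] {μ : Measure E} {X : ℕ → Ω → E} (hX : ∀ i, Measurable (X i))
    (hind : iIndepFun X P) (hlaw : ∀ i, P.map (X i) = μ) (hμ : ∀ x, μ {x} = 0) :
    ∀ᵐ ω ∂P, Function.Injective fun i => X i ω := by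
  have : IsProbabilityMeasure μ := hlaw 0 ▸ Measure.isProbabilityMeasure_map (hX 0).aemeasurable
  have h : ∀ i j, i ≠ j → ∀ᵐ ω ∂P, X i ω ≠ X j ω := by
    intro i j hij
    have h1 := (indepFun_iff_map_prod_eq_prod_map_map (hX i).aemeasurable
      (hX j).aemeasurable).1 (hind.indepFun hij)
    rw [hlaw, hlaw] at h1
    have h2 : (μ.prod μ) (Set.diagonal E) = 0 := by
      rw [Measure.measure_prod_null measurableSet_diagonal]
      refine Eventually.of_forall fun x => ?_
      have : Prod.mk x ⁻¹' Set.diagonal E = {x} := by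
        ext y; simp [eq_comm]
      change μ (Prod.mk x ⁻¹' Set.diagonal E) = 0
      rw [this]
      exact hμ x
    rw [← h1, Measure.map_apply ((hX i).prodMk (hX j)) measurableSet_diagonal] at h2
    have h3 : ∀ᵐ ω ∂P, ω ∉ (fun ω => (X i ω, X j ω)) ⁻¹' Set.diagonal E :=
      measure_eq_zero_iff_ae_notMem.1 h2
    filter_upwards [h3] with ω hω using hω
  have h' : ∀ᵐ ω ∂P, ∀ i j, i ≠ j → X i ω ≠ X j ω := by
    rw [ae_all_iff]; intro i
    rw [ae_all_iff]; intro j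
    by_cases hij : i = j
    · exact Eventually.of_forall fun ω h => absurd hij h
    · filter_upwards [h i j hij] with ω hω _ using hω
  filter_upwards [h'] with ω hω i j hij
  by_contra hne
  exact hω i j hne hij

/-! ### Almost sure limits of the coverage threshold -/

section Limits

variable {d m : ℕ} {M A B : Set (EuclideanSpace ℝ (Fin m))} {f : EuclideanSpace ℝ (Fin m) → ℝ}

lemma lt_of_ofReal_lt_infOn {S : Set (EuclideanSpace ℝ (Fin m))} {φ : ℝ} (hφ : 0 ≤ φ)
    (h : ENNReal.ofReal φ < infOn f S) : ∀ x ∈ S, φ < f x := fun x hx =>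
  (ENNReal.ofReal_lt_ofReal_iff_of_nonneg hφ).1 (h.trans_le (iInf₂_le x hx))

/-- The two closure hypotheses on `B` enter here: by continuity on `A`, a point of small density
moves into the relative interior, where there is room for a packing. -/
lemma exists_lt_of_infOn_lt_ofReal {S T : Set (EuclideanSpace ℝ (Fin m))} {φ : ℝ} (hφ : 0 < φ)
    (hfc : ContinuousOn f A) (hSA : S ⊆ A) (hST : S = closure T) (h : infOn f S < ENNReal.ofReal φ) :
    ∃ y ∈ T, f y < φ := by
  obtain ⟨x, hx, hlt⟩ : ∃ x ∈ S, ENNReal.ofReal (f x) < ENNReal.ofReal φ := by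
    simpa only [infOn, iInf_lt_iff, exists_prop] using h
  obtain ⟨η, hη, hxη⟩ := exists_ball_lt_of_continuousOn hfc (hSA hx)
    ((ENNReal.ofReal_lt_ofReal_iff hφ).1 hlt)
  obtain ⟨y, hy, hxy⟩ := Metric.mem_closure_iff.1 (hST ▸ hx : x ∈ closure T) η hη
  refine ⟨y, hy, hxη y (hSA ?_) (by rwa [dist_comm])⟩
  rw [hST]
  exact subset_closure hy

variable {Ω : Type*} [MeasurableSpace Ω] {P : Measure Ω}
  {X : ℕ → Ω → EuclideanSpace ℝ (Fin m)} {k : ℕ → ℕ} {t : ℕ → ℝ}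

lemma ae_eventually_le_threshold (hd : d ≠ 0) (ht : ∀ᶠ n in atTop, 0 < t n) {v : ℝ} (hv : 0 < v)
    {a : ℝ≥0∞} (ha : a ≤ ENNReal.ofReal v)
    (h : ∀ᵐ ω ∂P, ∀ᶠ n : ℕ in atTop, ∃ x ∈ B,
      hits X n (Metric.closedBall x (rad d (v / unitBallVolume d * t n / n))) ω < k n) :
    ∀ᵐ ω ∂P, ∀ᶠ n : ℕ in atTop, a ≤ (n : ℝ≥0∞) * ENNReal.ofReal (unitBallVolume d) *
      coverageThreshold M B (sample X n ω) (k n) ^ d / ENNReal.ofReal (t n) := by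
  have hθ := unitBallVolume_pos d
  filter_upwards [h] with ω hω
  filter_upwards [hω, ht, eventually_gt_atTop 0] with n hn htn hn0
  have hn0' : (0 : ℝ) < n := by exact_mod_cast hn0
  have hpos : 0 < v / unitBallVolume d * t n / n := by positivity
  have h1 := le_coverageThreshold (M := M) hn
  have h2 := ofReal_mul_pow_div (d := d) hθ.le (rad_pos (d := d) hpos).le htn hn0'
    (rad_pow hd hpos.le)
  have h3 : unitBallVolume d * (v / unitBallVolume d) = v := by field_simp
  rw [h3] at h2
  refine ha.trans (h2.symm.trans_le ?_)
  gcongr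

/-- The Euclidean radius is reduced by 1 + η in advance, to pay for the comparison with geodesic
balls. -/
lemma ae_eventually_threshold_le (hd : d ≠ 0) (hM : IsC2Submanifold d M) (hBc : IsCompact B)
    (hBM : B ⊆ M) (hinj : ∀ᵐ ω ∂P, Function.Injective fun i => X i ω)
    (hXM : ∀ᵐ ω ∂P, ∀ i, X i ω ∈ M) (ht : ∀ᶠ n in atTop, 0 < t n)
    (ht0 : Tendsto (fun n : ℕ => t n / n) atTop (𝓝 0)) {v η : ℝ} (hv : 0 < v) (hη : 0 < η)
    {b : ℝ≥0∞} (hb : ENNReal.ofReal v ≤ b)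
    (h : ∀ᵐ ω ∂P, ∀ᶠ n : ℕ in atTop, ∀ x ∈ B,
      k n ≤ hits X n (Metric.closedBall x
        (rad d (v / (1 + η) ^ d / unitBallVolume d * t n / n))) ω) :
    ∀ᵐ ω ∂P, ∀ᶠ n : ℕ in atTop, (n : ℝ≥0∞) * ENNReal.ofReal (unitBallVolume d) *
      coverageThreshold M B (sample X n ω) (k n) ^ d / ENNReal.ofReal (t n) ≤ b := by
  have hθ := unitBallVolume_pos d
  set u := v / (1 + η) ^ d / unitBallVolume d with hu
  have hu0 : 0 < u := by positivity
  obtain ⟨r₀, hr₀, hgeo⟩ := exists_geodesicEDist_le hM hBc hBM hη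
  have hrad : Tendsto (fun n : ℕ => rad d (u * t n / n)) atTop (𝓝 0) := by
    refine tendsto_rad hd ?_
    simpa [mul_div_assoc] using ht0.const_mul u
  filter_upwards [h, hinj, hXM] with ω hω hωi hωM
  filter_upwards [hω, ht, eventually_gt_atTop 0, hrad.eventually_lt_const hr₀]
    with n hn htn hn0 hrn
  have hn0' : (0 : ℝ) < n := by exact_mod_cast hn0
  have hpos : 0 < u * t n / n := by positivity
  have hr0 := rad_pos (d := d) hpos
  have h1 := coverageThreshold_le (M := M) (s := (1 + η) * rad d (u * t n / n)) (by positivity)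
    hωi hωM (fun x hx z hz hxz => hgeo x hx _ hr0 hrn z hz hxz) hn
  have h2 := ofReal_mul_pow_div (d := d) (w := (1 + η) ^ d * u) hθ.le
    (by positivity : 0 ≤ (1 + η) * rad d (u * t n / n)) htn hn0'
    (by rw [mul_pow, rad_pow hd hpos.le]; ring)
  have h3 : unitBallVolume d * ((1 + η) ^ d * u) = v := by rw [hu]; field_simp
  rw [h3] at h2
  refine le_trans ?_ (h2.trans_le hb)
  gcongr

/-- The almost sure limit of the coverage threshold, given the covering and the non-covering
criteria at the scale `t`. -/
lemma ae_tendsto_threshold [IsProbabilityMeasure P] (hd : 2 ≤ d) (hM : IsC2Submanifold d M)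
    (hA : IsSubmanifoldWithBoundary d M A) (hAc : IsCompact A) (hBA : B ⊆ A) (hBc : IsClosed B)
    (hf : IsDensityOn d M A f) (hfc : ContinuousOn f A) (hf_pos : 0 < infOn f B)
    (hB : B = closure (relInterior M B))
    (hB_bdry : B ∩ relBoundary M A = closure (relInterior A B ∩ relBoundary M A))
    (hX : ∀ i, Measurable (X i)) (hind : iIndepFun X P)
    (hlaw : ∀ i, P.map (X i) = densityMeasure d M f) (ht : ∀ᶠ n in atTop, 0 < t n)
    (ht0 : Tendsto (fun n : ℕ => t n / n) atTop (𝓝 0)) {b h₀ h₁ : ℝ} (hb : 0 ≤ b)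
    (hbh₀ : b < h₀) (hbh₁ : b < h₁)
    (hcov : ∀ κ₁ κ₂ u : ℝ, 0 < u → HasCovers (densityMeasure d M f) B d d (d - 1) κ₁ κ₂ →
      h₀ < u * κ₁ → h₁ < u * κ₂ → ∀ᵐ ω ∂P, ∀ᶠ n : ℕ in atTop, ∀ x ∈ B,
        k n ≤ hits X n (Metric.closedBall x (rad d (u * t n / n))) ω)
    (hpack₀ : ∀ κ u : ℝ, 0 < u → 0 < κ → HasPackings (densityMeasure d M f) B d d κ →
      b < u * κ → u * κ < h₀ → ∀ᵐ ω ∂P, ∀ᶠ n : ℕ in atTop, ∃ x ∈ B,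
        hits X n (Metric.closedBall x (rad d (u * t n / n))) ω < k n)
    (hpack₁ : ∀ κ u : ℝ, 0 < u → 0 < κ → HasPackings (densityMeasure d M f) B d (d - 1) κ →
      b < u * κ → u * κ < h₁ → ∀ᵐ ω ∂P, ∀ᶠ n : ℕ in atTop, ∃ x ∈ B,
        hits X n (Metric.closedBall x (rad d (u * t n / n))) ω < k n) :
    ∀ᵐ ω ∂P, Tendsto (fun n : ℕ => (n : ℝ≥0∞) * ENNReal.ofReal (unitBallVolume d) *
        coverageThreshold M B (sample X n ω) (k n) ^ d / ENNReal.ofReal (t n)) atTop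
      (𝓝 (max (ENNReal.ofReal h₀ / infOn f B)
        (ENNReal.ofReal (2 * h₁) / infOn f (B ∩ relBoundary M A)))) := by
  have hd0 : d ≠ 0 := by omega
  have hθ := unitBallVolume_pos d
  have hBcomp : IsCompact B := hAc.of_isClosed_subset hBc hBA
  have hBM : B ⊆ M := hBA.trans hA.1
  have hf_pos' : 0 < infOn f (B ∩ relBoundary M A) :=
    hf_pos.trans_le (iInf_le_iInf_of_subset Set.inter_subset_left)
  have hinj := ae_injective hX hind hlaw (densityMeasure_singleton hd0 hM)
  have hXM : ∀ᵐ ω ∂P, ∀ i, X i ω ∈ M := by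
    rw [ae_all_iff]
    intro i
    have h1 : ∀ᵐ x ∂(P.map (X i)), x ∈ M := by
      rw [hlaw]
      exact (withDensity_absolutelyContinuous _ _).ae_le hM.ae_mem
    exact ae_of_ae_map (hX i).aemeasurable h1
  refine ae_tendsto_of_forall_lt (fun a ha => ?_) (fun c hc => ?_)
  · rcases lt_max_iff.1 ha with ha | ha
    · obtain ⟨v, φ, hv, hφ, hav, hFφ, hbv, hvh⟩ := exists_lt_of_lt_div hf_pos hb hbh₀ ha
      obtain ⟨y, hy, hyφ⟩ := exists_lt_of_infOn_lt_ofReal hφ hfc hBA hB hFφ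
      have e : v / unitBallVolume d * (φ * unitBallVolume d) = v * φ := by field_simp
      exact ae_eventually_le_threshold hd0 ht hv hav (hpack₀ _ _ (by positivity) (by positivity)
        (hasPackings_interior hd0 hM hA hAc.isClosed hBA hf hfc hy hyφ)
        (by rwa [e]) (by rwa [e]))
    -- Half balls turn the mean into vφ/2, hence the doubling of both ends of the interval.
    · obtain ⟨v, φ, hv, hφ, hav, hFφ, hbv, hvh⟩ := exists_lt_of_lt_div (b := 2 * b) hf_pos'
        (by positivity) (by linarith) ha
      obtain ⟨y, hy, hyφ⟩ := exists_lt_of_infOn_lt_ofReal hφ hfc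
        (Set.inter_subset_left.trans hBA) hB_bdry hFφ
      have e : v / unitBallVolume d * (φ * unitBallVolume d / 2) = v * φ / 2 := by field_simp
      exact ae_eventually_le_threshold hd0 ht hv hav (hpack₁ _ _ (by positivity) (by positivity)
        (hasPackings_boundary hd hM hA hAc.isClosed hf hfc hy hyφ)
        (by rw [e]; linarith) (by rw [e]; linarith))
  · obtain ⟨q, hq1, hq2⟩ := ENNReal.lt_iff_exists_nnreal_btwn.1 hc
    rw [← ENNReal.ofReal_coe_nnreal] at hq1 hq2
    generalize (q : ℝ) = v at hq1 hq2
    have hv : 0 < v := by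
      by_contra hneg
      rw [ENNReal.ofReal_of_nonpos (not_lt.1 hneg)] at hq1
      exact absurd hq1 (by simp)
    obtain ⟨φ₀, hφ₀, hFφ₀, hvφ₀⟩ := exists_lt_of_div_lt hf_pos (hb.trans hbh₀.le) hv
      ((le_max_left _ _).trans_lt hq1)
    obtain ⟨φ₁, hφ₁, hFφ₁, hvφ₁⟩ := exists_lt_of_div_lt hf_pos' (by linarith) hv
      ((le_max_right _ _).trans_lt hq1)
    have hcont : ∀ h φ : ℝ, h < v * φ → ∀ᶠ η : ℝ in 𝓝[>] 0, h < v / (1 + η) ^ d * φ := by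
      intro h φ hφ
      have hg : ContinuousAt (fun η : ℝ => v / (1 + η) ^ d * φ) 0 :=
        (ContinuousAt.div continuousAt_const (by fun_prop) (by simp)).mul continuousAt_const
      exact (hg.tendsto.eventually_const_lt (by simpa using hφ)).filter_mono nhdsWithin_le_nhds
    obtain ⟨η, ⟨hη₀, hη₁⟩, hη⟩ := (((hcont _ _ hvφ₀).and (hcont _ _ hvφ₁)).and
      self_mem_nhdsWithin).exists
    replace hη : 0 < η := hη
    set w := v / (1 + η) ^ d with hw
    have e₀ : w / unitBallVolume d * (φ₀ * unitBallVolume d) = w * φ₀ := by field_simp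
    have e₁ : w / unitBallVolume d * (φ₁ * unitBallVolume d / 2) = w * φ₁ / 2 := by field_simp
    exact ae_eventually_threshold_le hd0 hM hBcomp hBM hinj hXM ht ht0 hv hη hq2.le
      (hcov _ _ _ (by positivity) (hasCovers hd hM hA hAc hBA hBc hf hfc hφ₀
        (lt_of_ofReal_lt_infOn hφ₀.le hFφ₀) hφ₁.le (lt_of_ofReal_lt_infOn hφ₁.le hFφ₁))
        (by rwa [e₀]) (by rw [e₁]; linarith))

end Limits

/-! ### The two regimes of k(n) and the main theorem -/

lemma natCast_sub_one_div {d : ℕ} (hd : 2 ≤ d) : ((d - 1 : ℕ) : ℝ) / d = 1 - 1 / (d : ℝ) := by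
  have h0 : (d : ℝ) ≠ 0 := by positivity
  rw [Nat.cast_sub (by omega)]
  field_simp
  simp

lemma one_sub_one_div_pos {d : ℕ} (hd : 2 ≤ d) : 0 < 1 - 1 / (d : ℝ) := by
  have h : (2 : ℝ) ≤ d := by exact_mod_cast hd
  rw [sub_pos, div_lt_one (by linarith)]
  linarith

lemma eventually_log_pos : ∀ᶠ n : ℕ in atTop, 0 < Real.log n :=
  tendsto_log_nat.eventually_gt_atTop 0

lemma tendsto_log_div_nat : Tendsto (fun n : ℕ => Real.log n / n) atTop (𝓝 0) := by
  have h := (Real.isLittleO_log_id_atTop.tendsto_div_nhds_zero).comp tendsto_natCast_atTop_atTop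
  exact h

/-- The measurable case, for `k n` of the order of `log n`. -/
lemma ae_tendsto_threshold_log {d m : ℕ} {M A B : Set (EuclideanSpace ℝ (Fin m))}
    {f : EuclideanSpace ℝ (Fin m) → ℝ} {Ω : Type*} [MeasurableSpace Ω] {P : Measure Ω}
    [IsProbabilityMeasure P] {X : ℕ → Ω → EuclideanSpace ℝ (Fin m)} {k : ℕ → ℕ}
    (hd : 2 ≤ d) (hM : IsC2Submanifold d M)
    (hA : IsSubmanifoldWithBoundary d M A) (hAc : IsCompact A) (hBA : B ⊆ A) (hBc : IsClosed B)
    (hf : IsDensityOn d M A f) (hfc : ContinuousOn f A) (hf_pos : 0 < infOn f B)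
    (hB : B = closure (relInterior M B))
    (hB_bdry : B ∩ relBoundary M A = closure (relInterior A B ∩ relBoundary M A))
    (hX : ∀ i, Measurable (X i)) (hind : iIndepFun X P)
    (hlaw : ∀ i, P.map (X i) = densityMeasure d M f) (hk1 : ∀ n, 1 ≤ n → 1 ≤ k n) {β : ℝ}
    (hβ : 0 ≤ β) (hk : Tendsto (fun n : ℕ => (k n : ℝ) / Real.log n) atTop (𝓝 β)) :
    ∀ᵐ ω ∂P, Tendsto (fun n : ℕ => (n : ℝ≥0∞) * ENNReal.ofReal (unitBallVolume d) *
        coverageThreshold M B (sample X n ω) (k n) ^ d / ENNReal.ofReal (Real.log n)) atTop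
      (𝓝 (max (ENNReal.ofReal (hatH β 1) / infOn f B)
        (ENNReal.ofReal (2 * hatH β (1 - 1 / (d : ℝ))) / infOn f (B ∩ relBoundary M A)))) := by
  have hd0 : d ≠ 0 := by omega
  have hdd : (d : ℝ) / d = 1 := div_self (by positivity)
  have hpos := one_sub_one_div_pos hd
  have hb₀ := lt_hatH hβ one_pos
  have hb₁ := lt_hatH hβ hpos
  refine ae_tendsto_threshold hd hM hA hAc hBA hBc hf hfc hf_pos hB hB_bdry hX hind hlaw
    eventually_log_pos tendsto_log_div_nat hβ hb₀ hb₁ ?_ ?_ ?_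
  · intro κ₁ κ₂ u hu hcov h₀ h₁
    refine ae_eventually_covered_log hX hind hlaw hd0 hcov hβ hk hu (hb₀.trans h₀) ?_
      (hb₁.trans h₁) ?_
    · rw [hdd]; exact lt_rate_of_hatH_lt hβ zero_le_one h₀
    · rw [natCast_sub_one_div hd]; exact lt_rate_of_hatH_lt hβ hpos.le h₁
  · intro κ u hu _ hpack hb h₀
    refine ae_eventually_not_covered_log hX hind hlaw hd0 hpack hk1 hβ hk hu hb ?_
    rw [hdd]; exact rate_lt_of_lt_hatH hβ zero_le_one hb.le h₀
  · intro κ u hu _ hpack hb h₁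
    refine ae_eventually_not_covered_log hX hind hlaw hd0 hpack hk1 hβ hk hu hb ?_
    rw [natCast_sub_one_div hd]; exact rate_lt_of_lt_hatH hβ hpos.le hb.le h₁

/-- The measurable case, for `k n` of larger order than `log n`. -/
lemma ae_tendsto_threshold_of_log_lt {d m : ℕ} {M A B : Set (EuclideanSpace ℝ (Fin m))}
    {f : EuclideanSpace ℝ (Fin m) → ℝ} {Ω : Type*} [MeasurableSpace Ω] {P : Measure Ω}
    [IsProbabilityMeasure P] {X : ℕ → Ω → EuclideanSpace ℝ (Fin m)} {k : ℕ → ℕ}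
    (hd : 2 ≤ d) (hM : IsC2Submanifold d M)
    (hA : IsSubmanifoldWithBoundary d M A) (hAc : IsCompact A) (hBA : B ⊆ A) (hBc : IsClosed B)
    (hf : IsDensityOn d M A f) (hfc : ContinuousOn f A) (hf_pos : 0 < infOn f B)
    (hB : B = closure (relInterior M B))
    (hB_bdry : B ∩ relBoundary M A = closure (relInterior A B ∩ relBoundary M A))
    (hX : ∀ i, Measurable (X i)) (hind : iIndepFun X P)
    (hlaw : ∀ i, P.map (X i) = densityMeasure d M f) (hk1 : ∀ n, 1 ≤ n → 1 ≤ k n)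
    (hk : Tendsto (fun n : ℕ => (k n : ℝ) / Real.log n) atTop atTop)
    (hkn : Tendsto (fun n : ℕ => (k n : ℝ) / n) atTop (𝓝 0)) :
    ∀ᵐ ω ∂P, Tendsto (fun n : ℕ => (n : ℝ≥0∞) * ENNReal.ofReal (unitBallVolume d) *
        coverageThreshold M B (sample X n ω) (k n) ^ d / (k n : ℝ≥0∞)) atTop
      (𝓝 (max (1 / infOn f B) (2 / infOn f (B ∩ relBoundary M A)))) := by
  have hd0 : d ≠ 0 := by omega
  have ht : ∀ᶠ n in atTop, 0 < (k n : ℝ) := by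
    filter_upwards [eventually_ge_atTop 1] with n hn
    exact_mod_cast hk1 n hn
  -- With t = k(n) the critical normalized mean is 1 both in the interior and on the boundary.
  have h := ae_tendsto_threshold (t := fun n => (k n : ℝ)) (b := 0) (h₀ := 1) (h₁ := 1) hd hM hA
    hAc hBA hBc hf hfc hf_pos hB hB_bdry hX hind hlaw ht hkn le_rfl one_pos one_pos
    (fun κ₁ κ₂ u hu hcov h₀ h₁ => ae_eventually_covered hX hind hlaw hd0 hcov le_rfl
      (Nat.sub_le _ _) hk hkn hu h₀ h₁)
    (fun κ u hu hκ hpack _ h₀ => ae_eventually_not_covered hX hind hlaw hd0 hpack hk hkn hu hκ h₀)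
    (fun κ u hu hκ hpack _ h₁ => ae_eventually_not_covered hX hind hlaw hd0 hpack hk hkn hu hκ h₁)
  simpa using h

lemma tendsto_div_log_of_tendsto_ofReal {k : ℕ → ℕ} {β : ℝ≥0∞} (hβ : β < ∞)
    (hk : Tendsto (fun n : ℕ => ENNReal.ofReal ((k n : ℝ) / Real.log n)) atTop (𝓝 β)) :
    Tendsto (fun n : ℕ => (k n : ℝ) / Real.log n) atTop (𝓝 β.toReal) := by
  refine ((ENNReal.tendsto_toReal hβ.ne).comp hk).congr fun n => ?_
  exact ENNReal.toReal_ofReal (div_nonneg (by positivity) (Real.log_natCast_nonneg n))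

lemma tendsto_atTop_of_tendsto_ofReal_top {x : ℕ → ℝ}
    (hx : Tendsto (fun n => ENNReal.ofReal (x n)) atTop (𝓝 ∞)) : Tendsto x atTop atTop := by
  refine tendsto_atTop.2 fun b => ?_
  filter_upwards [hx.eventually_const_lt (ENNReal.ofReal_lt_top (r := b))] with n hn
  exact (lt_of_not_ge fun h => absurd (ENNReal.ofReal_le_ofReal h) (not_le.2 hn)).le

/-- The points of a sample may be modified on null sets so that they become measurable. -/
lemma exists_measurable_modification {m : ℕ} {Ω : Type*} [MeasurableSpace Ω] {P : Measure Ω}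
    {μ : Measure (EuclideanSpace ℝ (Fin m))}
    {X : ℕ → Ω → EuclideanSpace ℝ (Fin m)} (hind : iIndepFun X P)
    (hlaw : ∀ i, HasLaw (X i) μ P) :
    ∃ Y : ℕ → Ω → EuclideanSpace ℝ (Fin m), (∀ i, Measurable (Y i)) ∧ iIndepFun Y P ∧
      (∀ i, P.map (Y i) = μ) ∧ ∀ᵐ ω ∂P, ∀ n, sample Y n ω = sample X n ω := by
  refine ⟨fun i => (hlaw i).aemeasurable.mk (X i), fun i => (hlaw i).aemeasurable.measurable_mk,
    hind.congr fun i => (hlaw i).aemeasurable.ae_eq_mk, fun i => ?_, ?_⟩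
  · rw [← Measure.map_congr (hlaw i).aemeasurable.ae_eq_mk, (hlaw i).map_eq]
  · have h := ae_all_iff.2 fun i => (hlaw i).aemeasurable.ae_eq_mk
    filter_upwards [h] with ω hω n
    simp only [sample]
    exact Set.image_congr fun i _ => (hω i).symm

end Coverage

end

theorem mainTheorem2 {d m : ℕ} (hd : 2 ≤ d)
    {M A B : Set (EuclideanSpace ℝ (Fin m))}
    (hM : IsC2Submanifold d M)
    (hA : IsSubmanifoldWithBoundary d M A) (hA_compact : IsCompact A)
    (hBA : B ⊆ A) (hB_closed : IsClosed B)
    {f : EuclideanSpace ℝ (Fin m) → ℝ}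
    (hf : IsDensityOn d M A f)
    (hf_cont : ContinuousOn f A)
    (hf_pos : 0 < infOn f B)
    (hB : B = closure (relInterior M B))
    (hB_bdry : B ∩ relBoundary M A = closure (relInterior A B ∩ relBoundary M A))
    (hB_mass : 0 < ∫⁻ x in B, ENNReal.ofReal (f x) ∂(riemannianVolume d M))
    {Ω : Type*} [MeasurableSpace Ω] {P : Measure Ω} [IsProbabilityMeasure P]
    {X : ℕ → Ω → EuclideanSpace ℝ (Fin m)}
    (hX_indep : iIndepFun X P)
    (hX_law : ∀ i, HasLaw (X i) (densityMeasure d M f) P) :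
    (∀ (k : ℕ → ℕ) (β : ℝ≥0∞), (∀ n, 1 ≤ n → 1 ≤ k n) →
      Tendsto (fun n : ℕ => ENNReal.ofReal ((k n : ℝ) / Real.log n)) atTop (𝓝 β) →
      Tendsto (fun n : ℕ => (k n : ℝ) / (n : ℝ)) atTop (𝓝 0) →
      (β = ∞ → ∀ᵐ ω ∂P, Tendsto
        (fun n : ℕ => (n : ℝ≥0∞) * ENNReal.ofReal (unitBallVolume d) *
          coverageThreshold M B (sample X n ω) (k n) ^ d / (k n : ℝ≥0∞))
        atTop (𝓝 (max (1 / infOn f B) (2 / infOn f (B ∩ relBoundary M A))))) ∧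
      (β < ∞ → ∀ᵐ ω ∂P, Tendsto
        (fun n : ℕ => (n : ℝ≥0∞) * ENNReal.ofReal (unitBallVolume d) *
          coverageThreshold M B (sample X n ω) (k n) ^ d / ENNReal.ofReal (Real.log n))
        atTop (𝓝 (max (ENNReal.ofReal (hatH β.toReal 1) / infOn f B)
          (ENNReal.ofReal (2 * hatH β.toReal (1 - 1 / (d : ℝ))) /
            infOn f (B ∩ relBoundary M A)))))) ∧
    (∀ k : ℕ, 1 ≤ k → ∀ᵐ ω ∂P, Tendsto
      (fun n : ℕ => (n : ℝ≥0∞) * ENNReal.ofReal (unitBallVolume d) *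
        coverageThreshold M B (sample X n ω) k ^ d / ENNReal.ofReal (Real.log n))
      atTop (𝓝 (max (1 / infOn f B)
        (ENNReal.ofReal (2 - 2 / (d : ℝ)) / infOn f (B ∩ relBoundary M A))))) := by
  obtain ⟨Y, hY, hY_indep, hY_law, hYX⟩ := exists_measurable_modification hX_indep hX_law
  refine ⟨fun k β hk1 hk hkn => ⟨?_, fun hβ => ?_⟩, fun k hk1 => ?_⟩
  · rintro rfl
    filter_upwards [hYX, ae_tendsto_threshold_of_log_lt hd hM hA hA_compact hBA hB_closed hf hf_cont
      hf_pos hB hB_bdry hY hY_indep hY_law hk1 (tendsto_atTop_of_tendsto_ofReal_top hk) hkn]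
      with ω h1 h2
    simpa only [h1] using h2
  · filter_upwards [hYX, ae_tendsto_threshold_log hd hM hA hA_compact hBA hB_closed hf hf_cont
      hf_pos hB hB_bdry hY hY_indep hY_law hk1 ENNReal.toReal_nonneg
      (tendsto_div_log_of_tendsto_ofReal hβ hk)] with ω h1 h2
    simpa only [h1] using h2
  -- A constant k has β = 0, where the rate is the identity and `hatH 0 x = x`.
  · have h := ae_tendsto_threshold_log hd hM hA hA_compact hBA hB_closed hf hf_cont
      hf_pos hB hB_bdry hY hY_indep hY_law (k := fun _ => k) (fun _ _ => hk1) le_rfl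
      (tendsto_log_nat.const_div_atTop (k : ℝ))
    rw [hatH_zero zero_le_one, hatH_zero (one_sub_one_div_pos hd).le, ENNReal.ofReal_one,
      show 2 * (1 - 1 / (d : ℝ)) = 2 - 2 / (d : ℝ) by ring] at h
    filter_upwards [hYX, h] with ω h1 h2
    simpa only [h1] using h2
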